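/- Let $\mathcal H$ be a complex Hilbert space, $\mathcal F(\mathcal H)$ the Bose Fock space over $\mathcal H$ with vacuum vector $\Omega$, creation and annihilation operators $a(\xi)^*,a(\xi)$, and Weyl operators $W(\xi)=\exp\big(i\,\overline{(a(\xi)^*+a(\xi))}\big)$, $\xi\in\mathcal H$. Let $H\subset\mathcal H$ be a closed real linear subspace, $\mathcal M(H)=\{W(h):h\in H\}''\subset\mathcal B(\mathcal F(\mathcal H))$, and let $E_H$ be the real orthogonal projection of $\mathcal H$ onto $H$ with respect to $\mathrm{Re}\,\langle\cdot,\cdot\rangle$. Let $X_1$ be a (possibly unbounded) complex linear self-adjoint operator on $\mathcal H$, and let $X=\bigoplus_{n\ge 0}X_1^{\otimes n}$ be its second quantization on $\mathcal F(\mathcal H)$ (the closure of the operator $a(f_1)^*\cdots a(f_n)^*\Omega\mapsto a(X_1f_1)^*\cdots a(X_1f_n)^*\Omega$, $f_j\in\mathrm{dom}(X_1)$). Assume $H\subset\mathrm{dom}(X_1)$ and $\mathcal M(H)\Omega\subset\mathrm{dom}(X)$, and define the linear map $$\Xi_{H,X_1}:\mathcal M(H)\to\mathcal F(\mathcal H),\qquad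 A\mapsto XA\Omega .$$ For a linear map $T$ between real or complex normed spaces let $\alpha_n(T)=\inf\{\|T-S\| : S \text{ bounded linear of rank}\le n\}$ and $\|T\|_p=\big(\sum_{n=0}^\infty\alpha_n(T)^p\big)^{1/p}\in[0,\infty]$ for $p>0$; $T$ is called $\ell^p$ if $\|T\|_p<\infty$, and $\ell^\infty$ if it is compact. For a real linear operator on $\mathcal H$, regarded as a real Hilbert space (with real linear $S$ and real rank), one writes $\|T\|_{\mathbb R,p}$ and $\ell^p_{\mathbb R}(\mathcal H)$. For $0<p\le1$, $T:B_1\to B_2$ is called $p$-nuclear if there are $\varphi_n\in B_1^*$ and $b_n\in B_2$ with $T(b)=\sum_n\varphi_n(b)\,b_n$ for all $b\in B_1$ and $\sum_n\|\varphi_n\|^p\|b_n\|^p<\infty$. Then: (a) If $X_1E_H$ is $\ell^p_{\mathbb R}(\mathcal H)$ for some $0<p\le 1$ and $\|X_1E_H\|<1$, then $\Xi_{H,X_1}$ is $p$-nuclear; it is compact; and, if $p<1$, it is $\ell^q$ for every real $q>p/(1-p)$. In particular, if $\|X_1E_H\|<1$ and $X_1E_H$ is $\ell^p_{\mathbb R}(\mathcal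 H)$ for all $p>0$, then $\Xi_{H,X_1}$ is $\ell^q$ for all $q>0$. (b) For all $p>0$, $\ \|X_1E_H\|_{\mathbb R,p}\le\sqrt e\,2^{1/p}\,\|\Xi_{H,X_1}\|_p$ (as an inequality in $[0,\infty]$). -/

import Mathlib

open scoped ComplexInnerProductSpace ENNReal

noncomputable section

section ApproximationNumbers

variable {𝕜 E F : Type*} [NontriviallyNormedField 𝕜]
  [NormedAddCommGroup E] [NormedSpace 𝕜 E] [NormedAddCommGroup F] [NormedSpace 𝕜 F]

/-- The operator norm of a linear map, with value `∞` for an unbounded map. -/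
def opENorm (T : E →ₗ[𝕜] F) : ℝ≥0∞ :=
  ⨆ (x : E) (_ : ‖x‖ ≤ 1), ‖T x‖ₑ

/-- The `n`-th approximation number `inf { ‖T - S‖ : S bounded of rank ≤ n }`
(it is `∞` if `T` is unbounded). The rank is taken over the field `𝕜`. -/
def approxNumber (n : ℕ) (T : E →ₗ[𝕜] F) : ℝ≥0∞ :=
  ⨅ (S : E →L[𝕜] F) (_ : LinearMap.rank (S : E →ₗ[𝕜] F) ≤ n), opENorm (T - (S : E →ₗ[𝕜] F))

/-- The `ℓ^p` quasi-norm `(∑_{n ≥ 0} α_n(T)^p)^{1/p}`, possibly `∞`. -/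
def ellQuasiNorm (p : ℝ) (T : E →ₗ[𝕜] F) : ℝ≥0∞ :=
  (∑' n : ℕ, approxNumber n T ^ p) ^ (1 / p)

/-- `T` is an `ℓ^p` map. For `𝕜 = ℝ` this is the real version of the notion. -/
def IsEll (p : ℝ) (T : E →ₗ[𝕜] F) : Prop :=
  ellQuasiNorm p T < ∞

/-- `T` is `p`-nuclear: `T b = ∑ₙ φₙ(b) bₙ` with `∑ₙ ‖φₙ‖^p ‖bₙ‖^p < ∞`. -/
def IsPNuclear (p : ℝ) (T : E →ₗ[𝕜] F) : Prop :=
  ∃ (φ : ℕ → (E →L[𝕜] 𝕜)) (b : ℕ → F),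
    (∀ x : E, HasSum (fun n => φ n x • b n) (T x)) ∧
      Summable fun n => ‖φ n‖ ^ p * ‖b n‖ ^ p

end ApproximationNumbers

section Fock

variable {ℋ : Type*} [NormedAddCommGroup ℋ] [InnerProductSpace ℂ ℋ]

/-- The annihilation operator `a(ξ)` on polynomials in the symbols `X f`, `f ∈ ℋ`: the derivation
with `a(ξ) (X f) = ⟪ξ, f⟫`. -/
def polyAnnihilation (ξ : ℋ) : Derivation ℂ (MvPolynomial ℋ ℂ) (MvPolynomial ℋ ℂ) :=
  MvPolynomial.mkDerivation ℂ fun f => MvPolynomial.C ⟪ξ, f⟫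

theorem polyAnnihilation_comm (ξ η : ℋ) (q : MvPolynomial ℋ ℂ) :
    polyAnnihilation ξ (polyAnnihilation η q) = polyAnnihilation η (polyAnnihilation ξ q) := by
  have h : ⁅polyAnnihilation ξ, polyAnnihilation η⁆ = 0 := by
    apply MvPolynomial.derivation_ext
    intro i
    simp [Derivation.commutator_apply, polyAnnihilation]
  have := congrArg (fun D => D q) h
  simpa [Derivation.commutator_apply, sub_eq_zero] using this

/-- The map `(ξ, q) ↦ a(ξ) q`. -/
def annihilate (ξ : ℋ) (q : MvPolynomial ℋ ℂ) : MvPolynomial ℋ ℂ :=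
  polyAnnihilation ξ q

instance : LeftCommutative (annihilate (ℋ := ℋ)) :=
  ⟨polyAnnihilation_comm⟩

/-- `⟨Ω, a(f₁) ⋯ a(fₙ) q⟩` for the multiset `{f₁, …, fₙ}`; the operators `a(f)` commute and the
vacuum expectation of a polynomial is its constant coefficient. -/
def vacuumPairing (s : Multiset ℋ) (q : MvPolynomial ℋ ℂ) : ℂ :=
  MvPolynomial.constantCoeff (s.foldr annihilate q)

/-- The Fock inner product of polynomials, determined by
`⟨X f₁ ⋯ X fₙ, q⟩ = ⟨Ω, a(f₁) ⋯ a(fₙ) q⟩` and conjugate linearity in the first entry. Hence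
`⟨X f₁ ⋯ X fₙ, X g₁ ⋯ X gₘ⟩` is `∑_σ ∏ᵢ ⟪fᵢ, g_{σ i}⟫` if `n = m` and `0` otherwise. -/
def polyInner (p q : MvPolynomial ℋ ℂ) : ℂ :=
  ∑ μ ∈ p.support, (starRingEnd ℂ) (p.coeff μ) * vacuumPairing (Finsupp.toMultiset μ) q

theorem polyInner_eq_of_subset (p q : MvPolynomial ℋ ℂ) (t : Finset (ℋ →₀ ℕ))
    (h : p.support ⊆ t) : polyInner p q =
      ∑ μ ∈ t, (starRingEnd ℂ) (p.coeff μ) * vacuumPairing (Finsupp.toMultiset μ) q := by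
  refine Finset.sum_subset h fun μ _ hμ => ?_
  rw [MvPolynomial.notMem_support_iff.1 hμ]
  simp

theorem polyInner_add_left (p p' q : MvPolynomial ℋ ℂ) :
    polyInner (p + p') q = polyInner p q + polyInner p' q := by
  classical
  rw [polyInner_eq_of_subset (p + p') q (p.support ∪ p'.support) MvPolynomial.support_add,
    polyInner_eq_of_subset p q _ Finset.subset_union_left,
    polyInner_eq_of_subset p' q _ Finset.subset_union_right, ← Finset.sum_add_distrib]
  simp [add_mul]

theorem polyInner_smul_left (p q : MvPolynomial ℋ ℂ) (r : ℂ) :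
    polyInner (r • p) q = (starRingEnd ℂ) r * polyInner p q := by
  rw [polyInner_eq_of_subset (r • p) q p.support MvPolynomial.support_smul, polyInner,
    Finset.mul_sum]
  simp [mul_assoc]

/-- The diagonal pairing `∑_μ μ! conj(P_μ) Q_μ` of polynomials in finitely many variables. -/
def finPairing {d : ℕ} (P Q : MvPolynomial (Fin d) ℂ) : ℂ :=
  ∑ μ ∈ P.support, (starRingEnd ℂ) (P.coeff μ) * ((∏ i, (μ i).factorial : ℕ) * Q.coeff μ)

theorem finPairing_eq_of_subset {d : ℕ} (P Q : MvPolynomial (Fin d) ℂ) (t : Finset (Fin d →₀ ℕ))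
    (h : P.support ⊆ t) : finPairing P Q =
      ∑ μ ∈ t, (starRingEnd ℂ) (P.coeff μ) * ((∏ i, (μ i).factorial : ℕ) * Q.coeff μ) := by
  refine Finset.sum_subset h fun μ _ hμ => ?_
  rw [MvPolynomial.notMem_support_iff.1 hμ]
  simp

theorem finPairing_add_left {d : ℕ} (P P' Q : MvPolynomial (Fin d) ℂ) :
    finPairing (P + P') Q = finPairing P Q + finPairing P' Q := by
  classical
  rw [finPairing_eq_of_subset (P + P') Q (P.support ∪ P'.support) MvPolynomial.support_add,
    finPairing_eq_of_subset P Q _ Finset.subset_union_left,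
    finPairing_eq_of_subset P' Q _ Finset.subset_union_right, ← Finset.sum_add_distrib]
  simp [add_mul]

theorem finPairing_smul_left {d : ℕ} (P Q : MvPolynomial (Fin d) ℂ) (r : ℂ) :
    finPairing (r • P) Q = (starRingEnd ℂ) r * finPairing P Q := by
  rw [finPairing_eq_of_subset (r • P) Q P.support MvPolynomial.support_smul, finPairing,
    Finset.mul_sum]
  simp [mul_assoc]

/-- `finPairing` as a conjugate linear map in its first entry. -/
def finPairingHom {d : ℕ} (Q : MvPolynomial (Fin d) ℂ) :
    MvPolynomial (Fin d) ℂ →ₛₗ[starRingEnd ℂ] ℂ where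
  toFun P := finPairing P Q
  map_add' P P' := finPairing_add_left P P' Q
  map_smul' r P := finPairing_smul_left P Q r

theorem finPairing_conj_symm {d : ℕ} (P Q : MvPolynomial (Fin d) ℂ) :
    (starRingEnd ℂ) (finPairing Q P) = finPairing P Q := by
  classical
  rw [finPairing_eq_of_subset P Q (P.support ∪ Q.support) Finset.subset_union_left,
    finPairing_eq_of_subset Q P (P.support ∪ Q.support) Finset.subset_union_right, map_sum]
  refine Finset.sum_congr rfl fun μ _ => ?_
  simp only [map_mul, Complex.conj_conj, map_natCast]
  ring

theorem finPairing_self_nonneg {d : ℕ} (P : MvPolynomial (Fin d) ℂ) :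
    0 ≤ (finPairing P P).re := by
  rw [finPairing, Complex.re_sum]
  refine Finset.sum_nonneg fun μ _ => ?_
  have : (starRingEnd ℂ) (P.coeff μ) * ((∏ i, (μ i).factorial : ℕ) * P.coeff μ)
      = (((∏ i, (μ i).factorial : ℕ) * Complex.normSq (P.coeff μ) : ℝ) : ℂ) := by
    push_cast
    rw [Complex.normSq_eq_conj_mul_self]
    ring
  rw [this, Complex.ofReal_re]
  exact mul_nonneg (Nat.cast_nonneg _) (Complex.normSq_nonneg _)

theorem finPairing_monomial {d : ℕ} (μ : Fin d →₀ ℕ) (Q : MvPolynomial (Fin d) ℂ) :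
    finPairing (MvPolynomial.monomial μ 1) Q = (∏ i, (μ i).factorial : ℕ) * Q.coeff μ := by
  classical
  rw [finPairing_eq_of_subset _ Q {μ} MvPolynomial.support_monomial_subset]
  simp

theorem finPairing_X_mul {d : ℕ} (i : Fin d) (P Q : MvPolynomial (Fin d) ℂ) :
    finPairing (MvPolynomial.X i * P) Q = finPairing P (MvPolynomial.pderiv i Q) := by
  classical
  induction P using MvPolynomial.induction_on' with
  | monomial μ c =>
    have h1 : (MvPolynomial.monomial μ c : MvPolynomial (Fin d) ℂ)
        = c • MvPolynomial.monomial μ 1 := by simp [MvPolynomial.smul_monomial]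
    rw [h1, mul_smul_comm, finPairing_smul_left, finPairing_smul_left]
    congr 1
    rw [mul_comm, MvPolynomial.X, MvPolynomial.monomial_mul, one_mul, finPairing_monomial,
      finPairing_monomial, MvPolynomial.coeff_pderiv]
    have : (∏ j, ((μ + Finsupp.single i 1 : Fin d →₀ ℕ) j).factorial)
        = (μ i + 1) * ∏ j, (μ j).factorial := by
      rw [← Finset.mul_prod_erase _ _ (Finset.mem_univ i),
        ← Finset.mul_prod_erase Finset.univ (fun j => (μ j).factorial) (Finset.mem_univ i)]
      rw [Finset.prod_congr rfl (g := fun j => (μ j).factorial)]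
      · simp [Nat.factorial_succ, mul_assoc]
      · intro j hj
        have : i ≠ j := fun h => by simp [h] at hj
        simp [this]
    rw [this]
    push_cast
    ring
  | add P P' h h' =>
    rw [mul_add, finPairing_add_left, finPairing_add_left, h, h']

/-- Expansion of the symbols `X f` in finitely many orthonormal directions. -/
def expandFin {d : ℕ} (e : Fin d → ℋ) : MvPolynomial ℋ ℂ →ₐ[ℂ] MvPolynomial (Fin d) ℂ :=
  MvPolynomial.aeval fun f => ∑ i, ⟪e i, f⟫ • MvPolynomial.X i

theorem expandFin_annihilate {d : ℕ} (e : Fin d → ℋ) (f : ℋ)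
    (hf : ∀ g : ℋ, ⟪f, g⟫ = ∑ i, ⟪f, e i⟫ * ⟪e i, g⟫) (q : MvPolynomial ℋ ℂ) :
    expandFin e (annihilate f q) = ∑ i, ⟪f, e i⟫ • MvPolynomial.pderiv i (expandFin e q) := by
  classical
  unfold annihilate
  induction q using MvPolynomial.induction_on with
  | C c => simp [expandFin]
  | add p q hp hq => simp [hp, hq, Finset.sum_add_distrib]
  | mul_X p g hp =>
    have hX : expandFin e (MvPolynomial.X g) = ∑ i, ⟪e i, g⟫ • MvPolynomial.X i := by
      simp [expandFin]
    have hD : ∀ i, MvPolynomial.pderiv i (expandFin e (MvPolynomial.X g))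
        = MvPolynomial.C ⟪e i, g⟫ := by
      intro i
      rw [hX]
      simp [MvPolynomial.pderiv_X, Pi.single_apply, MvPolynomial.smul_eq_C_mul]
    have hC : expandFin e (polyAnnihilation f (MvPolynomial.X g)) = MvPolynomial.C ⟪f, g⟫ := by
      simp [polyAnnihilation, expandFin]
    rw [Derivation.leibniz, map_add, smul_eq_mul, smul_eq_mul, map_mul, map_mul, hp, hC, map_mul]
    simp only [Derivation.leibniz, hD, smul_eq_mul, smul_add, Finset.sum_add_distrib]
    congr 1
    · rw [hf g, map_sum, Finset.mul_sum]
      refine Finset.sum_congr rfl fun i _ => ?_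
      rw [MvPolynomial.smul_eq_C_mul, map_mul]
      ring
    · rw [Finset.mul_sum]
      exact Finset.sum_congr rfl fun i _ => by rw [mul_smul_comm]

theorem foldr_annihilate (s : Multiset ℋ) (f : ℋ) (q : MvPolynomial ℋ ℂ) :
    (f ::ₘ s).foldr annihilate q = s.foldr annihilate (annihilate f q) := by
  induction s using Multiset.induction_on with
  | empty => simp
  | cons g s ih =>
    rw [Multiset.cons_swap, Multiset.foldr_cons, ih, Multiset.foldr_cons]

theorem finPairing_sum_smul_right {d : ℕ} (P : MvPolynomial (Fin d) ℂ) (c : Fin d → ℂ)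
    (Q : Fin d → MvPolynomial (Fin d) ℂ) :
    finPairing P (∑ i, c i • Q i) = ∑ i, c i * finPairing P (Q i) := by
  simp only [finPairing, MvPolynomial.coeff_sum, MvPolynomial.coeff_smul, Finset.mul_sum,
    smul_eq_mul]
  rw [Finset.sum_comm]
  exact Finset.sum_congr rfl fun i _ => Finset.sum_congr rfl fun μ _ => by ring

theorem vacuumPairing_eq {d : ℕ} (e : Fin d → ℋ) (s : Multiset ℋ)
    (hs : ∀ f ∈ s, ∀ g : ℋ, ⟪f, g⟫ = ∑ i, ⟪f, e i⟫ * ⟪e i, g⟫) (q : MvPolynomial ℋ ℂ) :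
    vacuumPairing s q = finPairing (expandFin e (s.map MvPolynomial.X).prod) (expandFin e q) := by
  induction s using Multiset.induction_on generalizing q with
  | empty =>
    have h1 : (1 : MvPolynomial (Fin d) ℂ) = MvPolynomial.monomial 0 1 := rfl
    simp only [vacuumPairing, Multiset.foldr_zero, Multiset.map_zero, Multiset.prod_zero, map_one]
    rw [h1, finPairing_monomial]
    simp only [Finsupp.coe_zero, Pi.zero_apply, Nat.factorial_zero, Finset.prod_const_one,
      Nat.cast_one, one_mul, ← MvPolynomial.constantCoeff_eq]
    induction q using MvPolynomial.induction_on with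
    | C c => simp [expandFin]
    | add p q hp hq => simp [hp, hq]
    | mul_X p g hp => simp [expandFin]
  | cons f s ih =>
    have hv : vacuumPairing (f ::ₘ s) q = vacuumPairing s (annihilate f q) := by
      simp only [vacuumPairing, foldr_annihilate]
    rw [hv, ih (fun g hg => hs g (Multiset.mem_cons_of_mem hg)),
      expandFin_annihilate e f (hs f (Multiset.mem_cons_self f s)), finPairing_sum_smul_right,
      Multiset.map_cons, Multiset.prod_cons, map_mul]
    have hX : expandFin e (MvPolynomial.X f) = ∑ i, ⟪e i, f⟫ • MvPolynomial.X i := by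
      simp [expandFin]
    rw [hX, Finset.sum_mul]
    change _ = finPairingHom _ _
    rw [map_sum]
    refine Finset.sum_congr rfl fun i _ => ?_
    change _ = finPairing _ _
    rw [smul_mul_assoc, finPairing_smul_left, finPairing_X_mul, inner_conj_symm]

theorem polyInner_eq_finPairing {d : ℕ} (e : Fin d → ℋ) (p q : MvPolynomial ℋ ℂ)
    (hp : ∀ f ∈ p.vars, ∀ g : ℋ, ⟪f, g⟫ = ∑ i, ⟪f, e i⟫ * ⟪e i, g⟫) :
    polyInner p q = finPairing (expandFin e p) (expandFin e q) := by
  conv_rhs => rw [p.as_sum, map_sum]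
  change _ = finPairingHom _ _
  rw [map_sum, polyInner]
  refine Finset.sum_congr rfl fun μ hμ => ?_
  change _ = finPairing _ _
  have h1 : MvPolynomial.monomial μ (p.coeff μ)
      = p.coeff μ • ((Finsupp.toMultiset μ).map MvPolynomial.X).prod := by
    rw [Finsupp.toMultiset_map, Finsupp.prod_toMultiset, MvPolynomial.smul_eq_C_mul,
      MvPolynomial.monomial_eq]
    congr 1
    rw [Finsupp.prod_mapDomain_index (by simp) (by intros; rw [pow_add])]
  rw [h1, map_smul, finPairing_smul_left, vacuumPairing_eq e]
  intro f hf
  refine hp f ((MvPolynomial.mem_vars_iff_mem_support f).2 ⟨μ, hμ, ?_⟩)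
  simpa using hf

theorem exists_expansion (s : Finset ℋ) : ∃ (d : ℕ) (e : Fin d → ℋ),
    ∀ f ∈ s, ∀ g : ℋ, ⟪f, g⟫ = ∑ i, ⟪f, e i⟫ * ⟪e i, g⟫ := by
  let V : Submodule ℂ ℋ := Submodule.span ℂ (s : Set ℋ)
  have : FiniteDimensional ℂ V := FiniteDimensional.span_finset ℂ s
  let b := stdOrthonormalBasis ℂ V
  refine ⟨_, fun i => (b i : ℋ), fun f hf g => ?_⟩
  have hfV : f ∈ V := Submodule.subset_span hf
  have h : f = ∑ i, ⟪(b i : ℋ), f⟫ • (b i : ℋ) := by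
    have := congrArg (Subtype.val) (b.sum_repr' ⟨f, hfV⟩)
    simpa using this.symm
  conv_lhs => rw [h, sum_inner]
  refine Finset.sum_congr rfl fun i _ => ?_
  rw [inner_smul_left, inner_conj_symm]

theorem polyInner_conj_symm (p q : MvPolynomial ℋ ℂ) :
    (starRingEnd ℂ) (polyInner q p) = polyInner p q := by
  classical
  obtain ⟨d, e, he⟩ := exists_expansion (p.vars ∪ q.vars)
  rw [polyInner_eq_finPairing e p q fun f hf => he f (Finset.mem_union_left _ hf),
    polyInner_eq_finPairing e q p fun f hf => he f (Finset.mem_union_right _ hf),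
    finPairing_conj_symm]

theorem polyInner_self_nonneg (p : MvPolynomial ℋ ℂ) : 0 ≤ (polyInner p p).re := by
  obtain ⟨d, e, he⟩ := exists_expansion p.vars
  rw [polyInner_eq_finPairing e p p he]
  exact finPairing_self_nonneg _

variable (ℋ) in
/-- The algebraic Bose Fock space over `ℋ`: polynomials in symbols `X f`, one for each `f ∈ ℋ`.
The monomial `X f₁ ⋯ X fₙ` stands for the vector `a(f₁)^* ⋯ a(fₙ)^* Ω`, that is for `√n!` times the
symmetrized tensor `f₁ ⊗ ⋯ ⊗ fₙ`, and `1` stands for `Ω`. The linear relations among these vectors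
(such as `X (f + g) = X f + X g`) hold up to vectors of norm zero for the semi-inner product
`polyInner`, and become identities in the Hausdorff completion `FockSpace ℋ`. -/
def PreFock : Type _ := MvPolynomial ℋ ℂ

instance : AddCommGroup (PreFock ℋ) := inferInstanceAs (AddCommGroup (MvPolynomial ℋ ℂ))

instance : Module ℂ (PreFock ℋ) := inferInstanceAs (Module ℂ (MvPolynomial ℋ ℂ))

/-- The semi-inner product of the algebraic Fock space. -/
instance preFockCore : PreInnerProductSpace.Core ℂ (PreFock ℋ) where
  inner := polyInner (ℋ := ℋ)
  conj_inner_symm := polyInner_conj_symm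
  re_inner_nonneg := polyInner_self_nonneg
  add_left := polyInner_add_left
  smul_left := polyInner_smul_left

instance : SeminormedAddCommGroup (PreFock ℋ) :=
  InnerProductSpace.Core.toSeminormedAddCommGroup (𝕜 := ℂ)

instance : InnerProductSpace ℂ (PreFock ℋ) := InnerProductSpace.ofCore preFockCore

variable (ℋ) in
/-- The Bose Fock space over `ℋ`, the Hilbert space completion of the algebraic Fock space. -/
abbrev FockSpace : Type _ := UniformSpace.Completion (PreFock ℋ)

/-- The vector of Fock space given by a polynomial. The range of this map is the dense
space of (algebraic) finite particle vectors. -/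
def polyVec : MvPolynomial ℋ ℂ →ₗ[ℂ] FockSpace ℋ where
  toFun p := ((show PreFock ℋ from p : PreFock ℋ) : FockSpace ℋ)
  map_add' p q := UniformSpace.Completion.coe_add (show PreFock ℋ from p) (show PreFock ℋ from q)
  map_smul' c p := UniformSpace.Completion.coe_smul c (show PreFock ℋ from p)

variable (ℋ) in
/-- The Fock vacuum `Ω`. -/
def vacuum : FockSpace ℋ := polyVec 1

/-- The operator `a(ξ)^* + a(ξ)` on finite particle vectors: `a(ξ)^*` multiplies by `X ξ`, and
`a(ξ)` is the derivation with `a(ξ) (X f) = ⟪ξ, f⟫`. -/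
def fieldOp (ξ : ℋ) : Module.End ℂ (MvPolynomial ℋ ℂ) :=
  LinearMap.mulLeft ℂ (MvPolynomial.X ξ) + (polyAnnihilation ξ : MvPolynomial ℋ ℂ →ₗ[ℂ] _)

/-- `W` is the Weyl operator `W(ξ) = exp(i (a(ξ)^* + a(ξ))‾)`. The finite particle vectors form a
dense invariant domain of entire analytic vectors for the essentially self-adjoint operator
`a(ξ)^* + a(ξ)`, so `W(ξ)` is the unique bounded operator given by the exponential series there. -/
def IsWeylOperator (ξ : ℋ) (W : FockSpace ℋ →L[ℂ] FockSpace ℋ) : Prop :=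
  ∀ q : MvPolynomial ℋ ℂ,
    HasSum (fun k : ℕ => (Complex.I ^ k / (k.factorial : ℂ)) • polyVec ((fieldOp ξ ^ k) q))
      (W (polyVec q))

/-- The von Neumann algebra `M(H) = {W(h) : h ∈ H}''`, as a double commutant. -/
def secondQuantizedAlgebra (H : ClosedSubmodule ℝ ℋ) :
    Subalgebra ℂ (FockSpace ℋ →L[ℂ] FockSpace ℋ) :=
  Subalgebra.centralizer ℂ (Subalgebra.centralizer ℂ
    {W : FockSpace ℋ →L[ℂ] FockSpace ℋ | ∃ h ∈ H, IsWeylOperator h W} :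
      Set (FockSpace ℋ →L[ℂ] FockSpace ℋ))

/-- The graph of the algebraic second quantization of `X₁`, which maps
`a(f₁)^* ⋯ a(fₙ)^* Ω` to `a(X₁ f₁)^* ⋯ a(X₁ fₙ)^* Ω` for `f₁, …, fₙ ∈ dom X₁`. -/
def secondQuantizationGraph (X₁ : ℋ →ₗ.[ℂ] ℋ) : Submodule ℂ (FockSpace ℋ × FockSpace ℋ) :=
  LinearMap.range
    ((polyVec ∘ₗ (MvPolynomial.rename (fun f : X₁.domain => (f : ℋ))).toLinearMap).prod
      (polyVec ∘ₗ (MvPolynomial.rename (fun f : X₁.domain => X₁ f)).toLinearMap))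

/-- The second quantization `X = ⨁ₙ X₁^{⊗ n}` of `X₁` on the Bose Fock space, the operator whose
graph is the closure of the graph of the algebraic second quantization. -/
def secondQuantization (X₁ : ℋ →ₗ.[ℂ] ℋ) : FockSpace ℋ →ₗ.[ℂ] FockSpace ℋ :=
  (secondQuantizationGraph X₁).topologicalClosure.toLinearPMap

/-- The map `Ξ_{H,X₁} : M(H) → F(ℋ)`, `A ↦ X A Ω`. -/
def xiMap (H : ClosedSubmodule ℝ ℋ) (X₁ : ℋ →ₗ.[ℂ] ℋ)
    (hX : ∀ A ∈ secondQuantizedAlgebra H, A (vacuum ℋ) ∈ (secondQuantization X₁).domain) :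
    secondQuantizedAlgebra H →ₗ[ℂ] FockSpace ℋ where
  toFun A := secondQuantization X₁
    ⟨(A : FockSpace ℋ →L[ℂ] FockSpace ℋ) (vacuum ℋ), hX A A.2⟩
  map_add' A B := by rw [← LinearPMap.map_add]; rfl
  map_smul' c A := by rw [← LinearPMap.map_smul]; rfl

open ClosedSubmodule in
/-- The real orthogonal projection `E_H` of `ℋ` onto `H`, with respect to `Re ⟪·, ·⟫`. -/
def realProj [CompleteSpace ℋ] (H : ClosedSubmodule ℝ ℋ) : ℋ →L[ℝ] ℋ :=
  H.toSubmodule.starProjection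

open ClosedSubmodule in
theorem realProj_mem [CompleteSpace ℋ] (H : ClosedSubmodule ℝ ℋ) (x : ℋ) : realProj H x ∈ H :=
  H.toSubmodule.starProjection_apply_mem x

/-- The real linear operator `X₁ E_H` on `ℋ`. -/
def oneParticleMap [CompleteSpace ℋ] (H : ClosedSubmodule ℝ ℋ) (X₁ : ℋ →ₗ.[ℂ] ℋ)
    (hH : ∀ h ∈ H, h ∈ X₁.domain) : ℋ →ₗ[ℝ] ℋ where
  toFun x := X₁ ⟨realProj H x, hH _ (realProj_mem H x)⟩
  map_add' x y := by
    rw [← LinearPMap.map_add]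
    congr 2
    exact map_add _ _ _
  map_smul' c x := by
    have := X₁.map_smul (c : ℂ) ⟨realProj H x, hH _ (realProj_mem H x)⟩
    rw [RingHom.id_apply, ← Complex.coe_smul c (X₁ _), ← this]
    congr 2
    exact (realProj H).map_smul c x

end Fock

end

noncomputable section

namespace BoseFock

variable {ℋ : Type*} [NormedAddCommGroup ℋ] [InnerProductSpace ℂ ℋ]

/-! ### Creation and annihilation operators on finite particle vectors -/

/-! Everything is tested against the coherent vectors `coherent g` = exp(a(g)^*) Ω. Write T for the
real linear map X₁ E_H and T† for its real adjoint.

Nuclearity. The symmetry of the second quantization gives ⟨coherent g, X A Ω⟩ = ⟨coherent (X₁ g), A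
Ω⟩ (`inner_coherent_secondQuantization`). If k is symplectically orthogonal to H, then W(k) commutes
with A ∈ M(H), and W(k) translates coherent vectors by i k up to an explicit scalar. Analytic
continuation in the length of k permits translations by every complex multiple of k. Hence all of ξ
except its part along H can be shared out between the two sides of ⟨coherent ξ, A Ω⟩ in the most
economical way, and Cauchy–Schwarz leaves ‖A‖ exp(‖E_H(iξ)‖²/2) (`norm_inner_coherent_le_exp`).
Since E_H(i X₁ g) = T†(i g), the function g ↦ ⟨coherent g, X A Ω⟩ has Gaussian growth controlled by
T† (`norm_inner_coherent_xiMap_le`).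

T† is only real linear, so it has no complex singular value basis. The complex linear operator T T†
- i T T† i does have an orthonormal basis of eigenvectors, and in that basis ‖T† g‖² is dominated by
a diagonal form with entries τ_i² where τ is p-summable and bounded away from 1
(`exists_hilbertBasis_diagonal_bound`). Cauchy estimates on polydiscs with optimized radii then
bound the coefficient of X A Ω at the occupation numbers μ by ‖A‖ ∏ √(e μ_i) τ_i^{μ_i}
(`norm_inner_occupationUnitVec_le_prod`). The p-th powers of these numbers are summable, because
their sum is dominated by a product of one-mode factors 1 + O(τ_i^p) (`summable_occupation`). The
expansion in the occupation number basis is therefore a p-nuclear decomposition. Compactness and the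
ℓ^q property follow for any p-nuclear map, by cutting its series at a threshold
(`IsPNuclear.isEll`).

Lower bound. For a unit vector h ∈ H, the one particle component of X W(h) Ω is e^{-1/2} i X₁ h. A
finite rank approximation of Ξ thus yields a complex subspace near which all these vectors lie, and
projecting X₁ E_H onto it gives an approximation of twice the real rank
(`approxNumber_oneParticleMap_le`). The factor √e is the Gaussian weight, and 2^{1/p} pays for the
doubled rank. -/

theorem inner_polyVec (p q : MvPolynomial ℋ ℂ) : ⟪polyVec p, polyVec q⟫ = polyInner p q :=
  UniformSpace.Completion.inner_coe (𝕜 := ℂ) (E := PreFock ℋ) p q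

theorem dense_range_polyVec : DenseRange (polyVec : MvPolynomial ℋ ℂ →ₗ[ℂ] FockSpace ℋ) :=
  UniformSpace.Completion.denseRange_coe (α := PreFock ℋ)

theorem eq_of_forall_inner_polyVec {ψ ψ' : FockSpace ℋ}
    (h : ∀ p : MvPolynomial ℋ ℂ, ⟪polyVec p, ψ⟫ = ⟪polyVec p, ψ'⟫) : ψ = ψ' := by
  refine ext_inner_left ℂ fun v => ?_
  refine dense_range_polyVec.induction_on (p := fun v => ⟪v, ψ⟫ = ⟪v, ψ'⟫) v ?_ h
  exact isClosed_eq (by fun_prop) (by fun_prop)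

theorem annihilate_add (f : ℋ) (p q : MvPolynomial ℋ ℂ) :
    annihilate f (p + q) = annihilate f p + annihilate f q := map_add _ _ _

theorem annihilate_smul (f : ℋ) (c : ℂ) (p : MvPolynomial ℋ ℂ) :
    annihilate f (c • p) = c • annihilate f p := Derivation.map_smul _ _ _

theorem annihilate_X_mul (f g : ℋ) (p : MvPolynomial ℋ ℂ) :
    annihilate f (MvPolynomial.X g * p) = ⟪f, g⟫ • p + MvPolynomial.X g * annihilate f p := by
  simp only [annihilate, Derivation.leibniz, smul_eq_mul]
  rw [add_comm]
  congr 1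
  simp [polyAnnihilation, MvPolynomial.smul_eq_C_mul, mul_comm]

theorem annihilate_one (f : ℋ) : annihilate f (1 : MvPolynomial ℋ ℂ) = 0 :=
  Derivation.map_one_eq_zero _

theorem annihilate_X_pow (f g : ℋ) (n : ℕ) :
    annihilate f ((MvPolynomial.X g : MvPolynomial ℋ ℂ) ^ (n + 1))
      = ((n + 1 : ℂ) * ⟪f, g⟫) • (MvPolynomial.X g : MvPolynomial ℋ ℂ) ^ n := by
  induction n with
  | zero =>
    have := annihilate_X_mul f g (1 : MvPolynomial ℋ ℂ)
    rw [annihilate_one] at this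
    simpa using this
  | succ n ih =>
    rw [pow_succ', annihilate_X_mul, ih, mul_smul_comm, ← pow_succ', ← add_smul]
    congr 1
    push_cast
    ring

theorem polyInner_monomial (μ : ℋ →₀ ℕ) (c : ℂ) (q : MvPolynomial ℋ ℂ) :
    polyInner (MvPolynomial.monomial μ c) q
      = (starRingEnd ℂ) c * vacuumPairing (Finsupp.toMultiset μ) q := by
  classical
  rw [polyInner_eq_of_subset _ q {μ} MvPolynomial.support_monomial_subset]
  simp

/-- The annihilation operators commute, so the last factor in the fold defining `vacuumPairing` may
be applied first. This is the adjointness of a(f)^* and a(f). -/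
theorem polyInner_X_mul (f : ℋ) (p q : MvPolynomial ℋ ℂ) :
    polyInner (MvPolynomial.X f * p) q = polyInner p (annihilate f q) := by
  induction p using MvPolynomial.induction_on' with
  | monomial μ c =>
    rw [MvPolynomial.X, MvPolynomial.monomial_mul, one_mul, polyInner_monomial, polyInner_monomial]
    congr 1
    rw [map_add, Finsupp.toMultiset_single, one_smul, Multiset.singleton_add, vacuumPairing,
      foldr_annihilate, vacuumPairing]
  | add p p' h h' => rw [mul_add, polyInner_add_left, polyInner_add_left, h, h']

theorem inner_X_mul_left (f : ℋ) (p q : MvPolynomial ℋ ℂ) :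
    ⟪polyVec (MvPolynomial.X f * p), polyVec q⟫ = ⟪polyVec p, polyVec (annihilate f q)⟫ := by
  rw [inner_polyVec, inner_polyVec, polyInner_X_mul]

theorem inner_X_mul_right (f : ℋ) (p q : MvPolynomial ℋ ℂ) :
    ⟪polyVec p, polyVec (MvPolynomial.X f * q)⟫ = ⟪polyVec (annihilate f p), polyVec q⟫ := by
  rw [← inner_conj_symm, inner_X_mul_left, inner_conj_symm]

theorem inner_polyVec_one_one :
    ⟪polyVec (1 : MvPolynomial ℋ ℂ), polyVec (1 : MvPolynomial ℋ ℂ)⟫ = 1 := by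
  rw [inner_polyVec, show (1 : MvPolynomial ℋ ℂ) = MvPolynomial.monomial 0 1 from rfl,
    polyInner_monomial]
  simp [vacuumPairing]

theorem norm_vacuum : ‖vacuum ℋ‖ = 1 := by
  have : ‖vacuum ℋ‖ ^ 2 = 1 := by
    rw [← inner_self_eq_norm_sq (𝕜 := ℂ), vacuum, inner_polyVec_one_one]
    simp
  nlinarith [norm_nonneg (vacuum ℋ)]

/-- The canonical commutation relation a(f) a(f)^* = ‖f‖² + a(f)^* a(f) in expectation. -/
theorem norm_sq_X_mul (f : ℋ) (p : MvPolynomial ℋ ℂ) :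
    ‖polyVec (MvPolynomial.X f * p)‖ ^ 2
      = ‖f‖ ^ 2 * ‖polyVec p‖ ^ 2 + ‖polyVec (annihilate f p)‖ ^ 2 := by
  have h : ⟪polyVec (MvPolynomial.X f * p), polyVec (MvPolynomial.X f * p)⟫
      = ⟪f, f⟫ * ⟪polyVec p, polyVec p⟫ + ⟪polyVec (annihilate f p), polyVec (annihilate f p)⟫ := by
    rw [inner_X_mul_left, annihilate_X_mul, map_add, map_smul, inner_add_right, inner_smul_right,
      inner_X_mul_right]
  simp only [inner_self_eq_norm_sq_to_K] at h
  exact_mod_cast h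

/-- The polynomials of degree at most `n`. -/
def degLE (n : ℕ) : Submodule ℂ (MvPolynomial ℋ ℂ) :=
  Submodule.span ℂ {p | ∃ s : Multiset ℋ, s.card ≤ n ∧ p = (s.map MvPolynomial.X).prod}

set_option linter.unusedSectionVars false in
theorem X_mul_mem_degLE {n : ℕ} (f : ℋ) {p : MvPolynomial ℋ ℂ} (hp : p ∈ degLE n) :
    MvPolynomial.X f * p ∈ degLE (n + 1) := by
  induction hp using Submodule.span_induction with
  | mem p hp =>
    obtain ⟨s, hs, rfl⟩ := hp
    exact Submodule.subset_span ⟨f ::ₘ s, by simpa using hs, by simp⟩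
  | zero => simp
  | add p q _ _ hp hq => rw [mul_add]; exact add_mem hp hq
  | smul c p _ hp => rw [mul_smul_comm]; exact Submodule.smul_mem _ _ hp

set_option linter.unusedSectionVars false in
theorem degLE_mono {m n : ℕ} (h : m ≤ n) : (degLE m : Submodule ℂ (MvPolynomial ℋ ℂ)) ≤ degLE n :=
  Submodule.span_mono fun _ ⟨s, hs, hp⟩ => ⟨s, hs.trans h, hp⟩

theorem annihilate_multiset_mem_degLE (f : ℋ) (s : Multiset ℋ) :
    annihilate f (s.map MvPolynomial.X).prod ∈ degLE (s.card - 1) := by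
  induction s using Multiset.induction_on with
  | empty => simp [annihilate_one]
  | cons g s ih =>
    rw [Multiset.map_cons, Multiset.prod_cons, annihilate_X_mul, Multiset.card_cons,
      Nat.add_sub_cancel]
    refine add_mem (Submodule.smul_mem _ _ (Submodule.subset_span ⟨s, le_rfl, rfl⟩)) ?_
    rcases s.empty_or_exists_mem with rfl | ⟨a, ha⟩
    · simp [annihilate_one]
    · have : 0 < s.card := Multiset.card_pos_iff_exists_mem.2 ⟨a, ha⟩
      have h := X_mul_mem_degLE g ih
      rwa [Nat.sub_add_cancel this] at h

theorem annihilate_mem_degLE {n : ℕ} (f : ℋ) {p : MvPolynomial ℋ ℂ} (hp : p ∈ degLE n) :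
    annihilate f p ∈ degLE (n - 1) := by
  induction hp using Submodule.span_induction with
  | mem p hp =>
    obtain ⟨s, hs, rfl⟩ := hp
    exact degLE_mono (Nat.sub_le_sub_right hs 1) (annihilate_multiset_mem_degLE f s)
  | zero =>
    rw [annihilate, map_zero]
    exact zero_mem _
  | add p q _ _ hp hq => rw [annihilate_add]; exact add_mem hp hq
  | smul c p _ hp => rw [annihilate_smul]; exact Submodule.smul_mem _ _ hp

theorem annihilate_eq_zero_of_mem_degLE_zero (f : ℋ) {p : MvPolynomial ℋ ℂ} (hp : p ∈ degLE 0) :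
    annihilate f p = 0 := by
  induction hp using Submodule.span_induction with
  | mem p hp =>
    obtain ⟨s, hs, rfl⟩ := hp
    obtain rfl : s = 0 := by simpa using hs
    simp [annihilate_one]
  | zero => rw [annihilate, map_zero]
  | add p q _ _ hp hq => rw [annihilate_add, hp, hq, add_zero]
  | smul c p _ hp => rw [annihilate_smul, hp, smul_zero]

theorem exists_mem_degLE (p : MvPolynomial ℋ ℂ) : ∃ n, p ∈ degLE n := by
  induction p using MvPolynomial.induction_on with
  | C c =>
    refine ⟨0, ?_⟩
    have : (MvPolynomial.C c : MvPolynomial ℋ ℂ) = c • 1 := by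
      rw [MvPolynomial.smul_eq_C_mul, mul_one]
    rw [this]
    exact Submodule.smul_mem _ _ (Submodule.subset_span ⟨0, by simp, by simp⟩)
  | add p q hp hq =>
    obtain ⟨m, hm⟩ := hp
    obtain ⟨n, hn⟩ := hq
    exact ⟨max m n, add_mem (degLE_mono (le_max_left _ _) hm) (degLE_mono (le_max_right _ _) hn)⟩
  | mul_X p f hp =>
    obtain ⟨m, hm⟩ := hp
    exact ⟨m + 1, by rw [mul_comm]; exact X_mul_mem_degLE f hm⟩

/-! ### Number estimates and convergence of exponential series -/

theorem sq_le_of_sq_le_mul {a b c k : ℝ} (hk : 0 ≤ k) (h1 : c ^ 2 ≤ k * a ^ 2)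
    (h2 : a ^ 2 ≤ c * b) : a ^ 2 ≤ k * b ^ 2 := by
  rcases (sq_nonneg a).eq_or_lt with h0 | h0
  · rw [← h0]
    positivity
  · refine le_of_mul_le_mul_left ?_ h0
    calc a ^ 2 * a ^ 2 ≤ (c * b) * (c * b) := mul_self_le_mul_self h0.le h2
      _ = c ^ 2 * b ^ 2 := by ring
      _ ≤ (k * a ^ 2) * b ^ 2 := by gcongr
      _ = _ := by ring

theorem norm_annihilate_sq_le_mul (f : ℋ) (p : MvPolynomial ℋ ℂ) :
    ‖polyVec (annihilate f p)‖ ^ 2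
      ≤ ‖polyVec (MvPolynomial.X f * annihilate f p)‖ * ‖polyVec p‖ := by
  rw [← inner_self_eq_norm_sq (𝕜 := ℂ), ← inner_X_mul_left]
  exact re_inner_le_norm _ _

/-- Induction on the degree: ‖a p‖² ≤ ‖a^* a p‖ ‖p‖, and since a p has smaller degree the
commutation relation and the induction hypothesis bound ‖a^* a p‖² by (n+1) ‖f‖² ‖a p‖². Cancelling
one factor ‖a p‖² closes the induction, with no decomposition into homogeneous parts. -/
theorem norm_annihilate_sq_le (f : ℋ) (n : ℕ) : ∀ p ∈ (degLE n : Submodule ℂ (MvPolynomial ℋ ℂ)),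
    ‖polyVec (annihilate f p)‖ ^ 2 ≤ n * ‖f‖ ^ 2 * ‖polyVec p‖ ^ 2 := by
  induction n with
  | zero =>
    intro p hp
    simp [annihilate_eq_zero_of_mem_degLE_zero f hp]
  | succ n ih =>
    intro p hp
    have hm := annihilate_mem_degLE f hp
    rw [Nat.add_sub_cancel] at hm
    have h := ih _ hm
    have hk : (0 : ℝ) ≤ ((n + 1 : ℕ) : ℝ) * ‖f‖ ^ 2 := by positivity
    have h1 := norm_sq_X_mul f (annihilate f p)
    have h2 : ‖polyVec (MvPolynomial.X f * annihilate f p)‖ ^ 2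
        ≤ ((n + 1 : ℕ) : ℝ) * ‖f‖ ^ 2 * ‖polyVec (annihilate f p)‖ ^ 2 := by
      rw [h1]
      push_cast
      linarith
    exact sq_le_of_sq_le_mul hk h2 (norm_annihilate_sq_le_mul f p)

theorem norm_annihilate_le (f : ℋ) {n : ℕ} {p : MvPolynomial ℋ ℂ} (hp : p ∈ degLE n) :
    ‖polyVec (annihilate f p)‖ ≤ √(n + 1) * ‖f‖ * ‖polyVec p‖ := by
  refine le_of_sq_le_sq ?_ (by positivity)
  rw [mul_pow, mul_pow, Real.sq_sqrt (by positivity)]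
  refine (norm_annihilate_sq_le f n p hp).trans ?_
  gcongr
  linarith

theorem norm_X_mul_le (f : ℋ) {n : ℕ} {p : MvPolynomial ℋ ℂ} (hp : p ∈ degLE n) :
    ‖polyVec (MvPolynomial.X f * p)‖ ≤ √(n + 1) * ‖f‖ * ‖polyVec p‖ := by
  refine le_of_sq_le_sq ?_ (by positivity)
  rw [mul_pow, mul_pow, Real.sq_sqrt (by positivity), norm_sq_X_mul]
  have := norm_annihilate_sq_le f n p hp
  linarith

theorem fieldOp_apply (h : ℋ) (p : MvPolynomial ℋ ℂ) :
    fieldOp h p = MvPolynomial.X h * p + annihilate h p := rfl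

theorem fieldOp_mem_degLE (h : ℋ) {n : ℕ} {p : MvPolynomial ℋ ℂ} (hp : p ∈ degLE n) :
    fieldOp h p ∈ degLE (n + 1) :=
  add_mem (X_mul_mem_degLE h hp) (degLE_mono (by omega) (annihilate_mem_degLE h hp))

theorem norm_fieldOp_le (h : ℋ) {n : ℕ} {p : MvPolynomial ℋ ℂ} (hp : p ∈ degLE n) :
    ‖polyVec (fieldOp h p)‖ ≤ √(n + 1) * (2 * ‖h‖) * ‖polyVec p‖ := by
  rw [fieldOp_apply, map_add]
  refine (norm_add_le _ _).trans ?_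
  linarith [norm_X_mul_le h hp, norm_annihilate_le h hp]

theorem inner_fieldOp (h : ℋ) (p q : MvPolynomial ℋ ℂ) :
    ⟪polyVec (fieldOp h p), polyVec q⟫ = ⟪polyVec p, polyVec (fieldOp h q)⟫ := by
  rw [fieldOp_apply, fieldOp_apply, map_add, map_add, inner_add_left, inner_add_right,
    inner_X_mul_left, inner_X_mul_right, add_comm]

theorem inner_fieldOp_pow (h : ℋ) (k : ℕ) (p q : MvPolynomial ℋ ℂ) :
    ⟪polyVec ((fieldOp h ^ k) p), polyVec q⟫ = ⟪polyVec p, polyVec ((fieldOp h ^ k) q)⟫ := by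
  induction k generalizing p with
  | zero => simp
  | succ k ih =>
    rw [pow_succ, Module.End.mul_apply, ih, inner_fieldOp, ← Module.End.mul_apply, ← pow_succ']
    rfl

/-- If `op` raises the degree by one with norm at most `√(n+1) c` on polynomials of degree `n`, then
its exponential series converges on polynomials. -/
theorem summable_exp_series {op : Module.End ℂ (MvPolynomial ℋ ℂ)} {c : ℝ} (hc : 0 ≤ c)
    (hdeg : ∀ n p, p ∈ degLE n → op p ∈ degLE (n + 1))
    (hnorm : ∀ n p, p ∈ degLE n → ‖polyVec (op p)‖ ≤ √(n + 1) * c * ‖polyVec p‖)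
    (q : MvPolynomial ℋ ℂ) :
    Summable fun k : ℕ => ‖polyVec ((op ^ k) q)‖ / (k.factorial : ℝ) := by
  obtain ⟨n, hn⟩ := exists_mem_degLE q
  have hd : ∀ k : ℕ, (op ^ k) q ∈ degLE (n + k) := by
    intro k
    induction k with
    | zero => simpa using hn
    | succ k ih =>
      rw [pow_succ', Module.End.mul_apply]
      exact hdeg _ _ ih
  have hstep : ∀ k : ℕ, ‖polyVec ((op ^ (k + 1)) q)‖
      ≤ √(n + k + 1) * c * ‖polyVec ((op ^ k) q)‖ := by
    intro k
    rw [pow_succ', Module.End.mul_apply]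
    have := hnorm _ _ (hd k)
    push_cast at this
    exact this
  -- The quotient of consecutive terms is at most √(n+k+1) c / (k+1), which tends to 0 because n + k
  -- + 1 ≤ (n+1)(k+1).
  have hlim : Filter.Tendsto (fun k : ℕ => √((n : ℝ) + k + 1) * c / ((k : ℝ) + 1))
      Filter.atTop (nhds 0) := by
    have h1 : Filter.Tendsto (fun k : ℕ => √((n + 1 : ℝ) * (1 / ((k : ℝ) + 1))) * c)
        Filter.atTop (nhds (√((n + 1 : ℝ) * 0) * c)) :=
      (((tendsto_one_div_add_atTop_nhds_zero_nat (𝕜 := ℝ)).const_mul _).sqrt).mul_const _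
    rw [mul_zero, Real.sqrt_zero, zero_mul] at h1
    refine squeeze_zero (fun k => by positivity) (fun k => ?_) h1
    rw [mul_div_right_comm]
    refine mul_le_mul_of_nonneg_right ?_ hc
    rw [div_le_iff₀ (by positivity)]
    refine Real.sqrt_le_iff.2 ⟨by positivity, ?_⟩
    rw [mul_pow, Real.sq_sqrt (by positivity)]
    field_simp
    nlinarith [mul_nonneg (Nat.cast_nonneg (α := ℝ) n) (Nat.cast_nonneg (α := ℝ) k)]
  have hev : ∀ᶠ k : ℕ in Filter.atTop, √((n : ℝ) + k + 1) * c / ((k : ℝ) + 1) ≤ 1 / 2 :=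
    (hlim.eventually (gt_mem_nhds (by norm_num : (0 : ℝ) < 1 / 2))).mono fun _ h => h.le
  refine summable_of_ratio_norm_eventually_le (r := 1 / 2) (by norm_num) ?_
  filter_upwards [hev] with k hk
  rw [Real.norm_of_nonneg (by positivity), Real.norm_of_nonneg (by positivity), Nat.factorial_succ]
  push_cast
  have h0 : (0 : ℝ) < k.factorial := by positivity
  calc ‖polyVec ((op ^ (k + 1)) q)‖ / (((k : ℝ) + 1) * k.factorial)
      ≤ √(n + k + 1) * c * ‖polyVec ((op ^ k) q)‖ / (((k : ℝ) + 1) * k.factorial) := by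
        gcongr
        exact hstep k
    _ = (√(n + k + 1) * c / ((k : ℝ) + 1)) * (‖polyVec ((op ^ k) q)‖ / k.factorial) := by
        field_simp
    _ ≤ _ := by gcongr

/-! ### Coherent vectors -/

theorem summable_coherent (g : ℋ) :
    Summable fun n : ℕ => ((n.factorial : ℂ)⁻¹) • polyVec ((MvPolynomial.X g) ^ n) := by
  have h := summable_exp_series (op := LinearMap.mulLeft ℂ (MvPolynomial.X g)) (norm_nonneg g)
    (fun n p hp => X_mul_mem_degLE g hp) (fun n p hp => norm_X_mul_le g hp) 1
  refine Summable.of_norm (h.congr fun n => ?_)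
  rw [LinearMap.pow_mulLeft, norm_smul, norm_inv, Complex.norm_natCast, div_eq_inv_mul]
  simp

/-- The (unnormalized) coherent vector `exp(a(g)^*) Ω`. -/
def coherent (g : ℋ) : FockSpace ℋ :=
  ∑' n : ℕ, ((n.factorial : ℂ)⁻¹) • polyVec ((MvPolynomial.X g) ^ n)

theorem hasSum_coherent (g : ℋ) :
    HasSum (fun n : ℕ => ((n.factorial : ℂ)⁻¹) • polyVec ((MvPolynomial.X g) ^ n)) (coherent g) :=
  (summable_coherent g).hasSum

/-- A functional that obeys the recursion `F (X g ^ (n+1) / (n+1)!) = c G (X g ^ n / n!)` satisfies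
`F (coherent g) = c G (coherent g)`. -/
theorem coherent_recursion {g : ℋ} {F G : FockSpace ℋ →L[ℂ] ℂ} {c : ℂ}
    (h0 : F (polyVec 1) = 0)
    (h : ∀ n : ℕ, F (polyVec (MvPolynomial.X g ^ (n + 1)))
      = (n + 1 : ℂ) * c * G (polyVec (MvPolynomial.X g ^ n))) :
    F (coherent g) = c * G (coherent g) := by
  have hF := (hasSum_coherent g).mapL F
  have hG := ((hasSum_coherent g).mapL G).mul_left c
  have hF' := (hasSum_nat_add_iff' 1).2 hF
  simp only [Finset.range_one, Finset.sum_singleton, pow_zero, map_smul, h0, smul_zero,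
    sub_zero] at hF'
  refine hF'.unique (hG.congr_fun ?_) |>.trans rfl
  intro n
  rw [h, Nat.factorial_succ, map_smul, smul_eq_mul, smul_eq_mul]
  have : ((n + 1 : ℕ) : ℂ) ≠ 0 := by exact_mod_cast Nat.succ_ne_zero n
  push_cast at this ⊢
  field_simp

/-- Weak form of a(f) coherent g = ⟪f, g⟫ coherent g, since differentiating the exponential series
shifts its index. -/
theorem inner_X_mul_coherent (f g : ℋ) (p : MvPolynomial ℋ ℂ) :
    ⟪polyVec (MvPolynomial.X f * p), coherent g⟫ = ⟪f, g⟫ * ⟪polyVec p, coherent g⟫ := by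
  refine coherent_recursion (F := innerSL ℂ (polyVec (MvPolynomial.X f * p)))
    (G := innerSL ℂ (polyVec p)) ?_ ?_
  · simp [inner_X_mul_left, annihilate_one]
  · intro n
    simp only [innerSL_apply_apply, inner_X_mul_left, annihilate_X_pow, map_smul,
      inner_smul_right]

theorem inner_one_polyVec_X_mul (g : ℋ) (q : MvPolynomial ℋ ℂ) :
    ⟪polyVec (1 : MvPolynomial ℋ ℂ), polyVec (MvPolynomial.X g * q)⟫ = 0 := by
  rw [inner_X_mul_right, annihilate_one, map_zero, inner_zero_left]

theorem inner_vacuum_coherent (g : ℋ) : ⟪vacuum ℋ, coherent g⟫ = 1 := by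
  have h := (hasSum_coherent g).mapL (innerSL ℂ (vacuum ℋ))
  have h1 := hasSum_single (f := fun n : ℕ =>
    innerSL ℂ (vacuum ℋ) (((n.factorial : ℂ)⁻¹) • polyVec ((MvPolynomial.X g) ^ n))) 0 (by
      intro n hn
      obtain ⟨m, rfl⟩ := Nat.exists_eq_succ_of_ne_zero hn
      simp [pow_succ', vacuum, inner_one_polyVec_X_mul])
  refine h.unique h1 |>.trans ?_
  simpa only [vacuum, Nat.factorial_zero, Nat.cast_one, inv_one, one_smul, pow_zero,
    innerSL_apply_apply] using inner_polyVec_one_one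

theorem inner_polyVec_eq_of_eigen {g : ℋ} {ψ : FockSpace ℋ}
    (h : ∀ (f : ℋ) (p : MvPolynomial ℋ ℂ),
      ⟪polyVec (MvPolynomial.X f * p), ψ⟫ = ⟪f, g⟫ * ⟪polyVec p, ψ⟫) (s : Multiset ℋ) :
    ⟪polyVec (s.map MvPolynomial.X).prod, ψ⟫ = (s.map fun f => ⟪f, g⟫).prod * ⟪vacuum ℋ, ψ⟫ := by
  induction s using Multiset.induction_on with
  | empty => simp [vacuum]
  | cons f s ih => simp only [Multiset.map_cons, Multiset.prod_cons, h, ih, mul_assoc]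

theorem inner_multiset_coherent (g : ℋ) (s : Multiset ℋ) :
    ⟪polyVec (s.map MvPolynomial.X).prod, coherent g⟫ = (s.map fun f => ⟪f, g⟫).prod := by
  rw [inner_polyVec_eq_of_eigen fun f p => inner_X_mul_coherent f g p, inner_vacuum_coherent,
    mul_one]

theorem eq_of_forall_inner_multiset {ψ ψ' : FockSpace ℋ}
    (h : ∀ s : Multiset ℋ, ⟪polyVec (s.map MvPolynomial.X).prod, ψ⟫
      = ⟪polyVec (s.map MvPolynomial.X).prod, ψ'⟫) : ψ = ψ' := by
  refine eq_of_forall_inner_polyVec fun p => ?_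
  obtain ⟨n, hn⟩ := exists_mem_degLE p
  induction hn using Submodule.span_induction with
  | mem p hp =>
    obtain ⟨s, -, rfl⟩ := hp
    exact h s
  | zero => simp
  | add p q _ _ hp hq => rw [map_add, inner_add_left, inner_add_left, hp, hq]
  | smul c p _ hp => rw [map_smul, inner_smul_left, inner_smul_left, hp]

/-- A joint eigenvector of the annihilation operators is a multiple of a coherent vector. -/
theorem eq_smul_coherent_of_eigen {g : ℋ} {ψ : FockSpace ℋ}
    (h : ∀ (f : ℋ) (p : MvPolynomial ℋ ℂ),
      ⟪polyVec (MvPolynomial.X f * p), ψ⟫ = ⟪f, g⟫ * ⟪polyVec p, ψ⟫) :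
    ψ = ⟪vacuum ℋ, ψ⟫ • coherent g := by
  refine eq_of_forall_inner_multiset fun s => ?_
  rw [inner_polyVec_eq_of_eigen h, inner_smul_right, inner_multiset_coherent, mul_comm]

theorem inner_coherent (f g : ℋ) : ⟪coherent f, coherent g⟫ = Complex.exp ⟪f, g⟫ := by
  have h := (hasSum_coherent f).mapL (innerSL ℂ (coherent g))
  have h2 : HasSum (fun n : ℕ => (⟪g, f⟫ ^ n / (n.factorial : ℂ))) (Complex.exp ⟪g, f⟫) := by
    rw [Complex.exp_eq_exp_ℂ]
    exact NormedSpace.exp_series_hasSum_exp' (𝕂 := ℂ) ⟪g, f⟫ |>.congr_fun fun n => by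
      simp [div_eq_inv_mul]
  have h3 : ⟪coherent g, coherent f⟫ = Complex.exp ⟪g, f⟫ := by
    refine h.unique (h2.congr_fun fun n => ?_)
    rw [innerSL_apply_apply, inner_smul_right, div_eq_inv_mul]
    congr 1
    rw [← inner_conj_symm]
    have := inner_multiset_coherent g (Multiset.replicate n f)
    simp only [Multiset.map_replicate, Multiset.prod_replicate] at this
    rw [this, map_pow, inner_conj_symm]
  rw [← inner_conj_symm, h3, ← Complex.exp_conj, inner_conj_symm]

theorem norm_coherent (g : ℋ) : ‖coherent g‖ = Real.exp (‖g‖ ^ 2 / 2) := by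
  have h : ‖coherent g‖ ^ 2 = Real.exp (‖g‖ ^ 2 / 2) ^ 2 := by
    rw [← inner_self_eq_norm_sq (𝕜 := ℂ), inner_coherent, inner_self_eq_norm_sq_to_K,
      ← Real.exp_nat_mul]
    have : Complex.exp ((‖g‖ : ℂ) ^ 2) = ((Real.exp (‖g‖ ^ 2) : ℝ) : ℂ) := by push_cast; rfl
    change (Complex.exp ((‖g‖ : ℂ) ^ 2)).re = _
    rw [this, Complex.ofReal_re]
    congr 1
    push_cast
    ring
  exact (pow_left_inj₀ (norm_nonneg _) (Real.exp_nonneg _) two_ne_zero).1 h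

/-- The squared distance of two coherent vectors is a combination of values of the continuous kernel
exp ⟪f, g⟫. -/
theorem continuous_coherent : Continuous (coherent : ℋ → FockSpace ℋ) := by
  rw [continuous_iff_continuousAt]
  intro g
  rw [ContinuousAt, tendsto_iff_norm_sub_tendsto_zero]
  have hsq : ∀ f : ℋ, ‖coherent f - coherent g‖ ^ 2
      = (Complex.exp ⟪f, f⟫ - Complex.exp ⟪f, g⟫ - Complex.exp ⟪g, f⟫ + Complex.exp ⟪g, g⟫).re := by
    intro f
    rw [← inner_self_eq_norm_sq (𝕜 := ℂ)]
    simp only [inner_sub_left, inner_sub_right, inner_coherent]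
    simp only [RCLike.re_to_complex]
    congr 1
    ring
  have hcont : Continuous fun f : ℋ =>
      (Complex.exp ⟪f, f⟫ - Complex.exp ⟪f, g⟫ - Complex.exp ⟪g, f⟫ + Complex.exp ⟪g, g⟫).re := by
    fun_prop
  have h := (hcont.sqrt).tendsto g
  simp only [← hsq] at h
  simpa [Real.sqrt_sq] using h

end BoseFock

end


noncomputable section

namespace BoseFock

variable {ℋ : Type*} [NormedAddCommGroup ℋ] [InnerProductSpace ℂ ℋ]

/-! ### Weyl operators -/

/-- Absolute convergence makes the double series unconditional, so that it can be summed along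
antidiagonals or with its indices exchanged. -/
theorem hasSum_inner_of_summable_norm {V : Type*} [NormedAddCommGroup V] [InnerProductSpace ℂ V]
    [CompleteSpace V] {f g : ℕ → V} {a b : V} (hf : Summable fun j => ‖f j‖)
    (hg : Summable fun k => ‖g k‖) (ha : HasSum f a) (hb : HasSum g b) :
    HasSum (fun jk : ℕ × ℕ => ⟪f jk.1, g jk.2⟫) ⟪a, b⟫ := by
  have hs : Summable fun jk : ℕ × ℕ => ⟪f jk.1, g jk.2⟫ := by
    refine Summable.of_norm_bounded (hf.mul_of_nonneg hg (fun _ => norm_nonneg _)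
      (fun _ => norm_nonneg _)) fun jk => norm_inner_le_norm _ _
  have h1 : HasSum (fun j => ⟪f j, b⟫) (∑' jk : ℕ × ℕ, ⟪f jk.1, g jk.2⟫) :=
    hs.hasSum.prod_fiberwise fun j => by
      simpa using hb.mapL (innerSL ℂ (f j))
  have h2 : HasSum (fun j => ⟪f j, b⟫) ⟪a, b⟫ := by
    have := (ha.mapL (innerSL ℂ b)).star
    simpa only [innerSL_apply_apply, RCLike.star_def, inner_conj_symm] using this
  rw [h2.unique h1]
  exact hs.hasSum

/-- `W` is the exponential `exp(z (a(h)^* + a(h)))`, given by the exponential series on finite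
particle vectors. -/
def IsExpField (z : ℂ) (h : ℋ) (W : FockSpace ℋ →L[ℂ] FockSpace ℋ) : Prop :=
  ∀ q : MvPolynomial ℋ ℂ,
    HasSum (fun k : ℕ => (z ^ k / (k.factorial : ℂ)) • polyVec ((fieldOp h ^ k) q))
      (W (polyVec q))

theorem summable_norm_fieldOp {z : ℂ} (hz : ‖z‖ = 1) (h : ℋ) (q : MvPolynomial ℋ ℂ) :
    Summable fun k : ℕ => ‖(z ^ k / (k.factorial : ℂ)) • polyVec ((fieldOp h ^ k) q)‖ := by
  refine (summable_exp_series (op := fieldOp h) (c := 2 * ‖h‖) (by positivity)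
    (fun n p hp => fieldOp_mem_degLE h hp) (fun n p hp => norm_fieldOp_le h hp) q).congr fun k => ?_
  rw [norm_smul, norm_div, norm_pow, hz, one_pow, Complex.norm_natCast, one_div, div_eq_inv_mul]

/-- The exponential series of `z (a(h)^* + a(h))` on polynomials. -/
def expField {z : ℂ} (hz : ‖z‖ = 1) (h : ℋ) : MvPolynomial ℋ ℂ →ₗ[ℂ] FockSpace ℋ where
  toFun q := ∑' k : ℕ, (z ^ k / (k.factorial : ℂ)) • polyVec ((fieldOp h ^ k) q)
  map_add' p q := by
    rw [← (summable_norm_fieldOp hz h p).of_norm.tsum_add (summable_norm_fieldOp hz h q).of_norm]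
    simp only [map_add, smul_add]
  map_smul' c p := by
    simp only [map_smul, RingHom.id_apply, smul_comm _ c]
    exact (summable_norm_fieldOp hz h p).of_norm.tsum_const_smul c

theorem hasSum_expField {z : ℂ} (hz : ‖z‖ = 1) (h : ℋ) (q : MvPolynomial ℋ ℂ) :
    HasSum (fun k : ℕ => (z ^ k / (k.factorial : ℂ)) • polyVec ((fieldOp h ^ k) q))
      (expField hz h q) :=
  (summable_norm_fieldOp hz h q).of_norm.hasSum

theorem sum_antidiagonal_pow_div_factorial (x y : ℂ) (N : ℕ) :
    ∑ jk ∈ Finset.HasAntidiagonal.antidiagonal N,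
      (x ^ jk.1 / (jk.1.factorial : ℂ)) * (y ^ jk.2 / (jk.2.factorial : ℂ))
      = (x + y) ^ N / (N.factorial : ℂ) := by
  rw [(Commute.all x y).add_pow', Finset.sum_div]
  refine Finset.sum_congr rfl fun jk hjk => ?_
  obtain rfl := Finset.HasAntidiagonal.mem_antidiagonal.1 hjk
  have h := Nat.add_choose_mul_factorial_mul_factorial jk.1 jk.2
  rw [← Nat.choose_symm_add] at h
  have h' : (((jk.1 + jk.2).choose jk.1 : ℕ) : ℂ) * (jk.1.factorial : ℂ) * (jk.2.factorial : ℂ)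
      = ((jk.1 + jk.2).factorial : ℂ) := by exact_mod_cast h
  have h1 : (jk.1.factorial : ℂ) ≠ 0 := by exact_mod_cast Nat.factorial_ne_zero _
  have h2 : (jk.2.factorial : ℂ) ≠ 0 := by exact_mod_cast Nat.factorial_ne_zero _
  have h3 : ((jk.1 + jk.2).choose jk.1 : ℂ) ≠ 0 := by
    exact_mod_cast (Nat.choose_pos (Nat.le_add_right _ _)).ne'
  rw [← h', nsmul_eq_mul]
  field_simp

theorem hasSum_antidiagonal {f : ℕ × ℕ → ℂ} {a : ℂ} (hs : HasSum f a) :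
    HasSum (fun N => ∑ jk ∈ Finset.HasAntidiagonal.antidiagonal N, f jk) a :=
  (Finset.HasAntidiagonal.sigmaAntidiagonalEquivProd.hasSum_iff.2 hs).sigma fun N =>
    (Finset.HasAntidiagonal.antidiagonal N).hasSum f

/-- The field operator is symmetric, so all its powers can be moved into the second entry. The terms
of total order N then add up to (z̄ + z)^N / N!, which vanishes for imaginary z unless N = 0. -/
theorem inner_expField {z : ℂ} (hz : ‖z‖ = 1) (hz' : (starRingEnd ℂ) z + z = 0) (h : ℋ)
    (p q : MvPolynomial ℋ ℂ) :
    ⟪expField hz h p, expField hz h q⟫ = ⟪polyVec p, polyVec q⟫ := by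
  have hs := hasSum_antidiagonal (hasSum_inner_of_summable_norm (summable_norm_fieldOp hz h p)
    (summable_norm_fieldOp hz h q) (hasSum_expField hz h p) (hasSum_expField hz h q))
  have hN : ∀ N : ℕ, ∑ jk ∈ Finset.HasAntidiagonal.antidiagonal N,
      ⟪(z ^ jk.1 / (jk.1.factorial : ℂ)) • polyVec ((fieldOp h ^ jk.1) p),
        (z ^ jk.2 / (jk.2.factorial : ℂ)) • polyVec ((fieldOp h ^ jk.2) q)⟫
      = ((starRingEnd ℂ) z + z) ^ N / (N.factorial : ℂ)
        * ⟪polyVec p, polyVec ((fieldOp h ^ N) q)⟫ := by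
    intro N
    rw [← sum_antidiagonal_pow_div_factorial, Finset.sum_mul]
    refine Finset.sum_congr rfl fun jk hjk => ?_
    obtain rfl := Finset.HasAntidiagonal.mem_antidiagonal.1 hjk
    rw [inner_smul_left, inner_smul_right, inner_fieldOp_pow, pow_add, Module.End.mul_apply]
    simp only [map_div₀, map_pow, map_natCast]
    ring
  simp only [hN, hz'] at hs
  refine hs.unique ?_
  convert hasSum_single 0 ?_ using 1
  · simp
  · intro N hN
    rw [zero_pow hN]
    simp

theorem norm_expField {z : ℂ} (hz : ‖z‖ = 1) (hz' : (starRingEnd ℂ) z + z = 0) (h : ℋ)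
    (p : MvPolynomial ℋ ℂ) : ‖expField hz h p‖ = ‖polyVec p‖ := by
  rw [@norm_eq_sqrt_re_inner ℂ, @norm_eq_sqrt_re_inner ℂ, inner_expField hz hz']

/-- The series is isometric on the dense space of finite particle vectors, hence extends to all of
Fock space. -/
theorem exists_isExpField {z : ℂ} (hz : ‖z‖ = 1) (hz' : (starRingEnd ℂ) z + z = 0) (h : ℋ) :
    ∃ W : FockSpace ℋ →L[ℂ] FockSpace ℋ, IsExpField z h W ∧ ∀ ψ, ‖W ψ‖ = ‖ψ‖ := by
  let f : PreFock ℋ →ₗ[ℂ] FockSpace ℋ := expField hz h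
  have hf : ∀ p : PreFock ℋ, ‖f p‖ = ‖p‖ := fun p => by
    refine (norm_expField hz hz' h p).trans ?_
    exact UniformSpace.Completion.norm_coe (E := PreFock ℋ) p
  let F : PreFock ℋ →L[ℂ] FockSpace ℋ := f.mkContinuous 1 fun p => by rw [hf p, one_mul]
  let e : PreFock ℋ →L[ℂ] FockSpace ℋ := UniformSpace.Completion.toComplL
  have hd : DenseRange e := UniformSpace.Completion.denseRange_coe
  have he : IsUniformInducing e := UniformSpace.Completion.isUniformInducing_coe _
  have hW : ∀ p : MvPolynomial ℋ ℂ, F.extend e (polyVec p) = expField hz h p := fun p =>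
    ContinuousLinearMap.extend_eq F hd he p
  refine ⟨F.extend e, fun q => ?_, fun ψ => ?_⟩
  · rw [hW]
    exact hasSum_expField hz h q
  · refine dense_range_polyVec.induction_on (p := fun ψ => ‖F.extend e ψ‖ = ‖ψ‖) ψ ?_ fun p => ?_
    · exact isClosed_eq (by fun_prop) (by fun_prop)
    · rw [hW, norm_expField hz hz']

theorem norm_neg_I : ‖-Complex.I‖ = 1 := by simp

/-- The Weyl operator `W(h)`. -/
def weyl (h : ℋ) : FockSpace ℋ →L[ℂ] FockSpace ℋ :=
  (exists_isExpField Complex.norm_I (by simp) h).choose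

/-- The inverse (and adjoint) of the Weyl operator `W(h)`. -/
def weylInv (h : ℋ) : FockSpace ℋ →L[ℂ] FockSpace ℋ :=
  (exists_isExpField norm_neg_I (by simp) h).choose

theorem isExpField_weyl (h : ℋ) : IsExpField Complex.I h (weyl h) :=
  (exists_isExpField Complex.norm_I (by simp) h).choose_spec.1

theorem norm_weyl_apply (h : ℋ) (ψ : FockSpace ℋ) : ‖weyl h ψ‖ = ‖ψ‖ :=
  (exists_isExpField Complex.norm_I (by simp) h).choose_spec.2 ψ

theorem isExpField_weylInv (h : ℋ) : IsExpField (-Complex.I) h (weylInv h) :=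
  (exists_isExpField norm_neg_I (by simp) h).choose_spec.1

theorem isWeylOperator_weyl (h : ℋ) : IsWeylOperator h (weyl h) := isExpField_weyl h

theorem IsExpField.unique {z : ℂ} {h : ℋ} {W W' : FockSpace ℋ →L[ℂ] FockSpace ℋ}
    (hW : IsExpField z h W) (hW' : IsExpField z h W') : W = W' := by
  refine ContinuousLinearMap.ext fun ψ => ?_
  refine dense_range_polyVec.induction_on (p := fun ψ => W ψ = W' ψ) ψ ?_ fun p =>
    (hW p).unique (hW' p)
  exact isClosed_eq (by fun_prop) (by fun_prop)

theorem eq_weyl_of_isWeylOperator {h : ℋ} {W : FockSpace ℋ →L[ℂ] FockSpace ℋ}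
    (hW : IsWeylOperator h W) : W = weyl h :=
  IsExpField.unique (z := Complex.I) hW (isExpField_weyl h)

theorem inner_polyVec_weyl (h : ℋ) (p q : MvPolynomial ℋ ℂ) :
    ⟪polyVec p, weyl h (polyVec q)⟫ = ⟪weylInv h (polyVec p), polyVec q⟫ := by
  have h1 := (isExpField_weyl h q).mapL (innerSL ℂ (polyVec p))
  have h2 := ((isExpField_weylInv h p).mapL (innerSL ℂ (polyVec q))).star
  simp only [innerSL_apply_apply, RCLike.star_def, inner_conj_symm] at h1 h2
  refine h1.unique (h2.congr_fun fun k => ?_)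
  rw [inner_smul_right, inner_smul_left, inner_fieldOp_pow]
  simp

theorem inner_weyl (h : ℋ) (ψ χ : FockSpace ℋ) : ⟪ψ, weyl h χ⟫ = ⟪weylInv h ψ, χ⟫ := by
  refine dense_range_polyVec.induction_on₂
    (p := fun ψ χ => ⟪ψ, weyl h χ⟫ = ⟪weylInv h ψ, χ⟫) ?_ (inner_polyVec_weyl h) ψ χ
  exact isClosed_eq (by fun_prop) (by fun_prop)

/-! ### Commutation relations -/

theorem annihilate_fieldOp (f h : ℋ) (p : MvPolynomial ℋ ℂ) :
    annihilate f (fieldOp h p) = fieldOp h (annihilate f p) + ⟪f, h⟫ • p := by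
  rw [fieldOp_apply, fieldOp_apply, annihilate_add, annihilate_X_mul]
  have : annihilate f (annihilate h p) = annihilate h (annihilate f p) :=
    polyAnnihilation_comm f h p
  rw [this]
  abel

theorem annihilate_fieldOp_pow (f h : ℋ) (k : ℕ) (p : MvPolynomial ℋ ℂ) :
    annihilate f ((fieldOp h ^ (k + 1)) p)
      = (fieldOp h ^ (k + 1)) (annihilate f p) + ((k + 1 : ℂ) * ⟪f, h⟫) • (fieldOp h ^ k) p := by
  induction k with
  | zero => simp [annihilate_fieldOp]
  | succ k ih =>
    rw [pow_succ', Module.End.mul_apply, annihilate_fieldOp, ih, map_add, map_smul,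
      ← Module.End.mul_apply (fieldOp h), ← Module.End.mul_apply (fieldOp h), ← pow_succ',
      ← pow_succ', add_assoc, ← add_smul]
    congr 2
    push_cast
    ring

theorem fieldOp_X_mul (f h : ℋ) (p : MvPolynomial ℋ ℂ) :
    fieldOp h (MvPolynomial.X f * p) = MvPolynomial.X f * fieldOp h p + ⟪h, f⟫ • p := by
  rw [fieldOp_apply, fieldOp_apply, annihilate_X_mul]
  ring

theorem fieldOp_pow_X_mul (f h : ℋ) (k : ℕ) (p : MvPolynomial ℋ ℂ) :
    (fieldOp h ^ (k + 1)) (MvPolynomial.X f * p)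
      = MvPolynomial.X f * (fieldOp h ^ (k + 1)) p
        + ((k + 1 : ℂ) * ⟪h, f⟫) • (fieldOp h ^ k) p := by
  induction k with
  | zero => simp [fieldOp_X_mul]
  | succ k ih =>
    rw [pow_succ', Module.End.mul_apply, ih, map_add, map_smul, fieldOp_X_mul,
      ← Module.End.mul_apply (fieldOp h), ← Module.End.mul_apply (fieldOp h), ← pow_succ',
      ← pow_succ', add_assoc, ← add_smul]
    congr 2
    push_cast
    ring

/-- The commutator of the two field operators is the scalar ⟪h, k⟫ - ⟪k, h⟫ = 2i Im ⟪h, k⟫. -/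
theorem fieldOp_commute {h k : ℋ} (hhk : ⟪h, k⟫.im = 0) : Commute (fieldOp h) (fieldOp k) := by
  refine LinearMap.ext fun p => ?_
  rw [Module.End.mul_apply, Module.End.mul_apply]
  have hs : ⟪h, k⟫ = ⟪k, h⟫ := by
    rw [← inner_conj_symm k h, Complex.conj_eq_iff_im.2 hhk]
  have hc : annihilate h (annihilate k p) = annihilate k (annihilate h p) :=
    polyAnnihilation_comm h k p
  simp only [fieldOp_apply, annihilate_add, annihilate_X_mul, hs, hc]
  ring

/-- Stated weakly, with one Weyl operator moved to the left, because the image of a polynomial under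
a Weyl operator is no longer a polynomial and the second exponential series could not be applied to
it. -/
theorem inner_weylInv_weyl_comm {h k : ℋ} (hhk : ⟪h, k⟫.im = 0) (p q : MvPolynomial ℋ ℂ) :
    ⟪weylInv h (polyVec p), weyl k (polyVec q)⟫ = ⟪weylInv k (polyVec p), weyl h (polyVec q)⟫ := by
  have h1 := hasSum_inner_of_summable_norm (summable_norm_fieldOp norm_neg_I h p)
    (summable_norm_fieldOp Complex.norm_I k q) (isExpField_weylInv h p) (isExpField_weyl k q)
  have h2 := hasSum_inner_of_summable_norm (summable_norm_fieldOp norm_neg_I k p)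
    (summable_norm_fieldOp Complex.norm_I h q) (isExpField_weylInv k p) (isExpField_weyl h q)
  refine h1.unique (((Equiv.prodComm ℕ ℕ).hasSum_iff.2 h2).congr_fun fun jk => ?_)
  simp only [Function.comp_apply, Equiv.prodComm_apply, Prod.fst_swap, Prod.snd_swap,
    inner_smul_left, inner_smul_right, inner_fieldOp_pow, ← Module.End.mul_apply,
    ((fieldOp_commute hhk).pow_pow jk.1 jk.2).eq]
  simp only [map_div₀, map_pow, map_neg, Complex.conj_I, neg_neg, map_natCast]
  ring

theorem weyl_commute {h k : ℋ} (hhk : ⟪h, k⟫.im = 0) : weyl h * weyl k = weyl k * weyl h := by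
  have hp : ∀ q : MvPolynomial ℋ ℂ, weyl h (weyl k (polyVec q)) = weyl k (weyl h (polyVec q)) :=
    fun q => eq_of_forall_inner_polyVec fun p => by
      rw [inner_weyl h, inner_weyl k (polyVec p), inner_weylInv_weyl_comm hhk]
  refine ContinuousLinearMap.ext fun ψ => ?_
  change weyl h (weyl k ψ) = weyl k (weyl h ψ)
  exact dense_range_polyVec.induction_on
    (p := fun ψ => weyl h (weyl k ψ) = weyl k (weyl h ψ)) ψ
    (isClosed_eq (by fun_prop) (by fun_prop)) hp

/-! ### Weyl operators on coherent vectors -/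

/-- Turns a relation [a, φ^(k+1)] = (k+1) c φ^k between powers of a field operator φ into the
relation [a, e^{zφ}] = z c e^{zφ}, as (k+1) z^(k+1)/(k+1)! = z · z^k/k!. -/
theorem exp_series_recursion {z c A B C : ℂ} {a b d : ℕ → ℂ}
    (ha : HasSum (fun k : ℕ => (z ^ k / (k.factorial : ℂ)) * a k) A)
    (hb : HasSum (fun k : ℕ => (z ^ k / (k.factorial : ℂ)) * b k) B)
    (hd : HasSum (fun k : ℕ => (z ^ k / (k.factorial : ℂ)) * d k) C)
    (h0 : a 0 = b 0) (h : ∀ k : ℕ, a (k + 1) = b (k + 1) + (k + 1 : ℂ) * c * d k) :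
    A = B + z * c * C := by
  have hab := (hasSum_nat_add_iff' 1).2 (ha.sub hb)
  simp only [Finset.range_one, Finset.sum_singleton, h0, sub_self, sub_zero] at hab
  have : A - B = z * c * C := by
    refine hab.unique ((hd.mul_left (z * c)).congr_fun fun k => ?_)
    rw [h, Nat.factorial_succ]
    have : ((k + 1 : ℕ) : ℂ) ≠ 0 := by exact_mod_cast Nat.succ_ne_zero k
    push_cast at this ⊢
    field_simp
    ring
  rw [← this]
  ring

theorem IsExpField.hasSum_inner {z : ℂ} {h : ℋ} {W : FockSpace ℋ →L[ℂ] FockSpace ℋ}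
    (hW : IsExpField z h W) (p q : MvPolynomial ℋ ℂ) :
    HasSum (fun k : ℕ => (z ^ k / (k.factorial : ℂ)) * ⟪polyVec p, polyVec ((fieldOp h ^ k) q)⟫)
      ⟪polyVec p, W (polyVec q)⟫ := by
  simpa only [innerSL_apply_apply, inner_smul_right] using (hW q).mapL (innerSL ℂ (polyVec p))

theorem IsExpField.inner_X_mul_left {z : ℂ} {h : ℋ} {W : FockSpace ℋ →L[ℂ] FockSpace ℋ}
    (hW : IsExpField z h W) (f : ℋ) (p q : MvPolynomial ℋ ℂ) :
    ⟪polyVec (MvPolynomial.X f * p), W (polyVec q)⟫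
      = ⟪polyVec p, W (polyVec (annihilate f q))⟫ + z * ⟪f, h⟫ * ⟪polyVec p, W (polyVec q)⟫ := by
  refine exp_series_recursion (hW.hasSum_inner _ _) (hW.hasSum_inner _ _) (hW.hasSum_inner _ _)
    ?_ fun k => ?_
  · simp [BoseFock.inner_X_mul_left]
  · rw [BoseFock.inner_X_mul_left, annihilate_fieldOp_pow, map_add, map_smul, inner_add_right,
      inner_smul_right]

theorem IsExpField.inner_X_mul_right {z : ℂ} {h : ℋ} {W : FockSpace ℋ →L[ℂ] FockSpace ℋ}
    (hW : IsExpField z h W) (f : ℋ) (p q : MvPolynomial ℋ ℂ) :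
    ⟪polyVec p, W (polyVec (MvPolynomial.X f * q))⟫
      = ⟪polyVec (annihilate f p), W (polyVec q)⟫ + z * ⟪h, f⟫ * ⟪polyVec p, W (polyVec q)⟫ := by
  refine exp_series_recursion (hW.hasSum_inner _ _) (hW.hasSum_inner _ _) (hW.hasSum_inner _ _)
    ?_ fun k => ?_
  · simp [BoseFock.inner_X_mul_right]
  · rw [fieldOp_pow_X_mul, map_add, map_smul, inner_add_right, inner_smul_right,
      BoseFock.inner_X_mul_right]

theorem hasSum_pow_div_factorial (z : ℂ) :
    HasSum (fun n : ℕ => z ^ n / (n.factorial : ℂ)) (Complex.exp z) := by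
  rw [Complex.exp_eq_exp_ℂ]
  exact NormedSpace.exp_series_hasSum_exp' (𝕂 := ℂ) z |>.congr_fun fun n => by
    simp [div_eq_inv_mul]

theorem inner_one_fieldOp_pow (h : ℋ) (k : ℕ) :
    ⟪polyVec 1, polyVec ((fieldOp h ^ (k + 2)) 1)⟫
      = (k + 1 : ℂ) * ⟪h, h⟫ * ⟪polyVec 1, polyVec ((fieldOp h ^ k) 1)⟫ := by
  rw [pow_succ', Module.End.mul_apply, fieldOp_apply, map_add, inner_add_right,
    inner_one_polyVec_X_mul, annihilate_fieldOp_pow, annihilate_one, map_zero, zero_add, zero_add,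
    map_smul, inner_smul_right]

/-- In the vacuum the field is Gaussian with variance ‖h‖². The factor n! is kept on the left to
avoid division. -/
theorem inner_one_fieldOp_pow_even (h : ℋ) (n : ℕ) :
    ⟪polyVec 1, polyVec ((fieldOp h ^ (2 * n)) 1)⟫ * (n.factorial : ℂ)
      = ((2 * n).factorial : ℂ) * (⟪h, h⟫ / 2) ^ n := by
  induction n with
  | zero => simpa using inner_polyVec_one_one
  | succ n ih =>
    rw [show 2 * (n + 1) = 2 * n + 2 by ring, inner_one_fieldOp_pow, Nat.factorial_succ,
      Nat.factorial_succ, Nat.factorial_succ]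
    push_cast
    calc _ = (2 * (n : ℂ) + 1) * ⟪h, h⟫ * (n + 1)
          * (⟪polyVec 1, polyVec ((fieldOp h ^ (2 * n)) 1)⟫ * (n.factorial : ℂ)) := by ring
      _ = _ := by rw [ih]; ring

theorem inner_one_fieldOp_pow_odd (h : ℋ) (n : ℕ) :
    ⟪polyVec 1, polyVec ((fieldOp h ^ (2 * n + 1)) 1)⟫ = 0 := by
  induction n with
  | zero =>
    simp only [mul_zero, zero_add, pow_one, fieldOp_apply, annihilate_one, add_zero]
    exact inner_one_polyVec_X_mul h 1
  | succ n ih =>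
    rw [show 2 * (n + 1) + 1 = (2 * n + 1) + 2 by ring, inner_one_fieldOp_pow, ih, mul_zero]

theorem IsExpField.inner_one_one {z : ℂ} {h : ℋ} {W : FockSpace ℋ →L[ℂ] FockSpace ℋ}
    (hW : IsExpField z h W) :
    ⟪polyVec 1, W (polyVec 1)⟫ = Complex.exp (z ^ 2 * ⟪h, h⟫ / 2) := by
  have he : HasSum (fun n : ℕ => (z ^ (2 * n) / ((2 * n).factorial : ℂ))
      * ⟪polyVec 1, polyVec ((fieldOp h ^ (2 * n)) 1)⟫) (Complex.exp (z ^ 2 * ⟪h, h⟫ / 2)) := by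
    refine (hasSum_pow_div_factorial (z ^ 2 * ⟪h, h⟫ / 2)).congr_fun fun n => ?_
    have h1 := inner_one_fieldOp_pow_even h n
    have h2 : (n.factorial : ℂ) ≠ 0 := by exact_mod_cast Nat.factorial_ne_zero _
    have h3 : ((2 * n).factorial : ℂ) ≠ 0 := by exact_mod_cast Nat.factorial_ne_zero _
    rw [← eq_div_iff h2] at h1
    rw [h1, pow_mul, mul_div_assoc (z ^ 2), mul_pow]
    field_simp
  have ho : HasSum (fun n : ℕ => (z ^ (2 * n + 1) / ((2 * n + 1).factorial : ℂ))
      * ⟪polyVec 1, polyVec ((fieldOp h ^ (2 * n + 1)) 1)⟫) 0 := by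
    simp only [inner_one_fieldOp_pow_odd, mul_zero]
    exact hasSum_zero
  have := (hW.hasSum_inner 1 1).unique (he.even_add_odd ho)
  rwa [add_zero] at this

theorem IsExpField.inner_one_pow {z : ℂ} {h : ℋ} {W : FockSpace ℋ →L[ℂ] FockSpace ℋ}
    (hW : IsExpField z h W) (g : ℋ) (n : ℕ) :
    ⟪polyVec 1, W (polyVec (MvPolynomial.X g ^ n))⟫
      = (z * ⟪h, g⟫) ^ n * Complex.exp (z ^ 2 * ⟪h, h⟫ / 2) := by
  induction n with
  | zero => simpa using hW.inner_one_one
  | succ n ih =>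
    rw [pow_succ', hW.inner_X_mul_right, annihilate_one, map_zero, inner_zero_left, zero_add, ih]
    ring

theorem IsExpField.inner_vacuum_coherent {z : ℂ} {h : ℋ} {W : FockSpace ℋ →L[ℂ] FockSpace ℋ}
    (hW : IsExpField z h W) (g : ℋ) :
    ⟪vacuum ℋ, W (coherent g)⟫ = Complex.exp (z ^ 2 * ⟪h, h⟫ / 2 + z * ⟪h, g⟫) := by
  have h1 := ((hasSum_coherent g).mapL W).mapL (innerSL ℂ (vacuum ℋ))
  have h2 := (hasSum_pow_div_factorial (z * ⟪h, g⟫)).mul_left (Complex.exp (z ^ 2 * ⟪h, h⟫ / 2))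
  rw [Complex.exp_add]
  refine h1.unique (h2.congr_fun fun n => ?_)
  rw [map_smul, innerSL_apply_apply, inner_smul_right, vacuum, hW.inner_one_pow]
  ring

/-- The action of the Weyl operators on coherent vectors. -/
theorem IsExpField.apply_coherent {z : ℂ} {h : ℋ} {W : FockSpace ℋ →L[ℂ] FockSpace ℋ}
    (hW : IsExpField z h W) (g : ℋ) :
    W (coherent g) = Complex.exp (z ^ 2 * ⟪h, h⟫ / 2 + z * ⟪h, g⟫) • coherent (g + z • h) := by
  rw [← hW.inner_vacuum_coherent g]
  -- By the commutation relation, W (coherent g) is a joint eigenvector of the annihilation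
  -- operators with eigenvalues ⟪f, g + z • h⟫. It is therefore a multiple of a coherent vector, and
  -- the multiple is read off from the vacuum component.
  refine eq_smul_coherent_of_eigen fun f p => ?_
  let F : FockSpace ℋ →L[ℂ] ℂ := (innerSL ℂ (polyVec (MvPolynomial.X f * p))) ∘L W
    - (z * ⟪f, h⟫) • ((innerSL ℂ (polyVec p)) ∘L W)
  have hF : F (coherent g) = ⟪f, g⟫ * ((innerSL ℂ (polyVec p)) ∘L W) (coherent g) := by
    refine coherent_recursion ?_ fun n => ?_
    · simp [F, hW.inner_X_mul_left, annihilate_one]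
    · simp only [F, sub_apply, smul_apply,
        ContinuousLinearMap.comp_apply, innerSL_apply_apply, hW.inner_X_mul_left,
        annihilate_X_pow, map_smul, inner_smul_right, smul_eq_mul]
      ring
  simp only [F, sub_apply, smul_apply,
    ContinuousLinearMap.comp_apply, innerSL_apply_apply, smul_eq_mul] at hF
  rw [inner_add_right, inner_smul_right, add_mul, ← hF]
  ring

theorem coherent_zero : coherent (0 : ℋ) = vacuum ℋ := by
  refine eq_of_forall_inner_multiset fun s => ?_
  rw [inner_multiset_coherent]
  induction s using Multiset.induction_on with
  | empty => simpa [vacuum] using inner_polyVec_one_one.symm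
  | cons f s ih =>
    simp [vacuum, BoseFock.inner_X_mul_left, annihilate_one]

end BoseFock

end


noncomputable section

namespace BoseFock

variable {ℋ : Type*} [NormedAddCommGroup ℋ] [InnerProductSpace ℂ ℋ]

/-! ### Total sets of finite particle vectors -/

theorem annihilate_add_left (f g : ℋ) (p : MvPolynomial ℋ ℂ) :
    annihilate (f + g) p = annihilate f p + annihilate g p := by
  have h : polyAnnihilation (f + g) = polyAnnihilation f + polyAnnihilation g :=
    MvPolynomial.derivation_ext fun i => by simp [polyAnnihilation]
  exact congrArg (fun D => D p) h

theorem annihilate_smul_left (c : ℂ) (f : ℋ) (p : MvPolynomial ℋ ℂ) :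
    annihilate (c • f) p = (starRingEnd ℂ) c • annihilate f p := by
  have h : polyAnnihilation (c • f) = (starRingEnd ℂ) c • polyAnnihilation f :=
    MvPolynomial.derivation_ext fun i => by
      simp [polyAnnihilation, MvPolynomial.smul_eq_C_mul, mul_comm]
  exact congrArg (fun D => D p) h

/-- The map `f ↦ a(f)^* q`. -/
def creationLM (q : MvPolynomial ℋ ℂ) : ℋ →ₗ[ℂ] FockSpace ℋ where
  toFun f := polyVec (MvPolynomial.X f * q)
  map_add' f g := eq_of_forall_inner_polyVec fun p => by
    rw [inner_add_right]
    simp only [inner_X_mul_right, annihilate_add_left, map_add, inner_add_left]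
  map_smul' c f := eq_of_forall_inner_polyVec fun p => by
    rw [RingHom.id_apply, inner_smul_right, inner_X_mul_right, inner_X_mul_right,
      annihilate_smul_left, map_smul, inner_smul_left, Complex.conj_conj]

theorem continuous_creationLM (q : MvPolynomial ℋ ℂ) : Continuous (creationLM q) := by
  obtain ⟨n, hn⟩ := exists_mem_degLE q
  refine AddMonoidHomClass.continuous_of_bound (creationLM q) (√(n + 1) * ‖polyVec q‖) fun f => ?_
  refine (norm_X_mul_le f hn).trans (le_of_eq ?_)
  ring

/-- Products of creation operators with entries in a total set generate Fock space. -/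
theorem eq_of_forall_inner_multiset_of_total {D : Set ℋ}
    (hD : (Submodule.span ℂ D).topologicalClosure = ⊤) {ψ ψ' : FockSpace ℋ}
    (h : ∀ s : Multiset ℋ, (∀ f ∈ s, f ∈ D) →
      ⟪polyVec (s.map MvPolynomial.X).prod, ψ⟫ = ⟪polyVec (s.map MvPolynomial.X).prod, ψ'⟫) :
    ψ = ψ' := by
  -- The factors in `t` already lie in `D` and those in `s` are arbitrary. A factor of `s` may be
  -- moved to `t` once it is known to be in `D`, and the vectors f for which the pairing vanishes
  -- form a closed subspace.
  have key : ∀ s t : Multiset ℋ, (∀ f ∈ t, f ∈ D) →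
      ⟪ψ - ψ', polyVec ((s.map MvPolynomial.X).prod * (t.map MvPolynomial.X).prod)⟫ = 0 := by
    intro s
    induction s using Multiset.induction_on with
    | empty =>
      intro t ht
      rw [Multiset.map_zero, Multiset.prod_zero, one_mul, ← inner_conj_symm, inner_sub_right,
        h t ht, sub_self, map_zero]
    | cons f s ih =>
      intro t ht
      let q : MvPolynomial ℋ ℂ := (s.map MvPolynomial.X).prod * (t.map MvPolynomial.X).prod
      have hc : Continuous (creationLM q) := continuous_creationLM q
      let V : Submodule ℂ ℋ := LinearMap.ker ((innerₛₗ ℂ (ψ - ψ')).comp (creationLM q))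
      have hV : IsClosed (V : Set ℋ) := by
        have : (V : Set ℋ) = {f | ⟪ψ - ψ', creationLM q f⟫ = 0} := rfl
        rw [this]
        exact isClosed_eq (by fun_prop) continuous_const
      have hDV : Submodule.span ℂ D ≤ V := by
        rw [Submodule.span_le]
        intro g hg
        change ⟪ψ - ψ', polyVec (MvPolynomial.X g * q)⟫ = 0
        have := ih (g ::ₘ t) (by simpa using ⟨hg, ht⟩)
        rw [Multiset.map_cons, Multiset.prod_cons, mul_left_comm] at this
        exact this
      have htop : V = ⊤ := top_le_iff.1 (hD ▸ Submodule.topologicalClosure_minimal _ hDV hV)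
      have hf : f ∈ V := htop ▸ Submodule.mem_top
      rw [Multiset.map_cons, Multiset.prod_cons, mul_assoc]
      exact hf
  refine eq_of_forall_inner_multiset fun s => ?_
  have := key s 0 (by simp)
  rw [Multiset.map_zero, Multiset.prod_zero, mul_one, ← inner_conj_symm, map_eq_zero,
    inner_sub_right, sub_eq_zero] at this
  exact this

/-! ### Second quantization -/

theorem annihilate_rename {σ : Type*} (j : σ → ℋ) (f : ℋ) (q : MvPolynomial σ ℂ) :
    annihilate f (MvPolynomial.rename j q) = MvPolynomial.rename j
      (MvPolynomial.mkDerivation ℂ (fun g => (MvPolynomial.C ⟪f, j g⟫ : MvPolynomial σ ℂ)) q) := by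
  induction q using MvPolynomial.induction_on with
  | C c => simp [annihilate]
  | add p q hp hq => simp [annihilate_add, hp, hq]
  | mul_X p g hp =>
    rw [map_mul, MvPolynomial.rename_X, mul_comm, annihilate_X_mul, hp]
    simp [MvPolynomial.smul_eq_C_mul]
    ring

theorem inner_one_polyVec (q : MvPolynomial ℋ ℂ) :
    ⟪polyVec 1, polyVec q⟫ = MvPolynomial.constantCoeff q := by
  rw [inner_polyVec, show (1 : MvPolynomial ℋ ℂ) = MvPolynomial.monomial 0 1 from rfl,
    polyInner_monomial]
  simp [vacuumPairing]

/-- Both sides depend only on the pairings of the images of the variables, and these agree. With i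
the inclusion of the domain and j = X₁, it says that the algebraic second quantization is symmetric.
-/
theorem inner_rename_comm {σ : Type*} (i j : σ → ℋ) (hij : ∀ x y, ⟪i x, j y⟫ = ⟪j x, i y⟫)
    (p q : MvPolynomial σ ℂ) :
    ⟪polyVec (MvPolynomial.rename i p), polyVec (MvPolynomial.rename j q)⟫
      = ⟪polyVec (MvPolynomial.rename j p), polyVec (MvPolynomial.rename i q)⟫ := by
  induction p using MvPolynomial.induction_on generalizing q with
  | C c =>
    have h : (MvPolynomial.C c : MvPolynomial ℋ ℂ) = c • 1 := by
      rw [MvPolynomial.smul_eq_C_mul, mul_one]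
    rw [MvPolynomial.rename_C, MvPolynomial.rename_C, h, map_smul, inner_smul_left,
      inner_smul_left, inner_one_polyVec, inner_one_polyVec, MvPolynomial.constantCoeff_rename,
      MvPolynomial.constantCoeff_rename]
  | add p p' h h' => simp only [map_add, inner_add_left, h, h']
  | mul_X p x hp =>
    rw [mul_comm, map_mul (MvPolynomial.rename i), map_mul (MvPolynomial.rename j),
      MvPolynomial.rename_X, MvPolynomial.rename_X, inner_X_mul_left, inner_X_mul_left,
      annihilate_rename, annihilate_rename, hp]
    simp only [hij]

theorem inner_apply_comm [CompleteSpace ℋ] {X₁ : ℋ →ₗ.[ℂ] ℋ} (hX₁ : IsSelfAdjoint X₁)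
    (x y : X₁.domain) :
    ⟪X₁ x, (y : ℋ)⟫ = ⟪(x : ℋ), X₁ y⟫ := by
  have h := LinearPMap.adjoint_isFormalAdjoint hX₁.dense_domain
  rw [LinearPMap.isSelfAdjoint_def.1 hX₁] at h
  exact h x y

theorem inner_of_mem_closure_graph [CompleteSpace ℋ] {X₁ : ℋ →ₗ.[ℂ] ℋ} (hX₁ : IsSelfAdjoint X₁)
    {x : FockSpace ℋ × FockSpace ℋ} (hx : x ∈ (secondQuantizationGraph X₁).topologicalClosure)
    (p : MvPolynomial X₁.domain ℂ) :
    ⟪polyVec (MvPolynomial.rename (fun f : X₁.domain => (f : ℋ)) p), x.2⟫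
      = ⟪polyVec (MvPolynomial.rename (fun f : X₁.domain => X₁ f) p), x.1⟫ := by
  have hcl : IsClosed {x : FockSpace ℋ × FockSpace ℋ |
      ⟪polyVec (MvPolynomial.rename (fun f : X₁.domain => (f : ℋ)) p), x.2⟫
      = ⟪polyVec (MvPolynomial.rename (fun f : X₁.domain => X₁ f) p), x.1⟫} :=
    isClosed_eq (by fun_prop) (by fun_prop)
  refine closure_minimal ?_ hcl hx
  rintro _ ⟨q, rfl⟩
  exact inner_rename_comm _ _ (fun x y => (inner_apply_comm hX₁ x y).symm) p q

/-- Closability: a symmetric operator with total domain has a closable graph. This is what makes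
`toLinearPMap` in `secondQuantization` an operator whose graph really is the closure. -/
theorem eq_zero_of_mem_closure_graph [CompleteSpace ℋ] {X₁ : ℋ →ₗ.[ℂ] ℋ} (hX₁ : IsSelfAdjoint X₁)
    (x : FockSpace ℋ × FockSpace ℋ) (hx : x ∈ (secondQuantizationGraph X₁).topologicalClosure)
    (h0 : x.1 = 0) : x.2 = 0 := by
  have hD : (Submodule.span ℂ (X₁.domain : Set ℋ)).topologicalClosure = ⊤ := by
    rw [Submodule.span_eq]
    exact Submodule.dense_iff_topologicalClosure_eq_top.1 hX₁.dense_domain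
  refine eq_of_forall_inner_multiset_of_total hD fun s hs => ?_
  lift s to Multiset X₁.domain using hs
  have h := inner_of_mem_closure_graph hX₁ hx (s.map MvPolynomial.X).prod
  rw [h0, inner_zero_right] at h
  rw [inner_zero_right, ← h, map_multiset_prod
    (MvPolynomial.rename (R := ℂ) (fun f : X₁.domain => (f : ℋ))), Multiset.map_map,
    Multiset.map_map]
  simp

theorem inner_rename_secondQuantization [CompleteSpace ℋ] {X₁ : ℋ →ₗ.[ℂ] ℋ} (hX₁ : IsSelfAdjoint X₁)
    (ψ : (secondQuantization X₁).domain) (p : MvPolynomial X₁.domain ℂ) :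
    ⟪polyVec (MvPolynomial.rename (fun f : X₁.domain => (f : ℋ)) p), secondQuantization X₁ ψ⟫
      = ⟪polyVec (MvPolynomial.rename (fun f : X₁.domain => X₁ f) p), (ψ : FockSpace ℋ)⟫ :=
  inner_of_mem_closure_graph hX₁
    (Submodule.mem_graph_toLinearPMap (eq_zero_of_mem_closure_graph hX₁) ψ) p

theorem inner_coherent_secondQuantization [CompleteSpace ℋ] {X₁ : ℋ →ₗ.[ℂ] ℋ}
    (hX₁ : IsSelfAdjoint X₁)
    (ψ : (secondQuantization X₁).domain) (g : X₁.domain) :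
    ⟪coherent (g : ℋ), secondQuantization X₁ ψ⟫ = ⟪coherent (X₁ g), (ψ : FockSpace ℋ)⟫ := by
  have h1 := ((hasSum_coherent (g : ℋ)).mapL (innerSL ℂ (secondQuantization X₁ ψ))).star
  have h2 := ((hasSum_coherent (X₁ g)).mapL (innerSL ℂ (ψ : FockSpace ℋ))).star
  simp only [innerSL_apply_apply, RCLike.star_def, inner_conj_symm] at h1 h2
  refine h1.unique (h2.congr_fun fun n => ?_)
  rw [inner_smul_left, inner_smul_left]
  congr 1
  simpa using inner_rename_secondQuantization hX₁ ψ (MvPolynomial.X g ^ n)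

/-! ### Analytic continuation in coherent vectors -/

theorem differentiable_inner_polyVec_coherent (p : MvPolynomial ℋ ℂ) (η k : ℋ) :
    Differentiable ℂ fun z : ℂ => ⟪polyVec p, coherent (η + z • k)⟫ := by
  obtain ⟨n, hn⟩ := exists_mem_degLE p
  induction hn using Submodule.span_induction with
  | mem p hp =>
    obtain ⟨s, -, rfl⟩ := hp
    simp only [inner_multiset_coherent]
    induction s using Multiset.induction_on with
    | empty => simp
    | cons f s ih =>
      simp only [Multiset.map_cons, Multiset.prod_cons, inner_add_right, inner_smul_right] at ih ⊢
      fun_prop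
  | zero => simp
  | add p q _ _ hp hq =>
    simp only [map_add, inner_add_left]
    fun_prop
  | smul c p _ hp =>
    simp only [map_smul, inner_smul_left]
    fun_prop

/-- For polynomial ψ the function is a polynomial in z. General ψ is a limit of polynomials, and the
limit is locally uniform because the norms of the coherent vectors are bounded on discs. -/
theorem differentiable_inner_coherent (ψ : FockSpace ℋ) (η k : ℋ) :
    Differentiable ℂ fun z : ℂ => ⟪ψ, coherent (η + z • k)⟫ := by
  obtain ⟨u, hu, hlim⟩ := mem_closure_iff_seq_limit.1 (dense_range_polyVec ψ)
  choose p hp using hu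
  rw [← differentiableOn_univ]
  refine TendstoLocallyUniformlyOn.differentiableOn (φ := Filter.atTop)
    (F := fun (n : ℕ) (z : ℂ) => ⟪u n, coherent (η + z • k)⟫) ?_ (Filter.Eventually.of_forall
      fun n => ?_) isOpen_univ
  · rw [Metric.tendstoLocallyUniformlyOn_iff]
    intro ε hε z _
    set C := Real.exp ((‖η‖ + (‖z‖ + 1) * ‖k‖) ^ 2 / 2) with hC
    have hC0 : 0 < C := Real.exp_pos _
    refine ⟨Metric.ball z 1, mem_nhdsWithin_of_mem_nhds (Metric.ball_mem_nhds z one_pos), ?_⟩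
    have hd : ∀ᶠ n in Filter.atTop, dist (u n) ψ < ε / C :=
      (Metric.tendsto_nhds.1 hlim) _ (div_pos hε hC0)
    filter_upwards [hd] with n hn w hw
    have hw' : ‖w‖ ≤ ‖z‖ + 1 := by
      have h1 : ‖w - z‖ < 1 := by simpa [dist_eq_norm] using hw
      have h2 := norm_add_le (w - z) z
      rw [sub_add_cancel] at h2
      linarith
    have hb : ‖coherent (η + w • k)‖ ≤ C := by
      rw [norm_coherent, hC]
      gcongr
      refine (norm_add_le _ _).trans ?_
      rw [norm_smul]
      gcongr
    rw [dist_comm, dist_eq_norm, ← inner_sub_left]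
    calc ‖⟪u n - ψ, coherent (η + w • k)⟫‖ ≤ ‖u n - ψ‖ * ‖coherent (η + w • k)‖ :=
          norm_inner_le_norm _ _
      _ ≤ ‖u n - ψ‖ * C := by gcongr
      _ < ε / C * C := by
          rw [← dist_eq_norm]
          gcongr
      _ = ε := by field_simp
  · rw [← hp n]
    exact (differentiable_inner_polyVec_coherent (p n) η k).differentiableOn

theorem eq_of_eq_on_reals {f g : ℂ → ℂ} (hf : Differentiable ℂ f) (hg : Differentiable ℂ g)
    (h : ∀ s : ℝ, f s = g s) : f = g := by
  have hfa : AnalyticOnNhd ℂ f Set.univ := fun z _ => hf.analyticAt z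
  have hga : AnalyticOnNhd ℂ g Set.univ := fun z _ => hg.analyticAt z
  refine hfa.eq_of_frequently_eq hga (z₀ := 0) ?_
  have ht : Filter.Tendsto (fun n : ℕ => ((1 / ((n : ℝ) + 1) : ℝ) : ℂ)) Filter.atTop
      (nhdsWithin 0 {0}ᶜ) := by
    refine tendsto_nhdsWithin_iff.2 ⟨?_, Filter.Eventually.of_forall fun n => ?_⟩
    · have := (Complex.continuous_ofReal.tendsto 0).comp
        (tendsto_one_div_add_atTop_nhds_zero_nat (𝕜 := ℝ))
      rwa [Complex.ofReal_zero] at this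
    · simp only [Set.mem_compl_iff, Set.mem_singleton_iff, Complex.ofReal_eq_zero]
      positivity
  exact ht.frequently (Filter.Frequently.of_forall fun n => h _)

/-! ### The estimate for `M(H)` -/

/-- For k in the symplectic complement of H, W(k) commutes with the generators of M(H), so it lies
in the commutant M(H)'. -/
theorem commute_weyl_of_mem {H : ClosedSubmodule ℝ ℋ} {A : FockSpace ℋ →L[ℂ] FockSpace ℋ}
    (hA : A ∈ secondQuantizedAlgebra H) {k : ℋ} (hk : ∀ h ∈ H, ⟪h, k⟫.im = 0) :
    weyl k * A = A * weyl k := by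
  refine (Subalgebra.mem_centralizer_iff ℂ).1 hA (weyl k) ?_
  refine (Subalgebra.mem_centralizer_iff ℂ).2 ?_
  rintro W ⟨h, hh, hW⟩
  rw [eq_weyl_of_isWeylOperator hW]
  exact weyl_commute (hk h hh)

/-- Slide W(k) through A and let it act on the coherent vector on either side. The exponents ‖k‖²/2
of the two actions cancel. -/
theorem inner_coherent_shift_real {H : ClosedSubmodule ℝ ℋ} {A : FockSpace ℋ →L[ℂ] FockSpace ℋ}
    (hA : A ∈ secondQuantizedAlgebra H) {k : ℋ} (hk : ∀ h ∈ H, ⟪h, k⟫.im = 0) (g η : ℋ) :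
    ⟪coherent (g - Complex.I • k), A (coherent η)⟫
      = Complex.exp (Complex.I * (⟪k, η⟫ - ⟪g, k⟫))
        * ⟪coherent g, A (coherent (η + Complex.I • k))⟫ := by
  have h1 : weyl k (A (coherent η)) = A (weyl k (coherent η)) :=
    congrArg (fun B : FockSpace ℋ →L[ℂ] FockSpace ℋ => B (coherent η)) (commute_weyl_of_mem hA hk)
  have h2 := inner_weyl k (coherent g) (A (coherent η))
  rw [h1, (isExpField_weyl k).apply_coherent, (isExpField_weylInv k).apply_coherent, map_smul,
    inner_smul_left, inner_smul_right, neg_smul, ← sub_eq_add_neg, ← Complex.exp_conj] at h2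
  have hne : Complex.exp ((starRingEnd ℂ) ((-Complex.I) ^ 2 * ⟪k, k⟫ / 2 + -Complex.I * ⟪k, g⟫))
      ≠ 0 := Complex.exp_ne_zero _
  refine mul_left_cancel₀ hne ?_
  rw [← h2, ← mul_assoc, ← Complex.exp_add]
  congr 2
  simp only [map_add, map_mul, map_neg, map_div₀, map_pow, Complex.conj_I, inner_conj_symm,
    map_ofNat]
  ring_nf

/-- For real multiples of k this is the preceding relation. Both sides extend to entire functions of
the multiple, so it persists for complex multiples, although i k need not be symplectically
orthogonal to H. -/
theorem inner_coherent_shift {H : ClosedSubmodule ℝ ℋ} {A : FockSpace ℋ →L[ℂ] FockSpace ℋ}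
    (hA : A ∈ secondQuantizedAlgebra H) {k : ℋ} (hk : ∀ h ∈ H, ⟪h, k⟫.im = 0) (g η : ℋ) (w : ℂ) :
    ⟪coherent (g + (starRingEnd ℂ) w • k), A (coherent η)⟫
      = Complex.exp (w * (⟪k, η⟫ - ⟪g, k⟫)) * ⟪coherent g, A (coherent (η + w • k))⟫ := by
  -- The conjugation on the left makes the function holomorphic, as coherent vectors in the first
  -- entry depend antiholomorphically on the parameter.
  have key : (fun z : ℂ => (starRingEnd ℂ)
        ⟪A (coherent η), coherent (g + (starRingEnd ℂ) z • (-Complex.I • k))⟫)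
      = fun z : ℂ => Complex.exp (Complex.I * z * (⟪k, η⟫ - ⟪g, k⟫))
        * ⟪ContinuousLinearMap.adjoint A (coherent g), coherent (η + z • (Complex.I • k))⟫ := by
    refine eq_of_eq_on_reals ?_ ?_ fun s => ?_
    · intro z
      have := ((differentiable_inner_coherent (A (coherent η)) g (-Complex.I • k))
        ((starRingEnd ℂ) z)).conj_conj
      rwa [Complex.conj_conj] at this
    · have := differentiable_inner_coherent (ContinuousLinearMap.adjoint A (coherent g)) η
        (Complex.I • k)
      fun_prop
    · have hs : ∀ h ∈ H, ⟪h, (s : ℂ) • k⟫.im = 0 := fun h hh => by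
        rw [inner_smul_right, Complex.im_ofReal_mul, hk h hh, mul_zero]
      have := inner_coherent_shift_real hA hs g η
      rw [inner_conj_symm, ContinuousLinearMap.adjoint_inner_left, Complex.conj_ofReal]
      rw [inner_smul_left, inner_smul_right, Complex.conj_ofReal] at this
      rw [smul_comm _ Complex.I, neg_smul, smul_neg, ← sub_eq_add_neg, smul_comm (s : ℂ) Complex.I,
        this]
      congr 2
      ring
  -- The parameter -i w turns the translation by i z k into one by w k.
  have h := congrFun key (-Complex.I * w)
  have h1 : Complex.I * (starRingEnd ℂ) w * -Complex.I = (starRingEnd ℂ) w := by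
    linear_combination (-(starRingEnd ℂ) w) * Complex.I_mul_I
  have h2 : Complex.I * (-Complex.I * w) = w := by linear_combination (-w) * Complex.I_mul_I
  have h3 : -Complex.I * w * Complex.I = w := by linear_combination (-w) * Complex.I_mul_I
  simpa only [inner_conj_symm, ContinuousLinearMap.adjoint_inner_left, map_mul, map_neg,
    Complex.conj_I, smul_smul, neg_neg, h1, h2, h3] using h

/-- Shift by k₁ with the parameter -i, then by k₂ with the parameter 1. The conjugate of the
parameter on the left makes the translation there k₂ + i k₁, and k₂ - i k₁ on the right. -/
theorem inner_coherent_vacuum_eq {H : ClosedSubmodule ℝ ℋ} {A : FockSpace ℋ →L[ℂ] FockSpace ℋ}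
    (hA : A ∈ secondQuantizedAlgebra H) {k₁ k₂ : ℋ} (h₁ : ∀ h ∈ H, ⟪h, k₁⟫.im = 0)
    (h₂ : ∀ h ∈ H, ⟪h, k₂⟫.im = 0) (g : ℋ) :
    ⟪coherent (g + k₂ + Complex.I • k₁), A (vacuum ℋ)⟫
      = Complex.exp (-⟪g, k₂ - Complex.I • k₁⟫)
        * ⟪coherent g, A (coherent (k₂ - Complex.I • k₁))⟫ := by
  have s1 := inner_coherent_shift hA h₁ (g + k₂) 0 (-Complex.I)
  have s2 := inner_coherent_shift hA h₂ g (-Complex.I • k₁) 1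
  rw [map_neg, Complex.conj_I, neg_neg, zero_add, coherent_zero] at s1
  rw [map_one, one_smul] at s2
  rw [s1, s2, ← mul_assoc, ← Complex.exp_add, neg_smul, neg_add_eq_sub]
  congr 2
  simp only [inner_add_left, inner_sub_right, inner_neg_right, inner_smul_right, inner_zero_right]
  ring

/-- An element of `M(H)` sees a coherent vector only through its components along `H`. -/
theorem norm_inner_coherent_le_exp [CompleteSpace ℋ] {H : ClosedSubmodule ℝ ℋ}
    {A : FockSpace ℋ →L[ℂ] FockSpace ℋ} (hA : A ∈ secondQuantizedAlgebra H) (ξ : ℋ) :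
    ‖⟪coherent ξ, A (vacuum ℋ)⟫‖ ≤ ‖A‖ * Real.exp (‖realProj H (Complex.I • ξ)‖ ^ 2 / 2) := by
  -- A vector that is real orthogonal to H becomes symplectically orthogonal after multiplication by
  -- i. The factor 1/2 is the one for which the decomposition below reproduces ξ.
  have hcompl : ∀ (x h : ℋ), h ∈ H → ⟪h, (-Complex.I / 2) • (x - realProj H x)⟫.im = 0 :=
    fun x h hh => by
      have h0 : ⟪h, x - realProj H x⟫.re = 0 := by
        open ClosedSubmodule in
        exact (Submodule.mem_orthogonal _ _).1
          (H.toSubmodule.sub_starProjection_mem_orthogonal x) h hh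
      rw [inner_smul_right]
      simp [Complex.mul_im, h0]
  -- With u = E_H ξ and v = E_H(iξ), the two sides carry the coherent vectors of g₁ = (u - i v)/2
  -- and g₂ = (u + i v)/2. After Cauchy–Schwarz the total exponent is ‖g₁ - g₂‖²/2, and g₁ - g₂ = -i
  -- v.
  have key := inner_coherent_vacuum_eq hA (hcompl ξ) (hcompl (Complex.I • ξ))
    ((1 / 2 : ℂ) • (realProj H ξ - Complex.I • realProj H (Complex.I • ξ)))
  generalize realProj H ξ = u at key
  generalize realProj H (Complex.I • ξ) = v at key ⊢
  have e1 : (1 / 2 : ℂ) • (u - Complex.I • v) + (-Complex.I / 2) • (Complex.I • ξ - v)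
      + Complex.I • (-Complex.I / 2) • (ξ - u) = ξ := by
    match_scalars <;> ring_nf <;> simp only [Complex.I_sq] <;> norm_num
  have e2 : (1 / 2 : ℂ) • (u - Complex.I • v) - ((-Complex.I / 2) • (Complex.I • ξ - v)
      - Complex.I • (-Complex.I / 2) • (ξ - u)) = -Complex.I • v := by
    match_scalars <;> ring_nf <;> simp only [Complex.I_sq] <;> norm_num
  rw [e1] at key
  generalize (1 / 2 : ℂ) • (u - Complex.I • v) = g₁ at key e2
  generalize (-Complex.I / 2) • (Complex.I • ξ - v)
      - Complex.I • (-Complex.I / 2) • (ξ - u) = g₂ at key e2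
  have hv : ‖v‖ ^ 2 = ‖g₁‖ ^ 2 - 2 * (⟪g₁, g₂⟫).re + ‖g₂‖ ^ 2 := by
    have h1 : ‖v‖ = ‖g₁ - g₂‖ := by rw [e2, norm_smul]; simp
    rw [h1]
    exact @norm_sub_sq ℂ _ _ _ _ g₁ g₂
  rw [key, norm_mul, Complex.norm_exp, Complex.neg_re]
  calc Real.exp (-(⟪g₁, g₂⟫).re) * ‖⟪coherent g₁, A (coherent g₂)⟫‖
      ≤ Real.exp (-(⟪g₁, g₂⟫).re) * (‖coherent g₁‖ * (‖A‖ * ‖coherent g₂‖)) := by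
        gcongr
        exact (norm_inner_le_norm _ _).trans (by gcongr; exact A.le_opNorm _)
    _ = ‖A‖ * Real.exp (‖v‖ ^ 2 / 2) := by
        rw [norm_coherent, norm_coherent, mul_left_comm (Real.exp _) ‖A‖, mul_left_comm,
          ← Real.exp_add, ← Real.exp_add, hv]
        congr 2
        ring

end BoseFock

end


noncomputable section

/-! ### Approximation numbers -/

section ApproximationNumbers

variable {𝕜 E F : Type*} [RCLike 𝕜]
  [NormedAddCommGroup E] [NormedSpace 𝕜 E] [NormedAddCommGroup F] [NormedSpace 𝕜 F]

theorem opENorm_le_ofReal {T : E →ₗ[𝕜] F} {c : ℝ} (hc : 0 ≤ c) (h : ∀ x, ‖T x‖ ≤ c * ‖x‖) :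
    opENorm T ≤ ENNReal.ofReal c := by
  refine iSup₂_le fun x hx => ?_
  rw [← ofReal_norm]
  refine ENNReal.ofReal_le_ofReal ((h x).trans ?_)
  exact mul_le_of_le_one_right hc hx

theorem norm_apply_le_of_opENorm_ne_top {T : E →ₗ[𝕜] F} (hT : opENorm T ≠ ∞) (x : E) :
    ‖T x‖ ≤ (opENorm T).toReal * ‖x‖ := by
  have h1 : ∀ y : E, ‖y‖ ≤ 1 → ‖T y‖ ≤ (opENorm T).toReal := fun y hy => by
    have : ‖T y‖ₑ ≤ opENorm T :=
      le_iSup₂_of_le (f := fun (y : E) (_ : ‖y‖ ≤ 1) => ‖T y‖ₑ) y hy le_rfl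
    have h := ENNReal.toReal_mono hT this
    rwa [toReal_enorm] at h
  rcases eq_or_ne x 0 with rfl | hx
  · simp
  have hx' : 0 < ‖x‖ := norm_pos_iff.2 hx
  have h2 := h1 (((‖x‖⁻¹ : ℝ) : 𝕜) • x) (by
    rw [norm_smul, RCLike.norm_ofReal, abs_of_pos (inv_pos.2 hx'), inv_mul_cancel₀ hx'.ne'])
  rw [map_smul, norm_smul, RCLike.norm_ofReal, abs_of_pos (inv_pos.2 hx'),
    inv_mul_le_iff₀ hx'] at h2
  linarith

theorem approxNumber_antitone (T : E →ₗ[𝕜] F) : Antitone fun n => approxNumber n T := by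
  intro m n hmn
  refine le_iInf₂ fun S hS => iInf₂_le_of_le S (hS.trans ?_) le_rfl
  exact_mod_cast hmn

theorem tsum_le_two_mul_tsum_even {a : ℕ → ℝ≥0∞} (ha : Antitone a) :
    ∑' n, a n ≤ 2 * ∑' n, a (2 * n) := by
  rw [← tsum_even_add_odd ENNReal.summable ENNReal.summable, two_mul]
  gcongr with n
  exact ha (Nat.le_succ _)

end ApproximationNumbers

namespace BoseFock

variable {ℋ : Type*} [NormedAddCommGroup ℋ] [InnerProductSpace ℂ ℋ]

/-! ### The one particle component -/

/-- The embedding of the one particle space. -/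
def oneParticle : ℋ →L[ℂ] FockSpace ℋ := ⟨creationLM 1, continuous_creationLM 1⟩

theorem oneParticle_apply (f : ℋ) : oneParticle f = polyVec (MvPolynomial.X f) := by
  change polyVec (MvPolynomial.X f * 1) = _
  rw [mul_one]

theorem norm_oneParticle_apply (f : ℋ) : ‖oneParticle f‖ = ‖f‖ := by
  have h := norm_sq_X_mul f 1
  have h1 : ‖polyVec (1 : MvPolynomial ℋ ℂ)‖ = 1 := norm_vacuum
  rw [h1, annihilate_one, map_zero, norm_zero, mul_one, ← oneParticle_apply, one_pow, mul_one,
    zero_pow two_ne_zero, add_zero] at h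
  exact (pow_left_inj₀ (norm_nonneg _) (norm_nonneg _) two_ne_zero).1 h

theorem norm_weyl_le (h : ℋ) : ‖weyl h‖ ≤ 1 :=
  ContinuousLinearMap.opNorm_le_bound _ zero_le_one fun ψ => by rw [norm_weyl_apply, one_mul]

theorem weyl_mem {H : ClosedSubmodule ℝ ℋ} {h : ℋ} (hh : h ∈ H) :
    weyl h ∈ secondQuantizedAlgebra H := by
  refine (Subalgebra.mem_centralizer_iff ℂ).2 fun B hB => ?_
  exact ((Subalgebra.mem_centralizer_iff ℂ).1 hB (weyl h) ⟨h, hh, isWeylOperator_weyl h⟩).symm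

theorem weyl_vacuum (h : ℋ) :
    weyl h (vacuum ℋ) = ((Real.exp (-‖h‖ ^ 2 / 2) : ℝ) : ℂ) • coherent (Complex.I • h) := by
  rw [← coherent_zero, (isExpField_weyl h).apply_coherent, zero_add, inner_zero_right,
    inner_self_eq_norm_sq_to_K]
  congr 1
  push_cast
  congr 1
  rw [Complex.I_sq]
  simp

variable [CompleteSpace ℋ]

/-- W(h) Ω is e^{-‖h‖²/2} times the coherent vector of i h, whose one particle part is i h. Testing
against the dense domain of X₁ transfers X₁ onto h. -/
theorem oneParticle_adjoint_xiMap_weyl {H : ClosedSubmodule ℝ ℋ} {X₁ : ℋ →ₗ.[ℂ] ℋ}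
    (hX₁ : IsSelfAdjoint X₁) (hH : ∀ h ∈ H, h ∈ X₁.domain)
    (hX : ∀ A ∈ secondQuantizedAlgebra H, A (vacuum ℋ) ∈ (secondQuantization X₁).domain)
    {h : ℋ} (hh : h ∈ H) :
    ContinuousLinearMap.adjoint oneParticle (xiMap H X₁ hX ⟨weyl h, weyl_mem hh⟩)
      = (((Real.exp (-‖h‖ ^ 2 / 2) : ℝ) : ℂ) * Complex.I) • X₁ ⟨h, hH h hh⟩ := by
  refine hX₁.dense_domain.eq_of_inner_right (𝕜 := ℂ) fun g hg => ?_
  rw [ContinuousLinearMap.adjoint_inner_right, oneParticle_apply]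
  have h1 := inner_rename_secondQuantization hX₁
    ⟨weyl h (vacuum ℋ), hX _ (weyl_mem hh)⟩ (MvPolynomial.X ⟨g, hg⟩)
  rw [MvPolynomial.rename_X, MvPolynomial.rename_X] at h1
  refine h1.trans ?_
  change ⟪_, weyl h (vacuum ℋ)⟫ = _
  have h2 := inner_X_mul_coherent (X₁ ⟨g, hg⟩) (Complex.I • h) 1
  rw [mul_one] at h2
  rw [weyl_vacuum, inner_smul_right, h2, inner_smul_right, inner_smul_right,
    inner_apply_comm hX₁ ⟨g, hg⟩ ⟨h, hH h hh⟩]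
  have h3 := inner_vacuum_coherent (Complex.I • h)
  rw [vacuum] at h3
  rw [h3]
  ring

theorem oneParticleMap_apply_of_mem {H : ClosedSubmodule ℝ ℋ} {X₁ : ℋ →ₗ.[ℂ] ℋ}
    (hH : ∀ h ∈ H, h ∈ X₁.domain) {h : ℋ} (hh : h ∈ H) :
    oneParticleMap H X₁ hH h = X₁ ⟨h, hH h hh⟩ := by
  have : realProj H h = h := by
    open ClosedSubmodule in
    exact H.toSubmodule.starProjection_eq_self_iff.2 hh
  change X₁ ⟨realProj H h, _⟩ = _
  congr 2

theorem oneParticleMap_realProj {H : ClosedSubmodule ℝ ℋ} {X₁ : ℋ →ₗ.[ℂ] ℋ}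
    (hH : ∀ h ∈ H, h ∈ X₁.domain) (x : ℋ) :
    oneParticleMap H X₁ hH (realProj H x) = oneParticleMap H X₁ hH x :=
  oneParticleMap_apply_of_mem hH (realProj_mem H x)

theorem norm_realProj_le (H : ClosedSubmodule ℝ ℋ) (x : ℋ) : ‖realProj H x‖ ≤ ‖x‖ := by
  open ClosedSubmodule in
  exact H.toSubmodule.norm_starProjection_apply_le x

/-- A bound on `R X₁` over unit vectors of `H` follows from a bound of `R` on the one particle
components of `Ξ`. -/
theorem norm_comp_oneParticleMap_le {H : ClosedSubmodule ℝ ℋ} {X₁ : ℋ →ₗ.[ℂ] ℋ}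
    (hX₁ : IsSelfAdjoint X₁) (hH : ∀ h ∈ H, h ∈ X₁.domain)
    (hX : ∀ A ∈ secondQuantizedAlgebra H, A (vacuum ℋ) ∈ (secondQuantization X₁).domain)
    (R : ℋ →L[ℂ] ℋ) {m : ℝ} (hm : 0 ≤ m)
    (hR : ∀ A : secondQuantizedAlgebra H,
      ‖R (ContinuousLinearMap.adjoint oneParticle (xiMap H X₁ hX A))‖ ≤ m * ‖A‖) (x : ℋ) :
    ‖R (oneParticleMap H X₁ hH x)‖ ≤ Real.sqrt (Real.exp 1) * m * ‖x‖ := by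
  rw [← oneParticleMap_realProj]
  refine le_trans ?_ (mul_le_mul_of_nonneg_left (norm_realProj_le H x) (by positivity))
  have hh := realProj_mem H x
  generalize realProj H x = h at hh ⊢
  rcases eq_or_ne h 0 with rfl | h0
  · simp
  have hpos : 0 < ‖h‖ := norm_pos_iff.2 h0
  -- h ↦ W(h) is not linear, so the bound is taken at unit vectors and extended by homogeneity. At
  -- norm 1 the Gaussian weight is e^{-1/2}, the source of √e.
  let u : ℋ := (‖h‖⁻¹ : ℝ) • h
  have hu : u ∈ H := H.toSubmodule.smul_mem _ hh
  have hun : ‖u‖ = 1 := by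
    rw [norm_smul, Real.norm_of_nonneg (inv_nonneg.2 hpos.le), inv_mul_cancel₀ hpos.ne']
  have hhu : h = (‖h‖ : ℝ) • u := by rw [smul_smul, mul_inv_cancel₀ hpos.ne', one_smul]
  have h1 := hR ⟨weyl u, weyl_mem hu⟩
  rw [oneParticle_adjoint_xiMap_weyl hX₁ hH hX hu, map_smul, norm_smul, norm_mul,
    Complex.norm_real, Complex.norm_I, mul_one, Real.norm_of_nonneg (Real.exp_nonneg _), hun] at h1
  have h2 : m * ‖(⟨weyl u, weyl_mem hu⟩ : secondQuantizedAlgebra H)‖ ≤ m :=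
    mul_le_of_le_one_right hm (norm_weyl_le u)
  have h3 : ‖R (oneParticleMap H X₁ hH u)‖ ≤ Real.sqrt (Real.exp 1) * m := by
    rw [oneParticleMap_apply_of_mem hH hu]
    have h4 := h1.trans h2
    rw [← Real.exp_half]
    calc ‖R (X₁ ⟨u, hH u hu⟩)‖
        = Real.exp (1 / 2) * (Real.exp (-1 ^ 2 / 2) * ‖R (X₁ ⟨u, hH u hu⟩)‖) := by
          rw [← mul_assoc, ← Real.exp_add]
          norm_num
      _ ≤ _ := by gcongr
  rw [hhu, map_smul, ← Complex.coe_smul, map_smul, Complex.coe_smul, norm_smul, norm_smul, hun,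
    norm_norm, mul_one, mul_comm]
  gcongr

/-- An approximation S of Ξ cannot simply be composed with h ↦ W(h), which is not linear. Only the
space V of one particle components of the range of S is used: the projection onto Vᗮ annihilates S
and so bounds the part of X₁ E_H outside V. V has complex dimension at most n, hence real dimension
at most 2n. -/
theorem approxNumber_oneParticleMap_le {H : ClosedSubmodule ℝ ℋ} {X₁ : ℋ →ₗ.[ℂ] ℋ}
    (hX₁ : IsSelfAdjoint X₁) (hH : ∀ h ∈ H, h ∈ X₁.domain)
    (hX : ∀ A ∈ secondQuantizedAlgebra H, A (vacuum ℋ) ∈ (secondQuantization X₁).domain) (n : ℕ) :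
    approxNumber (2 * n) (oneParticleMap H X₁ hH)
      ≤ ENNReal.ofReal (Real.sqrt (Real.exp 1)) * approxNumber n (xiMap H X₁ hX) := by
  have hne : ENNReal.ofReal (Real.sqrt (Real.exp 1)) ≠ 0 := by simp [Real.exp_pos]
  unfold approxNumber
  rw [ENNReal.mul_iInf_of_ne hne ENNReal.ofReal_ne_top]
  refine le_iInf fun S => ?_
  rw [ENNReal.mul_iInf_of_ne hne ENNReal.ofReal_ne_top]
  refine le_iInf fun hS => ?_
  rcases eq_or_ne (opENorm (xiMap H X₁ hX - (S : secondQuantizedAlgebra H →ₗ[ℂ] FockSpace ℋ))) ∞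
    with htop | htop
  · rw [htop, ENNReal.mul_top hne]
    exact le_top
  have hm := norm_apply_le_of_opENorm_ne_top htop
  set m : ℝ := (opENorm (xiMap H X₁ hX - (S : secondQuantizedAlgebra H →ₗ[ℂ] FockSpace ℋ))).toReal
    with hmdef
  have hm0 : 0 ≤ m := ENNReal.toReal_nonneg
  let P : FockSpace ℋ →L[ℂ] ℋ := ContinuousLinearMap.adjoint oneParticle
  have hP : ‖P‖ ≤ 1 := by
    rw [LinearIsometryEquiv.norm_map]
    exact ContinuousLinearMap.opNorm_le_bound _ zero_le_one fun f => by
      rw [norm_oneParticle_apply, one_mul]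
  have hPle : ∀ ψ, ‖P ψ‖ ≤ ‖ψ‖ := fun ψ =>
    (P.le_opNorm ψ).trans (mul_le_of_le_one_left (norm_nonneg _) hP)
  let V : Submodule ℂ ℋ := LinearMap.range ((P ∘L S : secondQuantizedAlgebra H →L[ℂ] ℋ) :
    secondQuantizedAlgebra H →ₗ[ℂ] ℋ)
  have hVrank : Module.rank ℂ V ≤ n :=
    (LinearMap.rank_comp_le_right (S : secondQuantizedAlgebra H →ₗ[ℂ] FockSpace ℋ)
      (P : FockSpace ℋ →ₗ[ℂ] ℋ)).trans hS
  have : FiniteDimensional ℂ V :=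
    Module.rank_lt_aleph0_iff.1 (hVrank.trans_lt (Cardinal.natCast_lt_aleph0))
  let R : ℋ →L[ℂ] ℋ := Vᗮ.starProjection
  have hRS : ∀ A, R (P (S A)) = 0 := fun A =>
    (Submodule.starProjection_apply_eq_zero_iff _).2
      (V.le_orthogonal_orthogonal (LinearMap.mem_range_self _ A))
  have hRle : ∀ x, ‖R x‖ ≤ ‖x‖ := fun x => Vᗮ.norm_starProjection_apply_le x
  have hR := norm_comp_oneParticleMap_le hX₁ hH hX R hm0 fun A => by
    have : R (P (xiMap H X₁ hX A)) = R (P (xiMap H X₁ hX A - S A)) := by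
      rw [map_sub, map_sub, hRS, sub_zero]
    change ‖R (P (xiMap H X₁ hX A))‖ ≤ _
    rw [this]
    exact (hRle _).trans ((hPle _).trans (hm A))
  -- The same bound without projection shows that X₁ E_H is bounded, so that its compression to V is
  -- an admissible competitor.
  have hbd := norm_comp_oneParticleMap_le hX₁ hH hX (ContinuousLinearMap.id ℂ ℋ)
    (m := m + ‖S‖) (by positivity) fun A => by
      refine (hPle _).trans ?_
      have h1 := norm_add_le (xiMap H X₁ hX A - S A) (S A)
      rw [sub_add_cancel] at h1
      have h2 := hm A
      have h3 := S.le_opNorm A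
      rw [add_mul]
      exact h1.trans (add_le_add h2 h3)
  let T : ℋ →L[ℝ] ℋ := (oneParticleMap H X₁ hH).mkContinuous _ hbd
  let S' : ℋ →L[ℝ] ℋ := (V.starProjection.restrictScalars ℝ) ∘L T
  refine iInf₂_le_of_le S' ?_ ?_
  · have hle : LinearMap.range (S' : ℋ →ₗ[ℝ] ℋ) ≤ V.restrictScalars ℝ := by
      rintro _ ⟨x, rfl⟩
      exact V.starProjection_apply_mem (T x)
    refine (Submodule.rank_mono hle).trans ?_
    have h2 : Module.rank ℝ (V.restrictScalars ℝ) = 2 * Module.rank ℂ V :=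
      rank_real_of_complex V
    rw [h2]
    push_cast
    gcongr
  · rw [← ENNReal.ofReal_toReal htop, ← ENNReal.ofReal_mul (by positivity)]
    refine opENorm_le_ofReal (by positivity) fun x => ?_
    refine le_of_eq_of_le ?_ (hR x)
    change ‖T x - V.starProjection (T x)‖ = ‖R (T x)‖
    rw [V.starProjection_orthogonal_val]

theorem ellQuasiNorm_oneParticleMap_le {H : ClosedSubmodule ℝ ℋ} {X₁ : ℋ →ₗ.[ℂ] ℋ}
    (hX₁ : IsSelfAdjoint X₁) (hH : ∀ h ∈ H, h ∈ X₁.domain)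
    (hX : ∀ A ∈ secondQuantizedAlgebra H, A (vacuum ℋ) ∈ (secondQuantization X₁).domain)
    {p : ℝ} (hp : 0 < p) :
    ellQuasiNorm p (oneParticleMap H X₁ hH) ≤
      ENNReal.ofReal (Real.sqrt (Real.exp 1) * 2 ^ (1 / p)) *
        ellQuasiNorm p (xiMap H X₁ hX) := by
  have h1 : ∑' n, approxNumber n (oneParticleMap H X₁ hH) ^ p
      ≤ 2 * (ENNReal.ofReal (Real.sqrt (Real.exp 1)) ^ p
        * ∑' n, approxNumber n (xiMap H X₁ hX) ^ p) := by
    -- Only even indices are controlled, and monotonicity makes the odd ones cost a factor 2, which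
    -- becomes 2^{1/p}.
    refine (tsum_le_two_mul_tsum_even fun m n hmn =>
      ENNReal.rpow_le_rpow (approxNumber_antitone _ hmn) hp.le).trans ?_
    rw [← ENNReal.tsum_mul_left (a := ENNReal.ofReal (√(Real.exp 1)) ^ p)]
    refine mul_le_mul_right (ENNReal.tsum_le_tsum fun n => ?_) 2
    rw [← ENNReal.mul_rpow_of_nonneg _ _ hp.le]
    exact ENNReal.rpow_le_rpow (approxNumber_oneParticleMap_le hX₁ hH hX n) hp.le
  have hp' : 0 ≤ 1 / p := by positivity
  refine (ENNReal.rpow_le_rpow h1 hp').trans (le_of_eq ?_)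
  rw [ENNReal.mul_rpow_of_nonneg _ _ hp', ENNReal.mul_rpow_of_nonneg _ _ hp', ← ENNReal.rpow_mul,
    mul_one_div_cancel hp.ne', ENNReal.rpow_one, ← mul_assoc, ellQuasiNorm,
    ENNReal.ofReal_mul (Real.sqrt_nonneg _), mul_comm (ENNReal.ofReal (√(Real.exp 1))),
    ← ENNReal.ofReal_rpow_of_pos two_pos, ENNReal.ofReal_ofNat]

end BoseFock

end


noncomputable section

/-! ### `p`-nuclear maps -/

section Nuclear

variable {𝕜 E F : Type*} [RCLike 𝕜]
  [NormedAddCommGroup E] [NormedSpace 𝕜 E] [NormedAddCommGroup F] [NormedSpace 𝕜 F]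

/-- Summability leaves countably many nonzero terms, which are placed injectively in ℕ and padded
with zeros. -/
theorem isPNuclear_of_hasSum {ι : Type*} {T : E →ₗ[𝕜] F} {p : ℝ} (hp : 0 < p)
    (φ : ι → (E →L[𝕜] 𝕜)) (b : ι → F) (hT : ∀ x, HasSum (fun i => φ i x • b i) (T x))
    (hs : Summable fun i => ‖φ i‖ ^ p * ‖b i‖ ^ p) : IsPNuclear p T := by
  let s : Set ι := Function.support fun i => ‖φ i‖ ^ p * ‖b i‖ ^ p
  have hsc : s.Countable := hs.countable_support
  obtain ⟨e, he⟩ : ∃ e : s → ℕ, Function.Injective e := by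
    have := hsc.to_subtype
    exact exists_injective_nat s
  let φ' : ℕ → (E →L[𝕜] 𝕜) := Function.extend e (fun i => φ i) 0
  let b' : ℕ → F := Function.extend e (fun i => b i) 0
  have hφ' : ∀ i : s, φ' (e i) = φ i := fun i => he.extend_apply _ _ i
  have hb' : ∀ i : s, b' (e i) = b i := fun i => he.extend_apply _ _ i
  have hb0 : ∀ n, n ∉ Set.range e → b' n = 0 := fun n hn =>
    Function.extend_apply' _ _ _ fun ⟨i, hi⟩ => hn ⟨i, hi⟩
  refine ⟨φ', b', fun x => ?_, ?_⟩
  · refine (he.hasSum_iff (fun n hn => by rw [hb0 n hn, smul_zero])).1 ?_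
    have h1 : (fun n => φ' n x • b' n) ∘ e = (fun i => φ i x • b i) ∘ ((↑) : s → ι) := by
      funext i
      simp only [Function.comp_apply, hφ', hb']
    rw [h1]
    refine (hasSum_subtype_iff_of_support_subset ?_).2 (hT x)
    intro i hi hi0
    have : ‖φ i‖ ^ p * ‖b i‖ ^ p = 0 := by simpa [s] using hi0
    rcases mul_eq_zero.1 this with h | h
    · rw [Real.rpow_eq_zero (norm_nonneg _) hp.ne', norm_eq_zero] at h
      simp [h] at hi
    · rw [Real.rpow_eq_zero (norm_nonneg _) hp.ne', norm_eq_zero] at h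
      simp [h] at hi
  · refine (he.summable_iff (fun n hn => ?_)).1 ?_
    · rw [hb0 n hn, norm_zero, Real.zero_rpow hp.ne', mul_zero]
    · have h1 : (fun n => ‖φ' n‖ ^ p * ‖b' n‖ ^ p) ∘ e
          = (fun i => ‖φ i‖ ^ p * ‖b i‖ ^ p) ∘ ((↑) : s → ι) := by
        funext i
        simp only [Function.comp_apply, hφ', hb']
      rw [h1]
      exact hs.subtype s

/-- All but finitely many terms are at most 1, where x ≤ x^p. -/
theorem summable_of_summable_rpow {ι : Type*} {x : ι → ℝ} (hx : ∀ n, 0 ≤ x n) {p : ℝ} (hp : 0 < p)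
    (hp1 : p ≤ 1) (hs : Summable fun n => x n ^ p) : Summable x := by
  refine Summable.of_norm_bounded_eventually hs ?_
  have h := hs.tendsto_cofinite_zero.eventually (gt_mem_nhds one_pos)
  filter_upwards [h] with n hn
  rw [Real.norm_of_nonneg (hx n)]
  have h1 : x n ≤ 1 := by
    by_contra! hc
    exact absurd hn (not_lt.2 (Real.one_le_rpow hc.le hp.le))
  calc x n = x n ^ (1 : ℝ) := (Real.rpow_one _).symm
    _ ≤ x n ^ p := Real.rpow_le_rpow_of_exponent_ge_of_imp (hx n) h1 hp1
        (fun _ h => absurd h one_ne_zero)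

theorem norm_smulRight_le (φ : E →L[𝕜] 𝕜) (b : F) : ‖φ.smulRight b‖ ≤ ‖φ‖ * ‖b‖ :=
  (ContinuousLinearMap.norm_smulRight_apply φ b).le

theorem rank_sum_smulRight_le (φ : ℕ → (E →L[𝕜] 𝕜)) (b : ℕ → F) (s : Finset ℕ) :
    LinearMap.rank ((∑ n ∈ s, (φ n).smulRight (b n) : E →L[𝕜] F) : E →ₗ[𝕜] F) ≤ s.card := by
  classical
  have hle : LinearMap.range ((∑ n ∈ s, (φ n).smulRight (b n) : E →L[𝕜] F) : E →ₗ[𝕜] F)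
      ≤ Submodule.span 𝕜 ((s.image b : Finset F) : Set F) := by
    rintro _ ⟨x, rfl⟩
    rw [ContinuousLinearMap.coe_coe, sum_apply]
    refine Submodule.sum_mem _ fun n hn => ?_
    exact Submodule.smul_mem _ _ (Submodule.subset_span (Finset.mem_image_of_mem b hn))
  refine (Submodule.rank_mono hle).trans ((rank_span_finset_le _).trans ?_)
  exact_mod_cast Finset.card_image_le

theorem isCompactOperator_smulRight (φ : E →L[𝕜] 𝕜) (b : F) :
    IsCompactOperator (φ.smulRight b) := by
  have h : IsCompactOperator (ContinuousLinearMap.toSpanSingleton 𝕜 b) :=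
    isCompactOperator_of_locallyCompactSpace_rng _
  exact h.comp_clm φ

/-- For p ≤ 1 the rank one terms are absolutely summable in operator norm, so the map is a norm
limit of finite rank maps. -/
theorem IsPNuclear.isCompactOperator [CompleteSpace F] {T : E →ₗ[𝕜] F} {p : ℝ} (hp : 0 < p)
    (hp1 : p ≤ 1) (hT : IsPNuclear p T) : IsCompactOperator T := by
  obtain ⟨φ, b, hsum, hs⟩ := hT
  have hx : Summable fun n => ‖φ n‖ * ‖b n‖ :=
    summable_of_summable_rpow (fun n => by positivity) hp hp1
      (hs.congr fun n => (Real.mul_rpow (norm_nonneg _) (norm_nonneg _)).symm)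
  have hS : Summable fun n => (φ n).smulRight (b n) :=
    Summable.of_norm_bounded hx fun n => norm_smulRight_le _ _
  have heq : ((∑' n, (φ n).smulRight (b n) : E →L[𝕜] F) : E → F) = T := by
    funext x
    exact (hS.hasSum.mapL (ContinuousLinearMap.apply 𝕜 F x)).unique (hsum x)
  rw [← heq]
  refine isCompactOperator_of_tendsto hS.hasSum (Filter.Eventually.of_forall fun s => ?_)
  induction s using Finset.cons_induction with
  | empty => simpa using isCompactOperator_zero
  | cons n s hn ih =>
    rw [Finset.sum_cons]
    exact (isCompactOperator_smulRight _ _).add ih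

theorem approxNumber_le_of_card_le {T : E →ₗ[𝕜] F} {φ : ℕ → (E →L[𝕜] 𝕜)} {b : ℕ → F}
    (hsum : ∀ x, HasSum (fun n => φ n x • b n) (T x)) (hx : Summable fun n => ‖φ n‖ * ‖b n‖)
    {s : Finset ℕ} {n : ℕ} (hn : s.card ≤ n) :
    approxNumber n T ≤ ENNReal.ofReal (∑' k : {k // k ∉ s}, ‖φ k‖ * ‖b k‖) := by
  refine iInf₂_le_of_le (∑ k ∈ s, (φ k).smulRight (b k))
    ((rank_sum_smulRight_le φ b s).trans (by exact_mod_cast hn)) ?_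
  refine opENorm_le_ofReal (tsum_nonneg fun k => by positivity) fun x => ?_
  have hx' : Summable fun k : {k // k ∉ s} => ‖φ k‖ * ‖b k‖ := hx.subtype _
  have h1 : HasSum (fun k : {k // k ∉ s} => φ k x • b k)
      (T x - ∑ k ∈ s, φ k x • b k) := (s.hasSum_iff_compl).1 (hsum x)
  have h2 : (T - ((∑ k ∈ s, (φ k).smulRight (b k) : E →L[𝕜] F) : E →ₗ[𝕜] F)) x
      = T x - ∑ k ∈ s, φ k x • b k := by
    simp
  rw [h2, ← h1.tsum_eq, ← tsum_mul_right]
  refine tsum_of_norm_bounded (hx'.mul_right ‖x‖).hasSum fun k => ?_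
  rw [norm_smul, mul_right_comm]
  gcongr
  exact (φ k).le_opNorm x

theorem exists_approxNumber_le_of_summable_rpow {T : E →ₗ[𝕜] F} {φ : ℕ → (E →L[𝕜] 𝕜)} {b : ℕ → F}
    (hsum : ∀ x, HasSum (fun n => φ n x • b n) (T x)) {p : ℝ} (hp : 0 < p) (hp1 : p < 1)
    (hs : Summable fun n => (‖φ n‖ * ‖b n‖) ^ p) :
    ∃ K : ℝ, 0 ≤ K ∧ ∀ n : ℕ,
      approxNumber (n + 1) T ≤ ENNReal.ofReal (K * ((n : ℝ) + 1) ^ (-((1 - p) / p))) := by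
  set x : ℕ → ℝ := fun n => ‖φ n‖ * ‖b n‖ with hxdef
  have hx0 : ∀ n, 0 ≤ x n := fun n => by positivity
  have hx : Summable x := summable_of_summable_rpow hx0 hp hp1.le hs
  -- Adding 1 keeps `C` positive when all terms vanish.
  set C : ℝ := ∑' n, x n ^ p + 1 with hC
  have hC0 : 0 < C := by
    have : 0 ≤ ∑' n, x n ^ p := tsum_nonneg fun n => Real.rpow_nonneg (hx0 n) _
    linarith
  refine ⟨C ^ ((1 - p) / p) * C, by positivity, fun n => ?_⟩
  have hn0 : (0 : ℝ) < (n : ℝ) + 1 := by positivity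
  -- The threshold at which Chebyshev's inequality allows at most n + 1 larger terms. Each smaller
  -- term satisfies x ≤ ε^(1-p) x^p, so the tail is at most ε^(1-p) C.
  set ε : ℝ := (C / (n + 1)) ^ (1 / p) with hε
  have hε0 : 0 < ε := by positivity
  have hεp : ε ^ p = C / (n + 1) := by
    rw [hε, ← Real.rpow_mul (by positivity), one_div_mul_cancel hp.ne', Real.rpow_one]
  have hfin : {k | ε < x k}.Finite := by
    have h := hx.tendsto_cofinite_zero.eventually (gt_mem_nhds hε0)
    exact (Filter.eventually_cofinite.1 h).subset fun k hk => not_lt.2 (le_of_lt hk)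
  let s : Finset ℕ := hfin.toFinset
  have hmem : ∀ k, k ∈ s ↔ ε < x k := fun k => by simp [s]
  have hcard : s.card ≤ n + 1 := by
    have h1 : (s.card : ℝ) * ε ^ p ≤ C := by
      calc (s.card : ℝ) * ε ^ p = ∑ k ∈ s, ε ^ p := by simp
        _ ≤ ∑ k ∈ s, x k ^ p := Finset.sum_le_sum fun k hk =>
            Real.rpow_le_rpow hε0.le ((hmem k).1 hk).le hp.le
        _ ≤ ∑' k, x k ^ p := hs.sum_le_tsum _ fun k _ => Real.rpow_nonneg (hx0 k) _
        _ ≤ C := by linarith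
    rw [hεp, mul_div_assoc', div_le_iff₀ hn0, mul_comm C] at h1
    exact_mod_cast le_of_mul_le_mul_right h1 hC0
  refine (approxNumber_le_of_card_le hsum hx hcard).trans (ENNReal.ofReal_le_ofReal ?_)
  have h2 : ∑' k : {k // k ∉ s}, x k ≤ ε ^ (1 - p) * C := by
    have hs' : Summable fun k : {k // k ∉ s} => x k ^ p := hs.subtype _
    calc ∑' k : {k // k ∉ s}, x k ≤ ∑' k : {k // k ∉ s}, ε ^ (1 - p) * x k ^ p := by
          refine (hx.subtype _).tsum_le_tsum (fun k => ?_) (hs'.mul_left _)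
          have hk : x k ≤ ε := not_lt.1 fun h => k.2 ((hmem _).2 h)
          rcases (hx0 k).eq_or_lt with h0 | h0
          · rw [← h0]
            positivity
          · calc x k = x k ^ (1 - p) * x k ^ p := by
                  rw [← Real.rpow_add h0, sub_add_cancel, Real.rpow_one]
              _ ≤ _ := by
                  gcongr
      _ = ε ^ (1 - p) * ∑' k : {k // k ∉ s}, x k ^ p := tsum_mul_left
      _ ≤ ε ^ (1 - p) * C := by
          gcongr
          have := hs.tsum_subtype_le (fun k => x k ^ p) {k | k ∉ s}
            (fun k => Real.rpow_nonneg (hx0 k) _)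
          exact this.trans (by linarith)
  refine h2.trans (le_of_eq ?_)
  rw [hε, ← Real.rpow_mul (by positivity), one_div_mul_eq_div, Real.div_rpow hC0.le hn0.le,
    Real.rpow_neg hn0.le]
  ring

theorem IsPNuclear.isEll {T : E →ₗ[𝕜] F} {p : ℝ} (hp : 0 < p) (hp1 : p < 1)
    (hT : IsPNuclear p T) {q : ℝ} (hq : p / (1 - p) < q) : IsEll q T := by
  obtain ⟨φ, b, hsum, hs⟩ := hT
  have hs' : Summable fun n => (‖φ n‖ * ‖b n‖) ^ p :=
    hs.congr fun n => (Real.mul_rpow (norm_nonneg _) (norm_nonneg _)).symm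
  have hx : Summable fun n => ‖φ n‖ * ‖b n‖ :=
    summable_of_summable_rpow (fun n => by positivity) hp hp1.le hs'
  obtain ⟨K, hK, hle⟩ := exists_approxNumber_le_of_summable_rpow hsum hp hp1 hs'
  have h1p : 0 < 1 - p := by linarith
  have hq0 : 0 < q := lt_of_le_of_lt (by positivity) hq
  refine ENNReal.rpow_lt_top_of_nonneg (by positivity) ?_
  -- The decay estimate starts at index 1. The term at 0 is finite because the map is bounded.
  rw [tsum_eq_zero_add' ENNReal.summable]
  refine ENNReal.add_ne_top.2 ⟨?_, ?_⟩
  · have h0 := approxNumber_le_of_card_le hsum hx (s := ∅) (n := 0) (by simp)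
    exact (ENNReal.rpow_lt_top_of_nonneg hq0.le (h0.trans_lt ENNReal.ofReal_lt_top).ne).ne
  · have hsm : Summable fun n : ℕ => (K * ((n : ℝ) + 1) ^ (-((1 - p) / p))) ^ q := by
      have h1 : Summable fun n : ℕ => ((n : ℝ)) ^ (-((1 - p) / p) * q) := by
        rw [Real.summable_nat_rpow]
        have : 1 < (1 - p) / p * q := by
          rw [div_lt_iff₀ h1p] at hq
          rw [div_mul_eq_mul_div, one_lt_div hp]
          linarith
        linarith
      have h2 := ((summable_nat_add_iff 1).2 h1).mul_left (K ^ q)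
      refine h2.congr fun n => ?_
      push_cast
      rw [Real.mul_rpow hK (by positivity), ← Real.rpow_mul (by positivity)]
    refine ne_top_of_le_ne_top hsm.tsum_ofReal_ne_top (ENNReal.tsum_le_tsum fun n => ?_)
    rw [← ENNReal.ofReal_rpow_of_nonneg (by positivity) hq0.le]
    exact ENNReal.rpow_le_rpow (hle n) hq0.le

end Nuclear

end


noncomputable section

/-! ### Diagonal bounds for real linear operators -/

section Spectral

universe u

theorem isClosed_eigenspace {𝕜 V : Type*} [RCLike 𝕜] [NormedAddCommGroup V]
    [InnerProductSpace 𝕜 V] (S : V →L[𝕜] V) (μ : 𝕜) :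
    IsClosed (Module.End.eigenspace (S : Module.End 𝕜 V) μ : Set V) := by
  have : (Module.End.eigenspace (S : Module.End 𝕜 V) μ : Set V) = {x | S x = μ • x} := by
    ext x
    exact Module.End.mem_eigenspace_iff
  rw [this]
  exact isClosed_eq (by fun_prop) (by fun_prop)

/-- Hilbert bases of the members of an orthogonal family with trivial common orthogonal complement
give a Hilbert basis. -/
theorem exists_hilbertBasis_sigma {𝕜 V κ : Type*} [RCLike 𝕜] [NormedAddCommGroup V]
    [InnerProductSpace 𝕜 V] [CompleteSpace V] (G : κ → Submodule 𝕜 V)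
    [∀ μ, CompleteSpace (G μ)] (hG : OrthogonalFamily 𝕜 (fun μ => G μ) fun μ => (G μ).subtypeₗᵢ)
    (hbot : (⨆ μ, G μ)ᗮ = ⊥) {w : κ → Type*} (b : ∀ μ, HilbertBasis (w μ) 𝕜 (G μ)) :
    ∃ B : HilbertBasis (Σ μ, w μ) 𝕜 V, ∀ i, B i = ((b i.1 i.2 : G i.1) : V) := by
  have hv : Orthonormal 𝕜 fun i : Σ μ, w μ => ((b i.1 i.2 : G i.1) : V) :=
    hG.orthonormal_sigma_orthonormal fun μ => (b μ).orthonormal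
  have hsp : (Submodule.span 𝕜 (Set.range fun i : Σ μ, w μ => ((b i.1 i.2 : G i.1) : V)))ᗮ = ⊥ := by
    rw [eq_bot_iff, ← hbot]
    intro x hx
    rw [Submodule.mem_orthogonal'] at hx ⊢
    have hx' : ⨆ μ, G μ ≤ LinearMap.ker (innerₛₗ 𝕜 x) := by
      refine iSup_le fun μ y hy => ?_
      have hsum := ((b μ).hasSum_repr ⟨y, hy⟩).mapL ((innerSL 𝕜 x) ∘L (G μ).subtypeL)
      refine hsum.unique (hasSum_zero.congr_fun fun i => ?_)
      have h0 := hx (b μ i) (Submodule.subset_span ⟨⟨μ, i⟩, rfl⟩)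
      rw [map_smul]
      exact smul_eq_zero_of_right _ h0
    exact fun y hy => hx' hy
  exact ⟨HilbertBasis.mkOfOrthogonalEqBot hv hsp, fun i => by
    rw [HilbertBasis.coe_mkOfOrthogonalEqBot]⟩

/-- All eigenspaces are used, the kernel included, so the eigenvectors span without any separability
assumption. -/
theorem exists_hilbertBasis_eigenvectors {V : Type u} [NormedAddCommGroup V]
    [InnerProductSpace ℂ V] [CompleteSpace V] {S : V →L[ℂ] V} (hS : IsCompactOperator S)
    (hS' : (S : V →ₗ[ℂ] V).IsSymmetric) :
    ∃ (ι : Type u) (b : HilbertBasis ι ℂ V) (c : ι → ℂ), ∀ i, S (b i) = c i • b i := by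
  have hc : ∀ μ : ℂ, CompleteSpace (Module.End.eigenspace (S : Module.End ℂ V) μ) := fun μ =>
    (isClosed_eigenspace S μ).completeSpace_coe
  choose w b hb using fun μ : ℂ =>
    exists_hilbertBasis ℂ (Module.End.eigenspace (S : Module.End ℂ V) μ)
  obtain ⟨B, hB⟩ := exists_hilbertBasis_sigma
    (fun μ : ℂ => Module.End.eigenspace (S : Module.End ℂ V) μ) hS'.orthogonalFamily_eigenspaces
    (S.orthogonalComplement_iSup_eigenspaces_eq_bot hS hS') b
  refine ⟨Σ μ : ℂ, w μ, B, fun i => i.1, fun i => ?_⟩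
  rw [hB]
  exact Module.End.mem_eigenspace_iff.1 (b i.1 i.2).2

theorem isCompactOperator_of_finiteDimensional_range {𝕜 E F : Type*} [RCLike 𝕜]
    [NormedAddCommGroup E] [NormedSpace 𝕜 E] [NormedAddCommGroup F] [NormedSpace 𝕜 F]
    (R : E →L[𝕜] F) [FiniteDimensional 𝕜 (LinearMap.range (R : E →ₗ[𝕜] F))] :
    IsCompactOperator R := by
  let V := LinearMap.range (R : E →ₗ[𝕜] F)
  have : LocallyCompactSpace V := by
    have := FiniteDimensional.proper_rclike 𝕜 V
    infer_instance
  let R' : E →L[𝕜] V := R.codRestrict V fun x => LinearMap.mem_range_self _ x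
  exact (isCompactOperator_of_locallyCompactSpace_dom R').clm_comp V.subtypeL

variable {ℋ : Type*} [NormedAddCommGroup ℋ] [InnerProductSpace ℂ ℋ]

theorem tsum_approxNumber_rpow_ne_top {T : ℋ →ₗ[ℝ] ℋ} {p : ℝ} (hp : 0 < p) (hT : IsEll p T) :
    ∑' n, approxNumber n T ^ p ≠ ∞ := by
  intro h
  rw [IsEll, ellQuasiNorm, h, ENNReal.top_rpow_of_pos (by positivity)] at hT
  exact lt_irrefl _ hT

theorem opNorm_le_of_opENorm {T : ℋ →L[ℝ] ℋ} (h : opENorm (T : ℋ →ₗ[ℝ] ℋ) ≠ ∞) :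
    ‖T‖ ≤ (opENorm (T : ℋ →ₗ[ℝ] ℋ)).toReal :=
  T.opNorm_le_bound ENNReal.toReal_nonneg (norm_apply_le_of_opENorm_ne_top h)

theorem isCompactOperator_of_isEll [CompleteSpace ℋ] {T : ℋ →L[ℝ] ℋ} {p : ℝ} (hp : 0 < p)
    (hT : IsEll p (T : ℋ →ₗ[ℝ] ℋ)) : IsCompactOperator T := by
  have h1 := tsum_approxNumber_rpow_ne_top hp hT
  have hcl := isClosed_setOfPred_isCompactOperator (𝕜₁ := ℝ) (𝕜₂ := ℝ) (σ₁₂ := RingHom.id ℝ)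
    (M₁ := ℋ) (M₂ := ℋ)
  refine hcl.closure_subset (Metric.mem_closure_iff.2 fun ε hε => ?_)
  have h2 := ENNReal.tendsto_atTop_zero_of_tsum_ne_top h1
  obtain ⟨n, hn⟩ := (h2.eventually (gt_mem_nhds
    (show (0 : ℝ≥0∞) < ENNReal.ofReal ε ^ p from
      ENNReal.rpow_pos (by simpa using hε) (by simp)))).exists
  rw [ENNReal.rpow_lt_rpow_iff hp, approxNumber] at hn
  simp only [iInf_lt_iff] at hn
  obtain ⟨R, hR, hlt⟩ := hn
  refine ⟨R, ?_, ?_⟩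
  · have : FiniteDimensional ℝ (LinearMap.range (R : ℋ →ₗ[ℝ] ℋ)) :=
      Module.rank_lt_aleph0_iff.1 (lt_of_le_of_lt hR Cardinal.natCast_lt_aleph0)
    exact isCompactOperator_of_finiteDimensional_range R
  · rw [dist_eq_norm]
    have h3 : ((T - R : ℋ →L[ℝ] ℋ) : ℋ →ₗ[ℝ] ℋ) = (T : ℋ →ₗ[ℝ] ℋ) - (R : ℋ →ₗ[ℝ] ℋ) := rfl
    have h4 := opNorm_le_of_opENorm (T := T - R) (by rw [h3]; exact hlt.ne_top)
    rw [h3] at h4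
    refine h4.trans_lt ?_
    rwa [ENNReal.lt_ofReal_iff_toReal_lt hlt.ne_top] at hlt

/-- A real basis of the range spans a complex space of no larger dimension over ℂ. -/
theorem exists_complex_span_of_rank_le {R : ℋ →L[ℝ] ℋ} {n : ℕ}
    (hR : LinearMap.rank (R : ℋ →ₗ[ℝ] ℋ) ≤ n) :
    ∃ W : Submodule ℂ ℋ, FiniteDimensional ℂ W ∧ Module.finrank ℂ W ≤ n ∧ ∀ x, R x ∈ W := by
  let V := LinearMap.range (R : ℋ →ₗ[ℝ] ℋ)
  have hfin : FiniteDimensional ℝ V :=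
    Module.rank_lt_aleph0_iff.1 (lt_of_le_of_lt hR Cardinal.natCast_lt_aleph0)
  let e := Module.finBasis ℝ V
  refine ⟨Submodule.span ℂ (Set.range fun i => (e i : ℋ)),
    FiniteDimensional.span_of_finite ℂ (Set.finite_range _), ?_, fun x => ?_⟩
  · refine (finrank_range_le_card _).trans ?_
    rw [Fintype.card_fin]
    exact Module.finrank_le_of_rank_le hR
  · have h := congrArg Subtype.val (e.sum_repr ⟨R x, LinearMap.mem_range_self _ x⟩)
    simp only [Submodule.coe_sum, Submodule.coe_smul] at h
    rw [← h]
    refine Submodule.sum_mem _ fun i _ => ?_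
    rw [← Complex.coe_smul]
    exact Submodule.smul_mem _ _ (Submodule.subset_span ⟨i, rfl⟩)

open ClosedSubmodule

variable [CompleteSpace ℋ]

/-- The complex linear operator `T T† - i T T† i`, where `T†` is the real adjoint. -/
def symmetrization (T : ℋ →L[ℝ] ℋ) : ℋ →L[ℂ] ℋ :=
  ⟨{ toFun := fun x => T (T.adjoint x) - Complex.I • T (T.adjoint (Complex.I • x))
     map_add' := fun x y => by
       simp only [map_add, smul_add]
       abel
     map_smul' := fun c x => by
       have hre : ∀ (r : ℝ) (y : ℋ), T (T.adjoint ((r : ℂ) • y)) = (r : ℂ) • T (T.adjoint y) :=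
         fun r y => by simp only [Complex.coe_smul, map_smul]
       have hc : ∀ y : ℋ, T (T.adjoint (c • y)) = (c.re : ℂ) • T (T.adjoint y)
           + (c.im : ℂ) • T (T.adjoint (Complex.I • y)) := fun y => by
         conv_lhs => rw [← Complex.re_add_im c, add_smul, mul_smul, map_add, map_add, hre, hre]
       have hI : T (T.adjoint (Complex.I • Complex.I • x)) = -T (T.adjoint x) := by
         rw [smul_smul, Complex.I_mul_I, neg_one_smul, map_neg, map_neg]
       rw [smul_comm Complex.I c, hc, hc, hI, RingHom.id_apply]
       nth_rewrite 5 [← Complex.re_add_im c]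
       match_scalars <;> ring_nf
       simp only [Complex.I_sq]
       ring_nf },
   by
     have h1 : Continuous fun x => T (T.adjoint x) := by fun_prop
     have h2 : Continuous fun x : ℋ => T (T.adjoint (Complex.I • x)) :=
       h1.comp (continuous_const_smul _)
     exact h1.sub (h2.const_smul _)⟩

theorem symmetrization_apply (T : ℋ →L[ℝ] ℋ) (x : ℋ) :
    symmetrization T x = T (T.adjoint x) - Complex.I • T (T.adjoint (Complex.I • x)) := rfl

/-- The quadratic form is ‖T† x‖² + ‖T†(i x)‖²: it is invariant under multiplication by i and
dominates ‖T† x‖². -/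
theorem re_inner_symmetrization (T : ℋ →L[ℝ] ℋ) (x y : ℋ) :
    ⟪x, symmetrization T y⟫.re = inner ℝ (T.adjoint x) (T.adjoint y)
      + inner ℝ (T.adjoint (Complex.I • x)) (T.adjoint (Complex.I • y)) := by
  rw [ContinuousLinearMap.adjoint_inner_left, ContinuousLinearMap.adjoint_inner_left,
    inner_real_eq_re_inner, inner_real_eq_re_inner, symmetrization_apply, inner_sub_right,
    inner_smul_right, inner_smul_left]
  simp

theorem symmetrization_isSymmetric (T : ℋ →L[ℝ] ℋ) :
    (symmetrization T : ℋ →ₗ[ℂ] ℋ).IsSymmetric := by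
  intro x y
  change ⟪symmetrization T x, y⟫ = ⟪x, symmetrization T y⟫
  have him : ∀ u v : ℋ, ⟪u, v⟫.im = ⟪Complex.I • u, v⟫.re := fun u v => by
    rw [inner_smul_left]
    simp
  have hI : ∀ u : ℋ, T.adjoint (Complex.I • Complex.I • u) = -T.adjoint u := fun u => by
    rw [smul_smul, Complex.I_mul_I, neg_one_smul, map_neg]
  rw [← inner_conj_symm]
  refine Complex.ext ?_ ?_
  · rw [Complex.conj_re, re_inner_symmetrization, re_inner_symmetrization, real_inner_comm,
      real_inner_comm (T.adjoint (Complex.I • x))]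
  · rw [Complex.conj_im, him, him, re_inner_symmetrization, re_inner_symmetrization, hI, hI,
      inner_neg_left, inner_neg_left, real_inner_comm (T.adjoint x),
      real_inner_comm (T.adjoint (Complex.I • x))]
    ring

theorem isCompactOperator_symmetrization {T : ℋ →L[ℝ] ℋ} (hT : IsCompactOperator T) :
    IsCompactOperator (symmetrization T) := by
  let J : ℋ →L[ℝ] ℋ := (Complex.I • ContinuousLinearMap.id ℂ ℋ : ℋ →L[ℂ] ℋ).restrictScalars ℝ
  have h1 : IsCompactOperator (T ∘ T.adjoint) := hT.comp_clm T.adjoint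
  have h2 : IsCompactOperator (J ∘ (T ∘ T.adjoint) ∘ J) := (h1.comp_clm J).clm_comp J
  exact h1.sub h2

/-- The singular numbers of `symmetrization T` with respect to a family of vectors. -/
def symmSingular {ι : Type*} (T : ℋ →L[ℝ] ℋ) (b : ι → ℋ) (i : ι) : ℝ :=
  √(‖T.adjoint (b i)‖ ^ 2 + ‖T.adjoint (Complex.I • b i)‖ ^ 2)

/-- The left side is the quadratic form of `symmetrization T`, and this is diagonal on orthonormal
eigenvectors. For ‖T† ·‖² alone the cross terms would remain. -/
theorem norm_adjoint_sum_sq {ι : Type*} {T : ℋ →L[ℝ] ℋ} {b : ι → ℋ} (hb : Orthonormal ℂ b)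
    {c : ι → ℂ} (hc : ∀ i, symmetrization T (b i) = c i • b i) (s : Finset ι) (z : ι → ℂ) :
    ‖T.adjoint (∑ i ∈ s, z i • b i)‖ ^ 2 + ‖T.adjoint (Complex.I • ∑ i ∈ s, z i • b i)‖ ^ 2
      = ∑ i ∈ s, symmSingular T b i ^ 2 * ‖z i‖ ^ 2 := by
  have hself : ∀ g : ℋ, ‖T.adjoint g‖ ^ 2 + ‖T.adjoint (Complex.I • g)‖ ^ 2
      = ⟪g, symmetrization T g⟫.re := fun g => by
    rw [re_inner_symmetrization, real_inner_self_eq_norm_sq, real_inner_self_eq_norm_sq]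
  have hci : ∀ i, symmSingular T b i ^ 2 = (c i).re := fun i => by
    rw [symmSingular, Real.sq_sqrt (by positivity), hself, hc, inner_smul_right,
      inner_self_eq_norm_sq_to_K, hb.1 i]
    simp
  have hS : symmetrization T (∑ i ∈ s, z i • b i) = ∑ i ∈ s, (z i * c i) • b i := by
    simp only [map_sum, map_smul, hc, smul_smul]
  rw [hself, hS, hb.inner_sum, Complex.re_sum]
  refine Finset.sum_congr rfl fun i _ => ?_
  rw [hci, ← mul_assoc, ← Complex.normSq_eq_conj_mul_self, Complex.re_ofReal_mul,
    Complex.normSq_eq_norm_sq, mul_comm]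

theorem adjoint_eq_zero_of_mem_orthogonal {R : ℋ →L[ℝ] ℋ} {W : Submodule ℂ ℋ}
    (hW : ∀ x, R x ∈ W) {g : ℋ} (hg : g ∈ Wᗮ) : R.adjoint g = 0 := by
  rw [← inner_self_eq_zero (𝕜 := ℝ), ContinuousLinearMap.adjoint_inner_left,
    inner_real_eq_re_inner, ← inner_conj_symm, (Submodule.mem_orthogonal _ _).1 hg _ (hW _)]
  simp

/-- Min-max argument: the span of n + 1 eigenvectors contains a nonzero g orthogonal to the complex
span W of the range of R. There T† coincides with (T - R)†, at g and also at i g since W is complex,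
whence the factor 2. -/
theorem exists_symmSingular_sq_le {ι : Type*} {T : ℋ →L[ℝ] ℋ} {b : ι → ℋ} (hb : Orthonormal ℂ b)
    {c : ι → ℂ} (hc : ∀ i, symmetrization T (b i) = c i • b i) {n : ℕ} {s : Finset ι}
    (hs : s.card = n + 1) {R : ℋ →L[ℝ] ℋ} (hR : LinearMap.rank (R : ℋ →ₗ[ℝ] ℋ) ≤ n) :
    ∃ i ∈ s, symmSingular T b i ^ 2 ≤ 2 * ‖T - R‖ ^ 2 := by
  obtain ⟨W, hWf, hWn, hW⟩ := exists_complex_span_of_rank_le hR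
  let L : (s → ℂ) →ₗ[ℂ] W :=
    (W.orthogonalProjectionOnto : ℋ →ₗ[ℂ] W) ∘ₗ (Fintype.linearCombination ℂ fun i : s => b i)
  have hker : LinearMap.ker L ≠ ⊥ := by
    refine LinearMap.ker_ne_bot_of_finrank_lt ?_
    rw [Module.finrank_fintype_fun_eq_card, Fintype.card_coe, hs]
    omega
  obtain ⟨z, hz, hz0⟩ := Submodule.exists_mem_ne_zero_of_ne_bot hker
  have hg : Fintype.linearCombination ℂ (fun i : s => b i) z ∈ Wᗮ :=
    Submodule.orthogonalProjectionOnto_eq_zero_iff.1 hz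
  by_contra! hcon
  have hbs : Orthonormal ℂ fun i : s => b i := hb.comp _ Subtype.val_injective
  have hB := norm_adjoint_sum_sq (T := T) hbs (c := fun i => c i) (fun i => hc i) Finset.univ z
  rw [Fintype.linearCombination_apply] at hg
  set g := ∑ i, z i • b i with hgdef
  have hT : ∀ x ∈ Wᗮ, ‖T.adjoint x‖ ≤ ‖T - R‖ * ‖x‖ := fun x hx => by
    have h1 : T.adjoint x = (T - R).adjoint x := by
      rw [map_sub, sub_apply, adjoint_eq_zero_of_mem_orthogonal hW hx, sub_zero]
    rw [h1]
    refine (ContinuousLinearMap.le_opNorm _ _).trans ?_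
    rw [LinearIsometryEquiv.norm_map]
  have hgn : ‖g‖ ^ 2 = ∑ i, ‖z i‖ ^ 2 := by
    rw [← inner_self_eq_norm_sq (𝕜 := ℂ), hgdef, hbs.inner_sum]
    simp only [map_sum]
    refine Finset.sum_congr rfl fun i _ => ?_
    rw [← Complex.normSq_eq_conj_mul_self, Complex.normSq_eq_norm_sq]
    exact Complex.ofReal_re _
  have hle : ‖T.adjoint g‖ ^ 2 + ‖T.adjoint (Complex.I • g)‖ ^ 2
      ≤ ∑ i, 2 * ‖T - R‖ ^ 2 * ‖z i‖ ^ 2 := by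
    rw [← Finset.mul_sum, ← hgn]
    have h1 := hT g hg
    have h2 := hT (Complex.I • g) (Submodule.smul_mem _ _ hg)
    rw [norm_smul, Complex.norm_I, one_mul] at h2
    have h3 := pow_le_pow_left₀ (norm_nonneg _) h1 2
    have h4 := pow_le_pow_left₀ (norm_nonneg _) h2 2
    rw [mul_pow] at h3 h4
    linarith
  rw [hB] at hle
  refine absurd hle (not_le.2 ?_)
  obtain ⟨j, hj⟩ := Function.ne_iff.1 hz0
  refine Finset.sum_lt_sum (fun i _ => ?_) ⟨j, Finset.mem_univ _, ?_⟩
  · exact mul_le_mul_of_nonneg_right (hcon i i.2).le (sq_nonneg _)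
  · exact mul_lt_mul_of_pos_right (hcon j j.2) (pow_pos (norm_pos_iff.2 hj) 2)

end Spectral

end


/-! ### Summability of the singular numbers and the diagonal bound -/

noncomputable section

section Spectral

universe u

open ClosedSubmodule

variable {ℋ : Type u} [NormedAddCommGroup ℋ] [InnerProductSpace ℂ ℋ]

theorem Orthonormal.norm_sum_smul_sq {ι : Type*} {b : ι → ℋ} (hb : Orthonormal ℂ b)
    (s : Finset ι) (z : ι → ℂ) : ‖∑ i ∈ s, z i • b i‖ ^ 2 = ∑ i ∈ s, ‖z i‖ ^ 2 := by
  rw [← inner_self_eq_norm_sq (𝕜 := ℂ), hb.inner_sum]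
  simp only [map_sum]
  refine Finset.sum_congr rfl fun i _ => ?_
  rw [← Complex.normSq_eq_conj_mul_self, Complex.normSq_eq_norm_sq]
  exact Complex.ofReal_re _

variable [CompleteSpace ℋ]

theorem symmSingular_nonneg {ι : Type*} (T : ℋ →L[ℝ] ℋ) (b : ι → ℋ) (i : ι) :
    0 ≤ symmSingular T b i := Real.sqrt_nonneg _

theorem exists_symmSingular_le_approxNumber {ι : Type*} {T : ℋ →L[ℝ] ℋ} {b : ι → ℋ}
    (hb : Orthonormal ℂ b) {c : ι → ℂ} (hc : ∀ i, symmetrization T (b i) = c i • b i) {n : ℕ}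
    {s : Finset ι} (hs : s.card = n + 1) :
    ∃ i ∈ s, ENNReal.ofReal (symmSingular T b i)
      ≤ ENNReal.ofReal √2 * approxNumber n (T : ℋ →ₗ[ℝ] ℋ) := by
  obtain ⟨i, hi, hmin⟩ := s.exists_min_image (symmSingular T b) (Finset.card_pos.1 (by omega))
  refine ⟨i, hi, ?_⟩
  have hne : ENNReal.ofReal √2 ≠ 0 := by simp
  unfold approxNumber
  rw [ENNReal.mul_iInf_of_ne hne ENNReal.ofReal_ne_top]
  refine le_iInf fun R => ?_
  rw [ENNReal.mul_iInf_of_ne hne ENNReal.ofReal_ne_top]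
  refine le_iInf fun hR => ?_
  rcases eq_or_ne (opENorm ((T : ℋ →ₗ[ℝ] ℋ) - (R : ℋ →ₗ[ℝ] ℋ))) ∞ with htop | htop
  · rw [htop, ENNReal.mul_top hne]
    exact le_top
  obtain ⟨j, hj, hle⟩ := exists_symmSingular_sq_le hb hc hs hR
  have h1 : ‖T - R‖ ≤ (opENorm ((T : ℋ →ₗ[ℝ] ℋ) - (R : ℋ →ₗ[ℝ] ℋ))).toReal :=
    opNorm_le_of_opENorm (T := T - R) htop
  rw [← ENNReal.ofReal_toReal htop, ← ENNReal.ofReal_mul (Real.sqrt_nonneg _)]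
  refine ENNReal.ofReal_le_ofReal ((hmin j hj).trans ?_)
  refine le_trans ?_ (mul_le_mul_of_nonneg_left h1 (Real.sqrt_nonneg 2))
  refine le_of_sq_le_sq ?_ (by positivity)
  rwa [mul_pow, Real.sq_sqrt zero_le_two]

/-- Removing an index whose singular number is smallest compares it with the last approximation
number, and the remaining set is treated by induction. No ordering of the eigenvalues is needed. -/
theorem sum_symmSingular_rpow_le {ι : Type*} {T : ℋ →L[ℝ] ℋ} {b : ι → ℋ}
    (hb : Orthonormal ℂ b) {c : ι → ℂ} (hc : ∀ i, symmetrization T (b i) = c i • b i) {p : ℝ}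
    (hp : 0 < p) (n : ℕ) : ∀ s : Finset ι, s.card = n →
    ∑ i ∈ s, ENNReal.ofReal (symmSingular T b i) ^ p
      ≤ ∑ k ∈ Finset.range n, (ENNReal.ofReal √2 * approxNumber k (T : ℋ →ₗ[ℝ] ℋ)) ^ p := by
  classical
  induction n with
  | zero =>
    intro s hs
    simp [Finset.card_eq_zero.1 hs]
  | succ n ih =>
    intro s hs
    obtain ⟨i, hi, hle⟩ := exists_symmSingular_le_approxNumber hb hc hs
    rw [← Finset.sum_erase_add s _ hi, Finset.sum_range_succ]
    refine add_le_add (ih _ ?_) (ENNReal.rpow_le_rpow hle hp.le)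
    rw [Finset.card_erase_of_mem hi, hs, Nat.add_sub_cancel]

theorem summable_symmSingular_rpow {ι : Type*} {T : ℋ →L[ℝ] ℋ} {b : ι → ℋ}
    (hb : Orthonormal ℂ b) {c : ι → ℂ} (hc : ∀ i, symmetrization T (b i) = c i • b i) {p : ℝ}
    (hp : 0 < p) (hT : IsEll p (T : ℋ →ₗ[ℝ] ℋ)) :
    Summable fun i => symmSingular T b i ^ p := by
  have hfin : ∑' k, (ENNReal.ofReal √2 * approxNumber k (T : ℋ →ₗ[ℝ] ℋ)) ^ p ≠ ∞ := by
    simp only [ENNReal.mul_rpow_of_nonneg _ _ hp.le, ENNReal.tsum_mul_left]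
    exact ENNReal.mul_ne_top (ENNReal.rpow_ne_top_of_nonneg hp.le ENNReal.ofReal_ne_top)
      (tsum_approxNumber_rpow_ne_top hp hT)
  refine summable_of_sum_le (fun i => Real.rpow_nonneg (symmSingular_nonneg T b i) p)
    (c := (∑' k, (ENNReal.ofReal √2 * approxNumber k (T : ℋ →ₗ[ℝ] ℋ)) ^ p).toReal) fun s => ?_
  have h1 := (sum_symmSingular_rpow_le hb hc hp _ s rfl).trans (ENNReal.sum_le_tsum _)
  rw [← ENNReal.ofReal_le_iff_le_toReal hfin]
  refine le_of_eq_of_le ?_ h1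
  rw [ENNReal.ofReal_sum_of_nonneg fun i _ => Real.rpow_nonneg (symmSingular_nonneg T b i) p]
  exact Finset.sum_congr rfl fun i _ =>
    (ENNReal.ofReal_rpow_of_nonneg (symmSingular_nonneg T b i) hp.le).symm

theorem add_sq_le_of_pos {x y ε : ℝ} (hε : 0 < ε) :
    (x + y) ^ 2 ≤ (1 + ε) * x ^ 2 + (1 + 1 / ε) * y ^ 2 := by
  have h : (1 + ε) * x ^ 2 + (1 + 1 / ε) * y ^ 2 - (x + y) ^ 2 = (ε * x - y) ^ 2 / ε := by
    field_simp
    ring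
  have : 0 ≤ (ε * x - y) ^ 2 / ε := by positivity
  linarith

/-- The real adjoint of a strict contraction of class `ℓ^p` is dominated by a diagonal operator
with `p`-summable entries which are bounded away from `1`. -/
theorem exists_hilbertBasis_diagonal_bound {T : ℋ →L[ℝ] ℋ} {p : ℝ} (hp : 0 < p)
    (hT : IsEll p (T : ℋ →ₗ[ℝ] ℋ)) (hT1 : ‖T‖ < 1) :
    ∃ (ι : Type u) (b : HilbertBasis ι ℂ ℋ) (τ : ι → ℝ) (t : ℝ), t < 1 ∧
      (∀ i, 0 ≤ τ i ∧ τ i ≤ t) ∧ (Summable fun i => τ i ^ p) ∧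
      ∀ (s : Finset ι) (z : ι → ℂ),
        ‖T.adjoint (∑ i ∈ s, z i • b i)‖ ^ 2 ≤ ∑ i ∈ s, τ i ^ 2 * ‖z i‖ ^ 2 := by
  classical
  obtain ⟨ι, b, c, hc⟩ := exists_hilbertBasis_eigenvectors
    (isCompactOperator_symmetrization (isCompactOperator_of_isEll hp hT))
    (symmetrization_isSymmetric T)
  have hb := b.orthonormal
  set σ := symmSingular T b with hσ
  have hσ0 : ∀ i, 0 ≤ σ i := symmSingular_nonneg T b
  have hσs : Summable fun i => σ i ^ p := summable_symmSingular_rpow hb hc hp hT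
  have hn0 : 0 ≤ ‖T‖ := norm_nonneg T
  -- This choice gives (1 + ε) ‖T‖² = 1 - (1 - ‖T‖²)² < 1.
  set ε : ℝ := 1 - ‖T‖ ^ 2 with hε
  have hε0 : 0 < ε := by nlinarith
  set t' : ℝ := √((1 + ε) * ‖T‖ ^ 2) with ht'
  have ht'sq : t' ^ 2 = (1 + ε) * ‖T‖ ^ 2 := Real.sq_sqrt (by positivity)
  have ht'1 : t' < 1 := by
    rw [ht', Real.sqrt_lt' one_pos]
    nlinarith
  set C : ℝ := √(1 + 1 / ε) with hC
  have hCsq : C ^ 2 = 1 + 1 / ε := Real.sq_sqrt (by positivity)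
  have hC0 : 0 < C := Real.sqrt_pos.2 (by positivity)
  -- The numbers σ_i also count ‖T†(i b_i)‖ and carry the constant `C`, so they may exceed 1. For
  -- the finitely many large ones the bound by ‖T‖ is used instead, and the weighted inequality
  -- `add_sq_le_of_pos` joins the two blocks.
  let τ : ι → ℝ := fun i => if C * σ i ≤ 1 / 2 then C * σ i else t'
  have hev : ∀ᶠ i in Filter.cofinite, τ i = C * σ i := by
    have h := hσs.tendsto_cofinite_zero.eventually
      (gt_mem_nhds (show (0 : ℝ) < (1 / 2 / C) ^ p by positivity))
    filter_upwards [h] with i hi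
    rw [Real.rpow_lt_rpow_iff (hσ0 i) (by positivity) hp, lt_div_iff₀ hC0] at hi
    exact if_pos (by linarith)
  refine ⟨ι, b, τ, max t' (1 / 2), max_lt ht'1 (by norm_num), fun i => ?_, ?_, fun s z => ?_⟩
  · by_cases h : C * σ i ≤ 1 / 2
    · have : τ i = C * σ i := if_pos h
      rw [this]
      exact ⟨mul_nonneg hC0.le (hσ0 i), h.trans (le_max_right _ _)⟩
    · have : τ i = t' := if_neg h
      rw [this]
      exact ⟨Real.sqrt_nonneg _, le_max_left _ _⟩
  · refine (hσs.mul_left (C ^ p)).congr_cofinite ?_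
    filter_upwards [hev] with i hi
    rw [hi, Real.mul_rpow hC0.le (hσ0 i)]
  · rw [← Finset.sum_filter_not_add_sum_filter s (fun i => C * σ i ≤ 1 / 2) (fun i => z i • b i),
      ← Finset.sum_filter_not_add_sum_filter s (fun i => C * σ i ≤ 1 / 2)
        (fun i => τ i ^ 2 * ‖z i‖ ^ 2), map_add]
    set g' := ∑ i ∈ s with ¬C * σ i ≤ 1 / 2, z i • b i with hg'
    set g'' := ∑ i ∈ s with C * σ i ≤ 1 / 2, z i • b i with hg''
    have h1 : ‖T.adjoint g'‖ ^ 2 ≤ ‖T‖ ^ 2 * ∑ i ∈ s with ¬C * σ i ≤ 1 / 2, ‖z i‖ ^ 2 := by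
      rw [← Orthonormal.norm_sum_smul_sq hb, ← mul_pow]
      refine pow_le_pow_left₀ (norm_nonneg _) ?_ 2
      refine (ContinuousLinearMap.le_opNorm _ _).trans ?_
      rw [LinearIsometryEquiv.norm_map]
    have h2 : ‖T.adjoint g''‖ ^ 2 ≤ ∑ i ∈ s with C * σ i ≤ 1 / 2, σ i ^ 2 * ‖z i‖ ^ 2 := by
      rw [← norm_adjoint_sum_sq hb hc]
      exact le_add_of_nonneg_right (sq_nonneg _)
    calc ‖T.adjoint g' + T.adjoint g''‖ ^ 2 ≤ (‖T.adjoint g'‖ + ‖T.adjoint g''‖) ^ 2 :=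
          pow_le_pow_left₀ (norm_nonneg _) (norm_add_le _ _) 2
      _ ≤ (1 + ε) * ‖T.adjoint g'‖ ^ 2 + (1 + 1 / ε) * ‖T.adjoint g''‖ ^ 2 := add_sq_le_of_pos hε0
      _ ≤ (1 + ε) * (‖T‖ ^ 2 * ∑ i ∈ s with ¬C * σ i ≤ 1 / 2, ‖z i‖ ^ 2)
          + (1 + 1 / ε) * ∑ i ∈ s with C * σ i ≤ 1 / 2, σ i ^ 2 * ‖z i‖ ^ 2 := by gcongr
      _ = _ := by
          rw [← mul_assoc, ← ht'sq, ← hCsq, Finset.mul_sum, Finset.mul_sum]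
          congr 1
          · refine Finset.sum_congr rfl fun i hi => ?_
            have : τ i = t' := if_neg (Finset.mem_filter.1 hi).2
            rw [this]
          · refine Finset.sum_congr rfl fun i hi => ?_
            have : τ i = C * σ i := if_pos (Finset.mem_filter.1 hi).2
            rw [this]
            ring

end Spectral

end


noncomputable section

namespace BoseFock

open MeasureTheory

variable {ℋ : Type*} [NormedAddCommGroup ℋ] [InnerProductSpace ℂ ℋ] {ι : Type*}

/-! ### The occupation number basis -/

/-- The vector `∏ᵢ (a(bᵢ)^*)^{μᵢ} Ω`. -/
def occupationVec (b : ι → ℋ) (μ : ι →₀ ℕ) : FockSpace ℋ :=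
  polyVec (MvPolynomial.rename b (MvPolynomial.monomial μ 1))

/-- The product `∏ᵢ μᵢ!`. -/
def occupationFactorial (μ : ι →₀ ℕ) : ℕ := μ.prod fun _ n => n.factorial

theorem occupationFactorial_pos (μ : ι →₀ ℕ) : 0 < occupationFactorial μ :=
  Finset.prod_pos fun _ _ => Nat.factorial_pos _

theorem occupationFactorial_add_single (μ : ι →₀ ℕ) (i : ι) :
    occupationFactorial (μ + Finsupp.single i 1) = (μ i + 1) * occupationFactorial μ := by
  classical
  have h : ∀ ν : ι →₀ ℕ, ν.support ⊆ insert i μ.support →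
      occupationFactorial ν = ∏ j ∈ insert i μ.support, (ν j).factorial := fun ν hν =>
    Finsupp.prod_of_support_subset ν hν _ (by simp)
  rw [h μ (Finset.subset_insert _ _), h (μ + Finsupp.single i 1),
    ← Finset.mul_prod_erase _ _ (Finset.mem_insert_self i _),
    ← Finset.mul_prod_erase _ (fun j => (μ j).factorial) (Finset.mem_insert_self i _),
    ← mul_assoc]
  · congr 1
    · simp [Nat.factorial_succ]
    · refine Finset.prod_congr rfl fun j hj => ?_
      have : i ≠ j := (Finset.ne_of_mem_erase hj).symm
      simp [this]
  · intro j hj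
    by_cases hij : i = j
    · simp [hij]
    · simpa [hij, Ne.symm hij] using hj

/-- In orthonormal variables a(b_i) acts as ∂/∂x_i. -/
theorem annihilate_rename_orthonormal {b : ι → ℋ} (hb : Orthonormal ℂ b) (i : ι)
    (q : MvPolynomial ι ℂ) :
    annihilate (b i) (MvPolynomial.rename b q)
      = MvPolynomial.rename b (MvPolynomial.pderiv i q) := by
  classical
  have h : MvPolynomial.mkDerivation ℂ (fun j => (MvPolynomial.C ⟪b i, b j⟫ : MvPolynomial ι ℂ))
      = MvPolynomial.pderiv i := by
    refine MvPolynomial.derivation_ext fun j => ?_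
    rw [MvPolynomial.mkDerivation_X, MvPolynomial.pderiv_X, orthonormal_iff_ite.1 hb]
    by_cases hij : i = j
    · subst hij
      simp
    · simp [hij, Ne.symm hij]
  rw [annihilate_rename, h]

theorem inner_occupationVec_polyVec {b : ι → ℋ} (hb : Orthonormal ℂ b) (ν : ι →₀ ℕ)
    (q : MvPolynomial ι ℂ) :
    ⟪occupationVec b ν, polyVec (MvPolynomial.rename b q)⟫
      = occupationFactorial ν * q.coeff ν := by
  classical
  obtain ⟨s, rfl⟩ := Multiset.toFinsupp.surjective ν
  induction s using Multiset.induction_on generalizing q with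
  | empty =>
    rw [map_zero, occupationVec, show MvPolynomial.monomial (0 : ι →₀ ℕ) (1 : ℂ) = 1 from rfl,
      map_one (MvPolynomial.rename b), inner_one_polyVec, MvPolynomial.constantCoeff_rename]
    simp [occupationFactorial, MvPolynomial.constantCoeff_eq]
  | cons i s ih =>
    have hs : Multiset.toFinsupp (i ::ₘ s) = Multiset.toFinsupp s + Finsupp.single i 1 := by
      rw [← Multiset.singleton_add, map_add, Multiset.toFinsupp_singleton, add_comm]
    have hm : MvPolynomial.monomial (Multiset.toFinsupp s + Finsupp.single i 1) (1 : ℂ)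
        = MvPolynomial.X i * MvPolynomial.monomial (Multiset.toFinsupp s) 1 := by
      rw [mul_comm, MvPolynomial.X, MvPolynomial.monomial_mul, one_mul]
    have ih' := ih (MvPolynomial.pderiv i q)
    rw [occupationVec] at ih'
    rw [hs, occupationVec, hm, map_mul (MvPolynomial.rename b), MvPolynomial.rename_X,
      inner_X_mul_left, annihilate_rename_orthonormal hb, ih', MvPolynomial.coeff_pderiv,
      occupationFactorial_add_single]
    push_cast
    ring

theorem inner_occupationVec {b : ι → ℋ} (hb : Orthonormal ℂ b) [DecidableEq (ι →₀ ℕ)]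
    (ν μ : ι →₀ ℕ) :
    ⟪occupationVec b ν, occupationVec b μ⟫
      = if ν = μ then (occupationFactorial μ : ℂ) else 0 := by
  classical
  rw [occupationVec.eq_def b μ, inner_occupationVec_polyVec hb, MvPolynomial.coeff_monomial]
  by_cases h : ν = μ
  · simp [h]
  · simp [h, Ne.symm h]

theorem occupationVec_toFinsupp [DecidableEq ι] (b : ι → ℋ) (s : Multiset ι) :
    occupationVec b (Multiset.toFinsupp s) = polyVec ((s.map b).map MvPolynomial.X).prod := by
  rw [occupationVec]
  congr 1
  induction s using Multiset.induction_on with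
  | empty => simp
  | cons i s ih =>
    rw [← Multiset.singleton_add, map_add, Multiset.toFinsupp_singleton, Multiset.map_add,
      Multiset.map_add, Multiset.prod_add, ← ih, ← one_mul (1 : ℂ), ← MvPolynomial.monomial_mul,
      map_mul]
    rw [Multiset.map_singleton, Multiset.map_singleton, Multiset.prod_singleton,
      ← MvPolynomial.rename_X (R := ℂ) b i, MvPolynomial.X, one_mul]

theorem inner_occupationVec_coherent (b : ι → ℋ) (μ : ι →₀ ℕ) (g : ℋ) :
    ⟪occupationVec b μ, coherent g⟫ = μ.prod fun i n => ⟪b i, g⟫ ^ n := by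
  classical
  obtain ⟨s, rfl⟩ := Multiset.toFinsupp.surjective μ
  rw [occupationVec_toFinsupp, inner_multiset_coherent, Multiset.map_map,
    Finset.prod_multiset_map_count]
  rfl

/-- Occupation number vectors of a total family are total. -/
theorem eq_of_forall_inner_occupationVec {b : ι → ℋ}
    (hb : (Submodule.span ℂ (Set.range b)).topologicalClosure = ⊤) {ψ ψ' : FockSpace ℋ}
    (h : ∀ μ, ⟪occupationVec b μ, ψ⟫ = ⟪occupationVec b μ, ψ'⟫) : ψ = ψ' := by
  classical
  refine eq_of_forall_inner_multiset_of_total hb fun s hs => ?_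
  obtain ⟨t, rfl⟩ : ∃ t : Multiset ι, t.map b = s := by
    induction s using Multiset.induction_on with
    | empty => exact ⟨0, rfl⟩
    | cons f s ih =>
      obtain ⟨t, rfl⟩ := ih fun g hg => hs g (Multiset.mem_cons_of_mem hg)
      obtain ⟨i, rfl⟩ := hs f (Multiset.mem_cons_self f _)
      exact ⟨i ::ₘ t, by simp⟩
  rw [← occupationVec_toFinsupp]
  exact h _

/-- The normalized occupation number vectors. -/
def occupationUnitVec (b : ι → ℋ) (μ : ι →₀ ℕ) : FockSpace ℋ :=
  (((Real.sqrt (occupationFactorial μ))⁻¹ : ℝ) : ℂ) • occupationVec b μ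

theorem orthonormal_occupationUnitVec {b : ι → ℋ} (hb : Orthonormal ℂ b) :
    Orthonormal ℂ (occupationUnitVec b) := by
  classical
  rw [orthonormal_iff_ite]
  intro ν μ
  rw [occupationUnitVec, occupationUnitVec, inner_smul_left, inner_smul_right,
    inner_occupationVec hb, Complex.conj_ofReal]
  by_cases h : ν = μ
  · subst h
    have hpos : (0 : ℝ) < occupationFactorial ν := by exact_mod_cast occupationFactorial_pos ν
    rw [if_pos rfl, if_pos rfl, ← Complex.ofReal_natCast, ← Complex.ofReal_mul,
      ← Complex.ofReal_mul, ← Complex.ofReal_one]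
    congr 1
    rw [← mul_assoc, ← mul_inv, Real.mul_self_sqrt hpos.le, inv_mul_cancel₀ hpos.ne']
  · simp [h]

/-- The occupation number basis of Fock space. -/
def occupationBasis (b : HilbertBasis ι ℂ ℋ) : HilbertBasis (ι →₀ ℕ) ℂ (FockSpace ℋ) :=
  HilbertBasis.mkOfOrthogonalEqBot (orthonormal_occupationUnitVec b.orthonormal) <| by
    rw [eq_bot_iff]
    intro ψ hψ
    rw [Submodule.mem_orthogonal] at hψ
    refine eq_of_forall_inner_occupationVec b.dense_span fun μ => ?_
    have h := hψ (occupationUnitVec b μ) (Submodule.subset_span ⟨μ, rfl⟩)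
    have hpos : (0 : ℝ) < occupationFactorial μ := by exact_mod_cast occupationFactorial_pos μ
    rw [occupationUnitVec, inner_smul_left, mul_eq_zero] at h
    rw [inner_zero_right]
    refine h.resolve_left ?_
    rw [Complex.conj_ofReal]
    exact_mod_cast (inv_pos.2 (Real.sqrt_pos.2 hpos)).ne'

theorem occupationBasis_apply (b : HilbertBasis ι ℂ ℋ) (μ : ι →₀ ℕ) :
    occupationBasis b μ = occupationUnitVec b μ := by
  rw [occupationBasis, HilbertBasis.coe_mkOfOrthogonalEqBot]

/-! ### Cauchy estimates -/

theorem integral_conj_fourier_one_pow_mul (m n : ℕ) (r : ℝ) :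
    ∫ x : UnitAddCircle, (starRingEnd ℂ) (fourier 1 x) ^ m * ((r : ℂ) * fourier 1 x) ^ n
      ∂AddCircle.haarAddCircle = if n = m then (r : ℂ) ^ m else 0 := by
  have hpow : ∀ (k : ℕ) (x : UnitAddCircle), fourier 1 x ^ k = fourier (k : ℤ) x := by
    intro k x
    induction k with
    | zero => simp
    | succ k ih => rw [pow_succ, ih, Nat.cast_succ, fourier_add]
  have h := congrFun (fourierCoeff_fourier (T := 1) (n : ℤ)) (m : ℤ)
  rw [fourierCoeff] at h
  have h1 : ∀ x : UnitAddCircle,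
      (starRingEnd ℂ) (fourier 1 x) ^ m * ((r : ℂ) * fourier 1 x) ^ n
        = (r : ℂ) ^ n * (fourier (-(m : ℤ)) x • fourier (n : ℤ) x) := fun x => by
    rw [fourier_neg, ← map_pow, hpow, mul_pow, hpow, smul_eq_mul]
    ring
  simp_rw [h1]
  rw [integral_const_mul, h]
  by_cases hmn : n = m
  · simp [hmn]
  · simp [hmn, Ne.symm hmn]

theorem integral_conj_fourier_prod {s : Finset ι} (μ ν : ι →₀ ℕ) (r : ι → ℝ) :
    ∫ x : s → UnitAddCircle, (∏ i : s, (starRingEnd ℂ) (fourier 1 (x i)) ^ μ i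
        * ((r i : ℂ) * fourier 1 (x i)) ^ ν i)
        ∂(Measure.pi fun _ => AddCircle.haarAddCircle)
      = ∏ i : s, if ν i = μ i then (r i : ℂ) ^ μ i else 0 := by
  rw [integral_fintype_prod_eq_prod (fun (i : s) (x : UnitAddCircle) =>
    (starRingEnd ℂ) (fourier 1 x) ^ μ i * ((r i : ℂ) * fourier 1 x) ^ ν i)]
  exact Finset.prod_congr rfl fun i _ => integral_conj_fourier_one_pow_mul _ _ _

theorem integrable_coherent (b : ι → ℋ) (μ : ι →₀ ℕ) (r : ι → ℝ) :
    Integrable (fun x : μ.support → UnitAddCircle =>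
      (∏ i : μ.support, (starRingEnd ℂ) (fourier 1 (x i)) ^ μ i) •
        coherent (∑ i : μ.support, ((r i : ℂ) * fourier 1 (x i)) • b i))
      (Measure.pi fun _ => AddCircle.haarAddCircle) := by
  have hf : ∀ i : μ.support,
      Continuous fun x : μ.support → UnitAddCircle => (fourier 1 (x i) : ℂ) := fun i =>
    (fourier 1 : C(UnitAddCircle, ℂ)).continuous.comp (continuous_apply i)
  refine Continuous.integrable_of_hasCompactSupport ?_ (HasCompactSupport.of_compactSpace _)
  have h1 : Continuous fun x : μ.support → UnitAddCircle =>
      ∏ i : μ.support, (starRingEnd ℂ) (fourier 1 (x i)) ^ μ i :=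
    continuous_finsetProd _ fun i _ => (Complex.continuous_conj.comp (hf i)).pow _
  have h2 : Continuous fun x : μ.support → UnitAddCircle =>
      ∑ i : μ.support, ((r i : ℂ) * fourier 1 (x i)) • b i :=
    continuous_finsetSum _ fun i _ => (continuous_const.mul (hf i)).smul continuous_const
  exact h1.smul (continuous_coherent.comp h2)

/-- Occupation number vectors as Fourier coefficients of coherent vectors. -/
theorem integral_coherent (b : HilbertBasis ι ℂ ℋ) (μ : ι →₀ ℕ) (r : ι → ℝ) :
    ∫ x : μ.support → UnitAddCircle, (∏ i : μ.support, (starRingEnd ℂ) (fourier 1 (x i)) ^ μ i) •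
        coherent (∑ i : μ.support, ((r i : ℂ) * fourier 1 (x i)) • b i)
        ∂Measure.pi (fun _ => AddCircle.haarAddCircle)
      = ((∏ i ∈ μ.support, (r i : ℂ) ^ μ i) / occupationFactorial μ) • occupationVec b μ := by
  classical
  have hint := integrable_coherent b μ r
  have hfac : (occupationFactorial μ : ℂ) ≠ 0 := by
    exact_mod_cast (occupationFactorial_pos μ).ne'
  have hb := orthonormal_iff_ite.1 b.orthonormal
  refine eq_of_forall_inner_occupationVec b.dense_span fun ν => ?_
  rw [← innerSL_apply_apply ℂ, ← ContinuousLinearMap.integral_comp_comm _ hint, inner_smul_right,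
    inner_occupationVec b.orthonormal]
  simp only [innerSL_apply_apply, inner_smul_right, inner_occupationVec_coherent]
  have hcoef : ∀ (x : μ.support → UnitAddCircle) (j : ι),
      ⟪b j, ∑ i : μ.support, ((r i : ℂ) * fourier 1 (x i)) • b i⟫
        = if h : j ∈ μ.support then (r j : ℂ) * fourier 1 (x ⟨j, h⟩) else 0 := by
    intro x j
    simp only [inner_sum, inner_smul_right, hb]
    split_ifs with h
    · rw [Finset.sum_eq_single ⟨j, h⟩]
      · simp
      · intro i _ hi
        have : j ≠ i := fun hji => hi (Subtype.ext hji.symm)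
        simp [this]
      · simp
    · refine Finset.sum_eq_zero fun i _ => ?_
      have : j ≠ i := fun hji => h (hji ▸ i.2)
      simp [this]
  simp only [hcoef]
  -- If ν occupies a mode outside the support of μ, the integrand vanishes identically. Otherwise
  -- the integral factorizes over the modes.
  by_cases hν : ν.support ⊆ μ.support
  · have hprod : ∀ x : μ.support → UnitAddCircle,
        (ν.prod fun i n =>
          (if h : i ∈ μ.support then (r i : ℂ) * fourier 1 (x ⟨i, h⟩) else 0) ^ n)
          = ∏ i : μ.support, ((r i : ℂ) * fourier 1 (x i)) ^ ν i := by
      intro x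
      rw [Finsupp.prod_of_support_subset ν hν _ (by simp), ← Finset.prod_coe_sort]
      refine Finset.prod_congr rfl fun i _ => ?_
      rw [dif_pos i.2]
    simp only [hprod, ← Finset.prod_mul_distrib]
    rw [integral_conj_fourier_prod]
    by_cases h : ν = μ
    · subst h
      simp only [if_true]
      rw [div_mul_cancel₀ _ hfac, Finset.prod_coe_sort ν.support fun i => (r i : ℂ) ^ ν i]
    · rw [if_neg h, mul_zero]
      obtain ⟨i, hi⟩ := Finsupp.ne_iff.1 h
      have him : i ∈ μ.support := by
        by_contra hc
        have h1 : μ i = 0 := Finsupp.notMem_support_iff.1 hc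
        have h2 : ν i = 0 := Finsupp.notMem_support_iff.1 fun h' => hc (hν h')
        exact hi (h2.trans h1.symm)
      exact Finset.prod_eq_zero (Finset.mem_univ ⟨i, him⟩) (if_neg hi)
  · obtain ⟨i, hi, him⟩ := Finset.not_subset.1 hν
    have h : ν ≠ μ := fun h => him (h ▸ hi)
    rw [if_neg h, mul_zero]
    refine integral_eq_zero_of_ae (Filter.Eventually.of_forall fun x => ?_)
    refine mul_eq_zero_of_right _ (Finset.prod_eq_zero hi ?_)
    beta_reduce
    rw [dif_neg him]
    exact zero_pow (Finsupp.mem_support_iff.1 hi)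

/-- Cauchy estimate for the occupation number coefficients of a vector. -/
theorem norm_inner_occupationUnitVec_le (b : HilbertBasis ι ℂ ℋ) {ψ : FockSpace ℋ} {C : ℝ}
    {τ : ι → ℝ} (hψ : ∀ (s : Finset ι) (z : ι → ℂ), ‖⟪coherent (∑ i ∈ s, z i • b i), ψ⟫‖
      ≤ C * Real.exp ((∑ i ∈ s, τ i ^ 2 * ‖z i‖ ^ 2) / 2))
    (μ : ι →₀ ℕ) {r : ι → ℝ} (hr : ∀ i, 0 < r i) :
    ‖⟪occupationUnitVec b μ, ψ⟫‖ ≤ C * ∏ i ∈ μ.support,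
      (Real.sqrt (μ i).factorial / r i ^ μ i * Real.exp (τ i ^ 2 * r i ^ 2 / 2)) := by
  classical
  set M : ℝ := Real.exp ((∑ i ∈ μ.support, τ i ^ 2 * r i ^ 2) / 2) with hM
  have hfac : (0 : ℝ) < occupationFactorial μ := by exact_mod_cast occupationFactorial_pos μ
  have hR : 0 < ∏ i ∈ μ.support, r i ^ μ i := Finset.prod_pos fun i _ => pow_pos (hr i) _
  have hnorm : ∀ u : UnitAddCircle, ‖fourier 1 u‖ = 1 := fun u => Circle.norm_coe _
  -- On the torus |z_i| = r_i, so one bound serves for the whole integrand.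
  have hpt : ∀ x : μ.support → UnitAddCircle,
      ‖⟪ψ, (∏ i : μ.support, (starRingEnd ℂ) (fourier 1 (x i)) ^ μ i) •
        coherent (∑ i : μ.support, ((r i : ℂ) * fourier 1 (x i)) • b i)⟫‖ ≤ C * M := by
    intro x
    have h := hψ μ.support fun i =>
      if h : i ∈ μ.support then (r i : ℂ) * fourier 1 (x ⟨i, h⟩) else 0
    rw [← Finset.sum_coe_sort] at h
    simp only [Finset.coe_mem, dif_pos, Subtype.coe_eta] at h
    rw [inner_smul_right, norm_mul, norm_prod, Finset.prod_eq_one, one_mul, norm_inner_symm]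
    · refine h.trans (le_of_eq ?_)
      rw [hM]
      congr 3
      refine Finset.sum_congr rfl fun i hi => ?_
      rw [dif_pos hi, norm_mul, hnorm, mul_one, Complex.norm_real, Real.norm_eq_abs, sq_abs]
    · intro i _
      rw [norm_pow, RCLike.norm_conj, hnorm, one_pow]
  have hle : ‖⟪ψ, ((∏ i ∈ μ.support, (r i : ℂ) ^ μ i) / occupationFactorial μ) •
      occupationVec b μ⟫‖ ≤ C * M := by
    rw [← integral_coherent, ← innerSL_apply_apply ℂ,
      ← ContinuousLinearMap.integral_comp_comm _ (integrable_coherent b μ r)]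
    refine (norm_integral_le_of_norm_le_const (Filter.Eventually.of_forall hpt)).trans ?_
    simp
  have hRn : ‖(∏ i ∈ μ.support, (r i : ℂ) ^ μ i) / occupationFactorial μ‖
      = (∏ i ∈ μ.support, r i ^ μ i) / occupationFactorial μ := by
    rw [norm_div, norm_prod, Complex.norm_natCast]
    congr 1
    refine Finset.prod_congr rfl fun i _ => ?_
    rw [norm_pow, Complex.norm_real, Real.norm_of_nonneg (hr i).le]
  have hfs : Real.sqrt (occupationFactorial μ) = ∏ i ∈ μ.support, Real.sqrt (μ i).factorial := by
    rw [occupationFactorial, Finsupp.prod, Nat.cast_prod, Real.sqrt_prod _ fun i _ => by positivity]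
  have hprod : ∏ i ∈ μ.support,
      (Real.sqrt (μ i).factorial / r i ^ μ i * Real.exp (τ i ^ 2 * r i ^ 2 / 2))
        = Real.sqrt (occupationFactorial μ) / (∏ i ∈ μ.support, r i ^ μ i) * M := by
    rw [Finset.prod_mul_distrib, Finset.prod_div_distrib, hfs, hM, Finset.sum_div, Real.exp_sum]
  rw [inner_smul_right, norm_mul, hRn, norm_inner_symm, div_mul_eq_mul_div,
    div_le_iff₀ hfac] at hle
  have hs := Real.sqrt_pos.2 hfac
  rw [hprod, occupationUnitVec, inner_smul_left, norm_mul, Complex.conj_ofReal, Complex.norm_real,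
    norm_inv, Real.norm_of_nonneg hs.le, inv_mul_le_iff₀ hs]
  have hgoal : Real.sqrt (occupationFactorial μ) * (C * (Real.sqrt (occupationFactorial μ)
      / (∏ i ∈ μ.support, r i ^ μ i) * M))
      = C * M * occupationFactorial μ / ∏ i ∈ μ.support, r i ^ μ i := by
    conv_rhs => rw [← Real.mul_self_sqrt hfac.le]
    ring
  rw [hgoal, le_div_iff₀ hR, mul_comm]
  exact hle

end BoseFock

end


noncomputable section

/-! ### Summation over occupation numbers -/

/-- The elementary half of Stirling's formula, m! ≤ e m (m/e)^m. The inductive step is (1 -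
1/(m+1))^(m+1) ≤ 1/e. -/
theorem factorial_mul_exp_le {m : ℕ} (hm : 1 ≤ m) :
    (m.factorial : ℝ) * Real.exp m ≤ Real.exp 1 * m * (m : ℝ) ^ m := by
  induction m, hm using Nat.le_induction with
  | base => simp
  | succ m hm ih =>
    have hm0 : (0 : ℝ) < m := by exact_mod_cast hm
    have h1 : (m : ℝ) / (m + 1) ≤ Real.exp (-(1 / (m + 1))) := by
      have := Real.add_one_le_exp (-(1 / ((m : ℝ) + 1)))
      refine le_trans (le_of_eq ?_) this
      field_simp
      ring
    have h2 : ((m : ℝ) / (m + 1)) ^ (m + 1) ≤ Real.exp (-1) := by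
      refine (pow_le_pow_left₀ (by positivity) h1 (m + 1)).trans (le_of_eq ?_)
      rw [← Real.exp_nat_mul]
      congr 1
      push_cast
      field_simp
    rw [div_pow, div_le_iff₀ (by positivity), Real.exp_neg, inv_mul_eq_div,
      le_div_iff₀ (Real.exp_pos 1)] at h2
    have he : Real.exp ((m + 1 : ℕ) : ℝ) = Real.exp m * Real.exp 1 := by
      rw [Nat.cast_succ, Real.exp_add]
    rw [Nat.factorial_succ, he]
    push_cast
    calc ((m : ℝ) + 1) * m.factorial * (Real.exp m * Real.exp 1)
        = (m.factorial * Real.exp m) * ((m + 1) * Real.exp 1) := by ring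
      _ ≤ (Real.exp 1 * m * (m : ℝ) ^ m) * ((m + 1) * Real.exp 1) := by gcongr
      _ = ((m : ℝ) ^ (m + 1) * Real.exp 1) * (Real.exp 1 * (m + 1)) := by ring
      _ ≤ (m + 1) ^ (m + 1) * (Real.exp 1 * (m + 1)) := by gcongr
      _ = _ := by ring

/-- The radius √m / σ is the minimizer of r^{-m} exp(σ² r²/2). Here σ is slightly larger than τ, so
that the radius exists even if τ = 0. -/
theorem sqrt_factorial_div_le {m : ℕ} (hm : 1 ≤ m) {σ τ : ℝ} (hτ : 0 ≤ τ) (hστ : τ < σ) :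
    Real.sqrt m.factorial / (Real.sqrt m / σ) ^ m * Real.exp (τ ^ 2 * (Real.sqrt m / σ) ^ 2 / 2)
      ≤ Real.sqrt (Real.exp 1 * m) * σ ^ m := by
  have hm0 : (0 : ℝ) < m := by exact_mod_cast hm
  have hσ : 0 < σ := hτ.trans_lt hστ
  have h1 : τ ^ 2 * (Real.sqrt m / σ) ^ 2 / 2 ≤ m / 2 := by
    rw [div_pow, Real.sq_sqrt hm0.le]
    have : τ ^ 2 ≤ σ ^ 2 := by gcongr
    rw [← mul_div_assoc, div_le_div_iff_of_pos_right two_pos, div_le_iff₀ (by positivity), mul_comm]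
    gcongr
  have h2 : Real.sqrt m.factorial * Real.sqrt (Real.exp m)
      ≤ Real.sqrt (Real.exp 1 * m) * Real.sqrt m ^ m := by
    have h3 : Real.sqrt m ^ m = Real.sqrt ((m : ℝ) ^ m) := by
      rw [eq_comm, Real.sqrt_eq_iff_mul_self_eq_of_pos (by positivity), ← mul_pow,
        Real.mul_self_sqrt hm0.le]
    rw [h3, ← Real.sqrt_mul (by positivity), ← Real.sqrt_mul (by positivity)]
    exact Real.sqrt_le_sqrt (factorial_mul_exp_le hm)
  rw [← Real.exp_half] at h2
  have hpos : 0 < Real.sqrt m ^ m := by positivity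
  calc _ ≤ Real.sqrt m.factorial / (Real.sqrt m / σ) ^ m * Real.exp (m / 2) := by gcongr
    _ = (Real.sqrt m.factorial * Real.exp (m / 2)) * (σ ^ m / Real.sqrt m ^ m) := by
      rw [div_pow]
      field_simp
    _ ≤ (Real.sqrt (Real.exp 1 * m) * Real.sqrt m ^ m) * (σ ^ m / Real.sqrt m ^ m) := by gcongr
    _ = _ := by field_simp

/-- A sum over occupation numbers of products converges if the sum of the one-mode sums does. -/
theorem summable_finsupp_prod {ι : Type*} {f : ι → ℕ → ℝ} {c : ι → ℝ} (hf : ∀ i m, 0 ≤ f i m)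
    (hc : Summable c) (hfc : ∀ i N, ∑ m ∈ Finset.range N, f i (m + 1) ≤ c i) :
    Summable fun μ : ι →₀ ℕ => μ.prod f := by
  classical
  have hc0 : ∀ i, 0 ≤ c i := fun i => by simpa using hfc i 0
  have hF : ∀ μ : ι →₀ ℕ, 0 ≤ μ.prod f := fun μ => Finset.prod_nonneg fun i _ => hf i _
  refine summable_of_sum_le (c := Real.exp (∑' i, c i)) hF fun S => ?_
  let s : Finset ι := S.biUnion Finsupp.support
  obtain ⟨N, hN⟩ : ∃ N, ∀ μ ∈ S, ∀ i ∈ s, μ i ≤ N := by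
    refine ⟨S.sup fun μ => s.sup μ, fun μ hμ i hi => ?_⟩
    exact (Finset.le_sup (f := μ) hi).trans (Finset.le_sup (f := fun μ : ι →₀ ℕ => s.sup μ) hμ)
  -- `Finsupp.prod` skips unoccupied modes, so the one-mode factor at 0 has to be 1.
  let F : ι → ℕ → ℝ := fun i m => if m = 0 then 1 else f i m
  have hF0 : ∀ i m, 0 ≤ F i m := fun i m => by
    by_cases h : m = 0
    · simp [F, h]
    · simpa [F, h] using hf i m
  have hprod : ∀ μ ∈ S, μ.prod f = ∏ i ∈ s.attach, F i (μ i) := by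
    intro μ hμ
    rw [Finset.prod_attach s fun i => F i (μ i),
      ← Finset.prod_subset (Finset.subset_biUnion_of_mem Finsupp.support hμ)]
    · refine Finset.prod_congr rfl fun i hi => ?_
      simp [F, Finsupp.mem_support_iff.1 hi]
    · intro i _ hi
      simp [F, Finsupp.notMem_support_iff.1 hi]
  let e : (ι →₀ ℕ) → ∀ i ∈ s, ℕ := fun μ i _ => μ i
  have he : Set.InjOn e S := by
    intro μ hμ ν hν h
    ext i
    by_cases hi : i ∈ s
    · exact congrFun (congrFun h i) hi
    · have h0 : ∀ κ ∈ S, κ i = 0 := fun κ hκ => Finsupp.notMem_support_iff.1 fun hc =>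
        hi (Finset.mem_biUnion.2 ⟨κ, hκ, hc⟩)
      rw [h0 μ hμ, h0 ν hν]
  calc ∑ μ ∈ S, μ.prod f = ∑ g ∈ S.image e, ∏ i ∈ s.attach, F i (g i i.2) := by
        rw [Finset.sum_image he]
        exact Finset.sum_congr rfl hprod
    _ ≤ ∑ g ∈ s.pi fun _ => Finset.range (N + 1), ∏ i ∈ s.attach, F i (g i i.2) := by
        refine Finset.sum_le_sum_of_subset_of_nonneg ?_
          fun g _ _ => Finset.prod_nonneg fun i _ => hF0 _ _
        intro g hg
        obtain ⟨μ, hμ, rfl⟩ := Finset.mem_image.1 hg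
        exact Finset.mem_pi.2 fun i hi => Finset.mem_range.2 (Nat.lt_succ_of_le (hN μ hμ i hi))
    _ = ∏ i ∈ s, ∑ m ∈ Finset.range (N + 1), F i m := (Finset.prod_sum _ _ _).symm
    -- Each one-mode sum is at most 1 + c_i ≤ exp c_i, which bounds every finite product by exp (∑'
    -- c_i).
    _ ≤ ∏ i ∈ s, Real.exp (c i) := by
        refine Finset.prod_le_prod (fun i _ => Finset.sum_nonneg fun m _ => hF0 i m) fun i _ => ?_
        rw [Finset.sum_range_succ']
        have : ∑ m ∈ Finset.range N, F i (m + 1) = ∑ m ∈ Finset.range N, f i (m + 1) :=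
          Finset.sum_congr rfl fun m _ => by simp [F]
        rw [this]
        have h1 := hfc i N
        have h2 := Real.add_one_le_exp (c i)
        simp only [F, if_true]
        linarith
    _ = Real.exp (∑ i ∈ s, c i) := (Real.exp_sum _ _).symm
    _ ≤ Real.exp (∑' i, c i) := Real.exp_le_exp.2 (hc.sum_le_tsum s fun i _ => hc0 i)

theorem summable_occupation {ι : Type*} {τ : ι → ℝ} {t p : ℝ} (hp : 0 < p) (ht : t < 1)
    (hτ : ∀ i, 0 ≤ τ i ∧ τ i ≤ t) (hs : Summable fun i => τ i ^ p) :
    Summable fun μ : ι →₀ ℕ =>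
      (∏ i ∈ μ.support, Real.sqrt (Real.exp 1 * μ i) * τ i ^ μ i) ^ p := by
  -- Without modes `t` could be negative; there is then only the vacuum term.
  rcases isEmpty_or_nonempty ι with hι | ⟨⟨i₀⟩⟩
  · exact (hasSum_fintype _).summable
  have ht0 : 0 ≤ t := (hτ i₀).1.trans (hτ i₀).2
  have htp : t ^ p < 1 := Real.rpow_lt_one ht0 ht hp
  have htp0 : 0 ≤ t ^ p := Real.rpow_nonneg ht0 p
  -- One factor τ_i^p is split off from each occupied mode to give summability over the modes, and
  -- the remaining powers are bounded by those of t.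
  let a : ℕ → ℝ := fun m => Real.sqrt (Real.exp 1 * ((m : ℝ) + 1)) ^ p * (t ^ p) ^ m
  have ha : Summable a := by
    obtain ⟨y, hty, hy⟩ := exists_between htp
    have hy0 : 0 < y := htp0.trans_lt hty
    have h1 := (summable_nat_add_iff 1).2 (summable_pow_mul_geometric_of_norm_lt_one ⌈p⌉₊
      (r := y) (by rwa [Real.norm_of_nonneg hy0.le]))
    refine Summable.of_nonneg_of_le (fun m => by positivity) (fun m => ?_)
      (h1.mul_left (Real.exp 1 ^ ⌈p⌉₊ / y))
    have hw : 1 ≤ Real.exp 1 * ((m : ℝ) + 1) := by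
      have := Real.add_one_le_exp 1
      nlinarith [(Nat.cast_nonneg m : (0 : ℝ) ≤ m)]
    have h2 : Real.sqrt (Real.exp 1 * ((m : ℝ) + 1)) ^ p
        ≤ (Real.exp 1 * ((m : ℝ) + 1)) ^ ⌈p⌉₊ := by
      rw [← Real.rpow_natCast]
      refine (Real.rpow_le_rpow (Real.sqrt_nonneg _)
        (Real.sqrt_le_self_iff.2 (Or.inr hw)) hp.le).trans ?_
      exact Real.rpow_le_rpow_of_exponent_le hw (Nat.le_ceil p)
    calc a m ≤ (Real.exp 1 * ((m : ℝ) + 1)) ^ ⌈p⌉₊ * y ^ m := by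
          simp only [a]
          gcongr
      _ = _ := by
          push_cast
          rw [mul_pow]
          field_simp
          ring
  have ha0 : ∀ m, 0 ≤ a m := fun m => by positivity
  have hmain := summable_finsupp_prod (ι := ι)
    (f := fun i m => (Real.sqrt (Real.exp 1 * m) * τ i ^ m) ^ p)
    (c := fun i => (∑' m, a m) * τ i ^ p)
    (fun i m => Real.rpow_nonneg (mul_nonneg (Real.sqrt_nonneg _) (pow_nonneg (hτ i).1 _)) _)
    (hs.mul_left _) fun i N => by
      refine le_trans (Finset.sum_le_sum (g := fun m => a m * τ i ^ p) fun m _ => ?_) ?_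
      · have h0 := (hτ i).1
        rw [Real.mul_rpow (Real.sqrt_nonneg _) (pow_nonneg h0 _), pow_succ,
          Real.mul_rpow (pow_nonneg h0 _) h0, ← Real.rpow_pow_comm h0]
        have h1 : (τ i ^ p) ^ m ≤ (t ^ p) ^ m :=
          pow_le_pow_left₀ (Real.rpow_nonneg h0 p)
            (Real.rpow_le_rpow h0 (hτ i).2 hp.le) m
        simp only [a, ← mul_assoc]
        push_cast
        have h2 : 0 ≤ τ i ^ p := Real.rpow_nonneg h0 p
        gcongr
      · rw [← Finset.sum_mul]
        exact mul_le_mul_of_nonneg_right (ha.sum_le_tsum _ fun m _ => ha0 m)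
          (Real.rpow_nonneg (hτ i).1 p)
  refine hmain.congr fun μ => ?_
  rw [Finsupp.prod, Real.finsetProd_rpow]
  exact fun i _ => mul_nonneg (Real.sqrt_nonneg _) (pow_nonneg (hτ i).1 _)

end


noncomputable section

namespace BoseFock

open ClosedSubmodule Filter Topology

universe u

variable {ℋ : Type u} [NormedAddCommGroup ℋ] [InnerProductSpace ℂ ℋ]

/-! ### Nuclearity of `Ξ` -/

/-- The Cauchy estimate with the optimal radius in every occupied mode, taken with τ + ε in place of
τ since τ may vanish, and then ε → 0. -/
theorem norm_inner_occupationUnitVec_le_prod {ι : Type*} (b : HilbertBasis ι ℂ ℋ)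
    {ψ : FockSpace ℋ} {C : ℝ} (hC : 0 ≤ C) {τ : ι → ℝ} (hτ : ∀ i, 0 ≤ τ i)
    (hψ : ∀ (s : Finset ι) (z : ι → ℂ), ‖⟪coherent (∑ i ∈ s, z i • b i), ψ⟫‖
      ≤ C * Real.exp ((∑ i ∈ s, τ i ^ 2 * ‖z i‖ ^ 2) / 2)) (μ : ι →₀ ℕ) :
    ‖⟪occupationUnitVec b μ, ψ⟫‖
      ≤ C * ∏ i ∈ μ.support, Real.sqrt (Real.exp 1 * μ i) * τ i ^ μ i := by
  have hlim : Tendsto (fun ε : ℝ => C * ∏ i ∈ μ.support,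
      Real.sqrt (Real.exp 1 * μ i) * (τ i + ε) ^ μ i) (𝓝[>] 0)
      (𝓝 (C * ∏ i ∈ μ.support, Real.sqrt (Real.exp 1 * μ i) * (τ i + 0) ^ μ i)) := by
    have : Continuous fun ε : ℝ => C * ∏ i ∈ μ.support,
      Real.sqrt (Real.exp 1 * μ i) * (τ i + ε) ^ μ i := by fun_prop
    exact (this.tendsto 0).mono_left nhdsWithin_le_nhds
  simp only [add_zero] at hlim
  refine ge_of_tendsto hlim ?_
  filter_upwards [self_mem_nhdsWithin] with ε hε
  have hε : 0 < ε := hε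
  have hpos : ∀ i, 0 < τ i + ε := fun i => add_pos_of_nonneg_of_pos (hτ i) hε
  refine (norm_inner_occupationUnitVec_le b hψ μ
    (r := fun i => if μ i = 0 then 1 else Real.sqrt (μ i) / (τ i + ε)) fun i => ?_).trans ?_
  · split_ifs with h
    · exact one_pos
    · exact div_pos (Real.sqrt_pos.2 (by exact_mod_cast Nat.pos_of_ne_zero h)) (hpos i)
  · refine mul_le_mul_of_nonneg_left (Finset.prod_le_prod (fun i hi => ?_) fun i hi => ?_) hC
    · have := hpos i
      split_ifs <;> positivity
    · have h := Finsupp.mem_support_iff.1 hi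
      rw [if_neg h]
      exact sqrt_factorial_div_le (Nat.one_le_iff_ne_zero.2 h) (hτ i) (lt_add_of_pos_right _ hε)

variable [CompleteSpace ℋ] {H : ClosedSubmodule ℝ ℋ} {X₁ : ℋ →ₗ.[ℂ] ℋ}

/-- The adjoint of X₁ E_H is E_H X₁ on the domain of X₁, which converts the bound for M(H) into one
by T†. -/
theorem adjoint_oneParticleMap_apply (hX₁ : IsSelfAdjoint X₁) {hH : ∀ h ∈ H, h ∈ X₁.domain}
    {T : ℋ →L[ℝ] ℋ} (hT : (T : ℋ →ₗ[ℝ] ℋ) = oneParticleMap H X₁ hH) (g : X₁.domain) :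
    T.adjoint g = realProj H (X₁ g) := by
  refine ext_inner_right ℝ fun y => ?_
  have hTy : T y = X₁ ⟨realProj H y, hH _ (realProj_mem H y)⟩ := LinearMap.congr_fun hT y
  have h1 : inner ℝ (realProj H (X₁ g)) y = inner ℝ (X₁ g) (realProj H y) :=
    H.toSubmodule.inner_starProjection_left_eq_right _ _
  rw [ContinuousLinearMap.adjoint_inner_left, h1, inner_real_eq_re_inner, inner_real_eq_re_inner,
    hTy, ← inner_apply_comm hX₁]

theorem norm_inner_coherent_xiMap_le (hX₁ : IsSelfAdjoint X₁) {hH : ∀ h ∈ H, h ∈ X₁.domain}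
    {hX : ∀ A ∈ secondQuantizedAlgebra H, A (vacuum ℋ) ∈ (secondQuantization X₁).domain}
    {T : ℋ →L[ℝ] ℋ} (hT : (T : ℋ →ₗ[ℝ] ℋ) = oneParticleMap H X₁ hH)
    (A : secondQuantizedAlgebra H) (g : ℋ) :
    ‖⟪coherent g, xiMap H X₁ hX A⟫‖
      ≤ ‖A‖ * Real.exp (‖T.adjoint (Complex.I • g)‖ ^ 2 / 2) := by
  have hcl : IsClosed {g : ℋ | ‖⟪coherent g, xiMap H X₁ hX A⟫‖
      ≤ ‖A‖ * Real.exp (‖T.adjoint (Complex.I • g)‖ ^ 2 / 2)} := by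
    refine isClosed_le ?_ ?_
    · have := continuous_coherent (ℋ := ℋ)
      fun_prop
    · have : Continuous fun g : ℋ => T.adjoint (Complex.I • g) :=
        T.adjoint.continuous.comp (continuous_const_smul _)
      fun_prop
  refine hcl.closure_subset_iff.2 ?_ (hX₁.dense_domain g)
  intro g hg
  have h1 : T.adjoint (Complex.I • g) = realProj H (Complex.I • X₁ ⟨g, hg⟩) := by
    rw [← X₁.map_smul]
    exact adjoint_oneParticleMap_apply hX₁ hT (Complex.I • (⟨g, hg⟩ : X₁.domain))
  have h2 := inner_coherent_secondQuantization hX₁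
    ⟨(A : FockSpace ℋ →L[ℂ] FockSpace ℋ) (vacuum ℋ), hX A A.2⟩ ⟨g, hg⟩
  change ‖⟪coherent g, xiMap H X₁ hX A⟫‖ ≤ _
  change ⟪coherent g, xiMap H X₁ hX A⟫ = _ at h2
  rw [h2, h1]
  exact norm_inner_coherent_le_exp A.2 _

theorem isPNuclear_xiMap (hX₁ : IsSelfAdjoint X₁) (hH : ∀ h ∈ H, h ∈ X₁.domain)
    (hX : ∀ A ∈ secondQuantizedAlgebra H, A (vacuum ℋ) ∈ (secondQuantization X₁).domain)
    {p : ℝ} (hp : 0 < p) (hE : IsEll p (oneParticleMap H X₁ hH))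
    (h1 : opENorm (oneParticleMap H X₁ hH) < 1) : IsPNuclear p (xiMap H X₁ hX) := by
  have htop : opENorm (oneParticleMap H X₁ hH) ≠ ∞ := (h1.trans ENNReal.one_lt_top).ne
  obtain ⟨T, hT⟩ : ∃ T : ℋ →L[ℝ] ℋ, (T : ℋ →ₗ[ℝ] ℋ) = oneParticleMap H X₁ hH :=
    ⟨(oneParticleMap H X₁ hH).mkContinuous _ (norm_apply_le_of_opENorm_ne_top htop), rfl⟩
  have hT1 : ‖T‖ < 1 := by
    refine (opNorm_le_of_opENorm (by rwa [hT])).trans_lt ?_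
    rw [hT]
    exact (ENNReal.toReal_lt_toReal htop ENNReal.one_ne_top).2 h1
  obtain ⟨ι, b, τ, t, ht, hτ, hs, hbound⟩ := exists_hilbertBasis_diagonal_bound hp (hT ▸ hE) hT1
  have hest : ∀ (μ : ι →₀ ℕ) (A : secondQuantizedAlgebra H),
      ‖⟪occupationUnitVec b μ, xiMap H X₁ hX A⟫‖
        ≤ (∏ i ∈ μ.support, Real.sqrt (Real.exp 1 * μ i) * τ i ^ μ i) * ‖A‖ := by
    intro μ A
    rw [mul_comm]
    refine norm_inner_occupationUnitVec_le_prod b (norm_nonneg A) (fun i => (hτ i).1)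
      (fun s z => ?_) μ
    refine (norm_inner_coherent_xiMap_le hX₁ hT A _).trans ?_
    gcongr
    -- Multiplication by i leaves the moduli of the coefficients unchanged, so T†(i g) obeys the
    -- same diagonal bound.
    have h := hbound s fun i => Complex.I * z i
    simp only [norm_mul, Complex.norm_I, one_mul, ← smul_smul, ← Finset.smul_sum] at h
    exact h
  have hw : ∀ μ : ι →₀ ℕ,
      0 ≤ ∏ i ∈ μ.support, Real.sqrt (Real.exp 1 * μ i) * τ i ^ μ i := fun μ =>
    Finset.prod_nonneg fun i _ => mul_nonneg (Real.sqrt_nonneg _) (pow_nonneg (hτ i).1 _)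
  -- The functionals are the coefficients in the orthonormal occupation basis, so their norms alone
  -- decide p-nuclearity.
  let φ : (ι →₀ ℕ) → (secondQuantizedAlgebra H →L[ℂ] ℂ) := fun μ =>
    LinearMap.mkContinuous ((innerₛₗ ℂ (occupationUnitVec b μ)).comp (xiMap H X₁ hX)) _ (hest μ)
  refine isPNuclear_of_hasSum hp φ (occupationUnitVec b) (fun A => ?_) ?_
  · have h := (occupationBasis b).hasSum_repr (xiMap H X₁ hX A)
    simp only [HilbertBasis.repr_apply_apply, occupationBasis_apply] at h
    exact h
  · refine Summable.of_nonneg_of_le (fun μ => by positivity) (fun μ => ?_)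
      (summable_occupation hp ht hτ hs)
    rw [(orthonormal_occupationUnitVec b.orthonormal).1 μ, Real.one_rpow, mul_one]
    exact Real.rpow_le_rpow (norm_nonneg _) (LinearMap.mkContinuous_norm_le _ (hw μ) _) hp.le

end BoseFock

end


/-! ### The theorem -/

theorem theorem3p3 {ℋ : Type*} [NormedAddCommGroup ℋ] [InnerProductSpace ℂ ℋ] [CompleteSpace ℋ]
    (H : ClosedSubmodule ℝ ℋ) (X₁ : ℋ →ₗ.[ℂ] ℋ) (hX₁ : IsSelfAdjoint X₁)
    (hH : ∀ h ∈ H, h ∈ X₁.domain)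
    (hX : ∀ A ∈ secondQuantizedAlgebra H, A (vacuum ℋ) ∈ (secondQuantization X₁).domain) :
    (∀ p : ℝ, 0 < p → p ≤ 1 →
      IsEll p (oneParticleMap H X₁ hH) → opENorm (oneParticleMap H X₁ hH) < 1 →
        IsPNuclear p (xiMap H X₁ hX) ∧
        (p < 1 → ∀ q : ℝ, p / (1 - p) < q → IsEll q (xiMap H X₁ hX)) ∧
        IsCompactOperator (xiMap H X₁ hX)) ∧
    ((∀ p : ℝ, 0 < p → IsEll p (oneParticleMap H X₁ hH)) →
      opENorm (oneParticleMap H X₁ hH) < 1 →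
        ∀ q : ℝ, 0 < q → IsEll q (xiMap H X₁ hX)) ∧
    (∀ p : ℝ, 0 < p →
      ellQuasiNorm p (oneParticleMap H X₁ hH) ≤
        ENNReal.ofReal (Real.sqrt (Real.exp 1) * 2 ^ (1 / p)) *
          ellQuasiNorm p (xiMap H X₁ hX)) := by
  refine ⟨fun p hp hp1 hE h1 => ?_, fun hE h1 q hq => ?_,
    fun p hp => BoseFock.ellQuasiNorm_oneParticleMap_le hX₁ hH hX hp⟩
  · have hN := BoseFock.isPNuclear_xiMap hX₁ hH hX hp hE h1
    exact ⟨hN, fun hp1 q hq => hN.isEll hp hp1 hq, hN.isCompactOperator hp hp1⟩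
  · have hp : 0 < q / (2 * (1 + q)) := by positivity
    have hp1 : q / (2 * (1 + q)) < 1 := by
      rw [div_lt_one (by positivity)]
      linarith
    refine (BoseFock.isPNuclear_xiMap hX₁ hH hX hp (hE _ hp) h1).isEll hp hp1 ?_
    rw [div_lt_iff₀ (by linarith), mul_sub, mul_one, lt_sub_iff_add_lt, ← one_add_mul,
      ← mul_div_assoc, div_lt_iff₀ (by positivity)]
    nlinarith
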